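/- Let $M,T>0$, let $n\ge 4$ be an integer, and let $X=[0,M]$ with periodic boundary conditions; $H^s=H^s(X)$ ($s\ge 0$ real) is the $L^2$-based Sobolev space of real $M$-periodic functions, with norm $\|f\|_{H^s}^2=M\sum_{k\in\mathbb Z}(1+(2\pi k/M)^2)^s|\hat f(k)|^2$, and $C^k=C^k(X)$, $W^{k,\infty}=W^{k,\infty}(X)$ are the corresponding spaces of periodic functions. Write $\|f\|_{B_T}$ for the norm of $L^\infty([0,T];B)$. Consider $$u_t=a\,u_{xxx}+b\,u_{xx}+c\,u_x+d\,u+e ,\qquad (x,t)\in X\times[0,T], \tag{1}$$ where $a,b,c,d,e$ are real functions of $(x,t)$, $M$-periodic in $x$, with * $a\in C([0,T];C^{n+3})$, $a_t\in C([0,T];C^{n})$, $b\in C([0,T];C^{n+2})$, $b_t\in C([0,T];C^n)$, $c,d\in C([0,T];C^n)$, $e\in L^\infty([0,T];H^n)$; * $|a(x,t)|\ge a_0$ for all $x\in X$, $t\in[0,T]$, for some constant $a_0>0$; * the average modified diffusion vanishes identically: $\bar\delta(t)=\frac1M\int_0^M\frac{b(y,t)}{|a(y,t)|}\,dy=0$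 for all $t\in[0,T]$. A solution of (1) on $[0,T]$ means a function $u\in L^\infty([0,T];H^n)$ with $u(x,t)=u(x,0)+\int_0^t(au_{xxx}+bu_{xx}+cu_x+du+e)(x,s)\,ds$ for all $x$ and all $t\in[0,T]$. Put $$\tilde K=M+T+n+\|a\|_{W^{n+3,\infty}_T}+\|a_t\|_{W^{1,\infty}_T}+\|a^{-1}\|_{L^\infty_T}+\|b\|_{W^{n,\infty}_T}+\|b_t\|_{L^\infty_T}+\|c\|_{W^{n,\infty}_T}+\|d\|_{W^{n,\infty}_T}+\|e\|_{H^n_T}.$$ Below, $K>0$ depends only on $\tilde K$. Then the following hold. **Reversibility.** For every $t_0\in(0,T]$ write $\bar f(x,t)=f(M-x,t_0-t)$. The equation $$w_t=\bar a\,w_{xxx}-\bar b\,w_{xx}+\bar c\,w_x-\bar d\,w-\bar e \tag{2}$$ satisfies all the hypotheses above on $[0,t_0]$ (in particular its average modified diffusion vanishes identically), and $u$ is a solution of (1) on $[0,t_0]$ if and only if $w(x,t)=u(M-x,t_0-t)$ is a solution of (2) on $[0,t_0]$. **Solution map.** There is a continuous map $\Psi:H^n\to L^\infty([0,T];H^n)$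 such that for every $u_0\in H^n$ the function $u=\Psi(u_0)$ satisfies $\|u\|_{H^n_T}\le K(\|u_0\|_{H^n}+1)$ and 1. for all real $0\le n'<n$, $u\in C([0,T];H^{n'})$ and $\|u(t)\|_{H^{n'}}\le K(\|u_0\|_{H^n}+1)$ for all $t\in[0,T]$; 2. $u(x,0)=u_0(x)$; 3. $u$ is a solution of (1) on $[0,T]$; 4. $u$ is the only solution of (1) on $[0,T]$ with $u(x,0)=u_0(x)$; 5. moreover $u\in C([0,T];H^n)$. -/

import Mathlib

open MeasureTheory Set Filter Topology

noncomputable section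

namespace PeriodicDispersion

/-! Functions of space and time are written `f t x`; functions on the periodic interval `X = [0,M]`
are `M`-periodic functions on the line. -/

/-- The `k`-th Fourier coefficient `M⁻¹ ∫₀ᴹ f(x) exp(-2πikx/M) dx`. -/
def coeff (M : ℝ) (f : ℝ → ℝ) (k : ℤ) : ℂ :=
  (M : ℂ)⁻¹ * ∫ x in (0 : ℝ)..M,
    (f x : ℂ) * Complex.exp (-(2 * Real.pi * k * x / M : ℝ) * Complex.I)

/-- The `k`-th term of the squared `H^s` norm: `M (1 + (2πk/M)²)^s |f̂(k)|²`. -/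
def sobolevTerm (M s : ℝ) (f : ℝ → ℝ) (k : ℤ) : ℝ :=
  M * ((1 + (2 * Real.pi * k / M) ^ 2) ^ s * ‖coeff M f k‖ ^ 2)

/-- `f` belongs to the `L²`-based Sobolev space `H^s(X)` of real `M`-periodic functions.
For `s > 1/2` each class of almost everywhere equal functions in `H^s` contains exactly one
continuous function, and, as usual, `f` is required to be that representative. -/
structure MemH (M s : ℝ) (f : ℝ → ℝ) : Prop where
  periodic : Function.Periodic f M
  memLp : MemLp f 2 (volume.restrict (Ioc 0 M))
  summable : Summable (sobolevTerm M s f)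
  continuous : 1 / 2 < s → Continuous f

/-- The norm of `H^s(X)`. -/
def normH (M s : ℝ) (f : ℝ → ℝ) : ℝ :=
  Real.sqrt (∑' k : ℤ, sobolevTerm M s f k)

/-- `u ∈ L^∞([0,T]; H^s)`. The first clause is strong measurability into `H^s`: this
Hilbert space is separable and its Fourier coefficients separate points, so strong
measurability amounts to measurability of each coefficient. -/
structure MemLinftyH (M T s : ℝ) (u : ℝ → ℝ → ℝ) : Prop where
  aemeasurable : ∀ k : ℤ, AEMeasurable (fun t => coeff M (u t) k) (volume.restrict (Icc 0 T))
  ae_mem : ∀ᵐ t ∂(volume.restrict (Icc 0 T)), MemH M s (u t)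
  bounded : eLpNorm (fun t => normH M s (u t)) ⊤ (volume.restrict (Icc 0 T)) < ⊤

/-- The norm of `L^∞([0,T]; H^s)`. -/
def normLinftyH (M T s : ℝ) (u : ℝ → ℝ → ℝ) : ℝ :=
  (eLpNorm (fun t => normH M s (u t)) ⊤ (volume.restrict (Icc 0 T))).toReal

/-- `u ∈ C([0,T]; H^s)`. -/
structure MemCH (M T s : ℝ) (u : ℝ → ℝ → ℝ) : Prop where
  mem : ∀ t ∈ Icc 0 T, MemH M s (u t)
  tendsto : ∀ t ∈ Icc 0 T,
    Tendsto (fun τ => normH M s (fun x => u τ x - u t x)) (𝓝[Icc 0 T] t) (𝓝 0)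

/-- `f ∈ C([0,T]; C^k(X))`, with periodic boundary conditions. -/
structure MemCC (M T : ℝ) (k : ℕ) (f : ℝ → ℝ → ℝ) : Prop where
  periodic : ∀ t ∈ Icc 0 T, Function.Periodic (f t) M
  contDiff : ∀ t ∈ Icc 0 T, ContDiff ℝ k (f t)
  tendsto : ∀ j ≤ k, ∀ t ∈ Icc 0 T,
    TendstoUniformly (fun τ => iteratedDeriv j (f τ)) (iteratedDeriv j (f t)) (𝓝[Icc 0 T] t)

/-- `‖f‖_{L^∞([0,T]; W^{k,∞})}` for `f ∈ C([0,T]; C^k)`. -/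
def normW (T : ℝ) (k : ℕ) (f : ℝ → ℝ → ℝ) : ℝ :=
  ⨆ t : Icc (0 : ℝ) T, ∑ j ∈ Finset.range (k + 1), ⨆ x : ℝ, |iteratedDeriv j (f t) x|

/-- `f_t` on `[0,T]` (one-sided at the end points). -/
def timeDeriv (T : ℝ) (f : ℝ → ℝ → ℝ) (t x : ℝ) : ℝ :=
  derivWithin (fun τ => f τ x) (Icc 0 T) t

/-- `f` is differentiable in time and `f_t ∈ C([0,T]; C^k)`. -/
structure TimeDerivMemCC (M T : ℝ) (k : ℕ) (f : ℝ → ℝ → ℝ) : Prop where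
  differentiable : ∀ t ∈ Icc 0 T, ∀ x, DifferentiableWithinAt ℝ (fun τ => f τ x) (Icc 0 T) t
  memCC : MemCC M T k (timeDeriv T f)

/-- Regularity of the coefficients, and non-degeneracy of the dispersion. -/
structure Admissible (M T : ℝ) (n : ℕ) (a b c d e : ℝ → ℝ → ℝ) : Prop where
  a_mem : MemCC M T (n + 3) a
  a_time : TimeDerivMemCC M T n a
  b_mem : MemCC M T (n + 2) b
  b_time : TimeDerivMemCC M T n b
  c_mem : MemCC M T n c
  d_mem : MemCC M T n d
  e_mem : MemLinftyH M T n e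
  nondegenerate : ∃ a₀ : ℝ, 0 < a₀ ∧ ∀ t ∈ Icc 0 T, ∀ x, a₀ ≤ |a t x|

/-- The average modified diffusion `M⁻¹ ∫₀ᴹ b(y,t)/|a(y,t)| dy`. -/
def avgDiffusion (M : ℝ) (a b : ℝ → ℝ → ℝ) (t : ℝ) : ℝ :=
  (1 / M) * ∫ y in (0 : ℝ)..M, b t y / |a t y|

/-- The quantity on which alone the constants depend. -/
def dataSize (M T : ℝ) (n : ℕ) (a b c d e : ℝ → ℝ → ℝ) : ℝ :=
  M + T + n + normW T (n + 3) a + normW T 1 (timeDeriv T a)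
    + normW T 0 (fun t x => (a t x)⁻¹)
    + normW T n b + normW T 0 (timeDeriv T b)
    + normW T n c + normW T n d + normLinftyH M T n e

/-- The right-hand side `a u_xxx + b u_xx + c u_x + d u + e`. -/
def rhs (a b c d e u : ℝ → ℝ → ℝ) (t x : ℝ) : ℝ :=
  a t x * iteratedDeriv 3 (u t) x + b t x * iteratedDeriv 2 (u t) x
    + c t x * deriv (u t) x + d t x * u t x + e t x

/-- `u ∈ L^∞([0,T]; H^n)` solves `u_t = a u_xxx + b u_xx + c u_x + d u + e` for `t ∈ [0,T]`.
As `e` is merely bounded and measurable in time, the equation is integrated in time; the space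
derivatives are classical for `n ≥ 4`, since then `H^n ⊆ C³`. -/
structure IsSolution (M T : ℝ) (n : ℕ) (a b c d e u : ℝ → ℝ → ℝ) : Prop where
  mem : MemLinftyH M T n u
  integrable : ∀ x, IntervalIntegrable (fun s => rhs a b c d e u s x) volume 0 T
  eq : ∀ t ∈ Icc 0 T, ∀ x, u t x = u 0 x + ∫ s in (0 : ℝ)..t, rhs a b c d e u s x

/-- The reflection `(x,t) ↦ (M - x, t₀ - t)` applied to `f`. -/
def reflect (M t₀ : ℝ) (f : ℝ → ℝ → ℝ) (t x : ℝ) : ℝ := f (t₀ - t) (M - x)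

end PeriodicDispersion

end

noncomputable section

namespace PeriodicDispersion

/-! ### Linear evolution equations with bounded operators -/

section Volterra

variable {E : Type*} [NormedAddCommGroup E] [NormedSpace ℝ E]

/-! Put w = (1 + ∂ₓ)ⁿ u and S = (1 + ∂ₓ)⁻¹. Since |1 + iκ|² = 1 + κ², the L² norm of w is the Hⁿ
norm of u up to the factor √M. Since 1 + ∂ₓ is a differential operator, the Leibniz rule is exact:
(1 + ∂ₓ)ⁿ a (1 + ∂ₓ)⁻ⁿ = Σ C(n,j) a⁽ʲ⁾ Sʲ (`mulOp_smoothOp_pow`). Together with S∂ₓ = 1 - S this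
gives w_t = a w''' + (n a' + b) w'' + (c + n b' - n a' + C(n,2) a'') w' + (terms bounded in L²) + (1
+ ∂ₓ)ⁿ e (`CoeffAt.exists_remainder`).

Integration by parts turns 2 Re ∫ (f w''' + g w'') w̄ into ∫ (3f' - 2g)|w'|² plus terms without
derivatives of w. A weight ρ therefore removes the loss of derivatives if (ρa)' = (2/3) ρ (n a' +
b), that is, ρ = |a|^(2n/3 - 1) exp((2/3) ∫ b/a). As a has constant sign, this ρ is periodic exactly
when the average modified diffusion vanishes. The energy ⟨ρw, w⟩ then obeys a Gronwall inequality
whose constants depend only on the data size (`re_inner_third_order_le`,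
`CoeffAt.re_inner_weight_le`, `energy_gronwall`). The same computation at level 0, for u itself in
L², gives uniqueness (`CoeffBounds.integral_fieldOp_eq_zero`).

Existence is by a Galerkin scheme with the projection ρ⁻¹ P_N ρ, which is adapted to the weighted
inner product, so that the energy estimate holds uniformly in N (`CoeffAt.re_inner_approxOp_le`). A
subsequence converges weakly in L² at every time, the equation is tested against Fourier modes, and
the energy bound survives by weak lower semicontinuity (`exists_galerkin_limit`).

The limit is at first only weakly continuous in time. At t = 0 the energy bound prevents the norm
from jumping up, so convergence there is strong (`CoeffBounds.exists_isEvolution`). The hypotheses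
are invariant under (x,t) ↦ (M - x, t₀ - t), and by uniqueness any time can serve as the initial
time. Reflection at t₀ thus gives continuity from the left at t₀, and one more reflection gives
continuity from the right (`IsSolution.memCH`). By linearity, differences of solutions solve the
equation without source, so the solution map is Lipschitz (`CoeffBounds.norm_sub_le`). -/

theorem integral_pow_div_factorial (C t : ℝ) (m : ℕ) :
    ∫ s in (0 : ℝ)..t, C * ((C * s) ^ m / m.factorial) = (C * t) ^ (m + 1) / (m + 1).factorial := by
  have : ∀ s : ℝ, C * ((C * s) ^ m / m.factorial) = (C ^ (m + 1) / m.factorial) * s ^ m := by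
    intro s; rw [mul_pow]; ring
  simp only [this, intervalIntegral.integral_const_mul, integral_pow, Nat.factorial_succ]
  push_cast
  have h1 : (m.factorial : ℝ) ≠ 0 := by positivity
  have h2 : ((m : ℝ) + 1) ≠ 0 := by positivity
  field_simp
  ring

/-- Picard iteration: the m-th iterate of the integral operator V is Lipschitz with constant
(CT)ᵐ/m!, hence a contraction for large m. The fixed point of a contracting iterate is also fixed by
V. -/
theorem exists_volterra_of_continuous [CompleteSpace E] {T : ℝ} (hT : 0 ≤ T) {Q : ℝ → E →L[ℝ] E}
    (hQ : Continuous Q) {Φ : ℝ → E} (hΦ : Continuous Φ) :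
    ∃ w : ℝ → E, Continuous w ∧ ∀ t ∈ Icc 0 T, w t = Φ t + ∫ s in (0 : ℝ)..t, Q s (w s) := by
  obtain ⟨C, hC⟩ := (isCompact_Icc (a := (0 : ℝ)) (b := T)).exists_bound_of_continuousOn
    hQ.continuousOn
  have hC0 : 0 ≤ C := (norm_nonneg _).trans (hC 0 ⟨le_rfl, hT⟩)
  have hint : ∀ w : ℝ → E, Continuous w → Continuous fun t => ∫ s in (0 : ℝ)..t, Q s (w s) :=
    fun w hw => intervalIntegral.continuous_primitive
      (fun a b => (hQ.clm_apply hw).intervalIntegrable a b) 0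
  let V : C(Icc (0 : ℝ) T, E) → C(Icc (0 : ℝ) T, E) := fun w =>
    ⟨fun t => Φ t + ∫ s in (0 : ℝ)..t, Q s (w (projIcc 0 T hT s)), by
      have := hint (fun s => w (projIcc 0 T hT s)) (w.continuous.comp continuous_projIcc)
      fun_prop⟩
  have hV : ∀ w t, V w t = Φ t + ∫ s in (0 : ℝ)..t, Q s (w (projIcc 0 T hT s)) := fun _ _ => rfl
  have hiter : ∀ (m : ℕ) (w v : C(Icc (0 : ℝ) T, E)) (t : Icc (0 : ℝ) T),
      ‖V^[m] w t - V^[m] v t‖ ≤ (C * t) ^ m / m.factorial * dist w v := by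
    intro m w v
    induction m with
    | zero => intro t; simpa [dist_eq_norm] using ContinuousMap.dist_apply_le_dist (f := w) (g := v) t
    | succ m ih =>
      intro t
      rw [Function.iterate_succ_apply', Function.iterate_succ_apply', hV, hV, add_sub_add_left_eq_sub]
      have hc : ∀ w : C(Icc (0 : ℝ) T, E), Continuous fun s => Q s (w (projIcc 0 T hT s)) :=
        fun w => hQ.clm_apply (w.continuous.comp continuous_projIcc)
      rw [← intervalIntegral.integral_sub ((hc _).intervalIntegrable _ _)
        ((hc _).intervalIntegrable _ _), ← integral_pow_div_factorial,
        ← intervalIntegral.integral_mul_const]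
      refine intervalIntegral.norm_integral_le_of_norm_le t.2.1 ?_ (by
        apply Continuous.intervalIntegrable; fun_prop)
      refine Eventually.of_forall fun s hs => ?_
      have hs' : s ∈ Icc 0 T := ⟨hs.1.le, hs.2.trans t.2.2⟩
      rw [← map_sub, projIcc_of_mem hT hs']
      calc _ ≤ ‖Q s‖ * ‖V^[m] w ⟨s, hs'⟩ - V^[m] v ⟨s, hs'⟩‖ := (Q s).le_opNorm _
        _ ≤ C * ((C * s) ^ m / m.factorial * dist w v) := by
          have := ih ⟨s, hs'⟩
          gcongr
          exact hC s hs'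
        _ = _ := by ring
  have hlim := FloorSemiring.tendsto_pow_div_factorial_atTop (C * T)
  obtain ⟨m, hm⟩ := ((tendsto_order.1 hlim).2 (1 / 2) (by norm_num)).exists
  have hcon : ContractingWith (1 / 2) V^[m] := by
    refine ⟨by
      rw [← NNReal.coe_lt_coe]; norm_num, LipschitzWith.of_dist_le_mul fun w v => ?_⟩
    rw [ContinuousMap.dist_le (by positivity)]
    intro t
    rw [dist_eq_norm]
    refine (hiter m w v t).trans ?_
    have ht0 := t.2.1
    have : (C * t) ^ m / m.factorial ≤ (C * T) ^ m / m.factorial := by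
      gcongr; exact t.2.2
    gcongr
    push_cast
    linarith
  let w := hcon.fixedPoint
  have hw : V w = w := hcon.isFixedPt_fixedPoint_iterate
  refine ⟨fun s => w (projIcc 0 T hT s), w.continuous.comp continuous_projIcc, fun t ht => ?_⟩
  have := congrArg (fun f : C(Icc (0 : ℝ) T, E) => f ⟨t, ht⟩) hw
  simp only [hV] at this
  simp only [projIcc_of_mem hT ht]
  exact this.symm

/-- A linear Volterra equation of the second kind with continuous kernel is solvable. -/
theorem exists_volterra [CompleteSpace E] {T : ℝ} (hT : 0 ≤ T) {Q : ℝ → E →L[ℝ] E}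
    (hQ : ContinuousOn Q (Icc 0 T)) {Φ : ℝ → E} (hΦ : ContinuousOn Φ (Icc 0 T)) :
    ∃ w : ℝ → E, Continuous w ∧ ∀ t ∈ Icc 0 T, w t = Φ t + ∫ s in (0 : ℝ)..t, Q s (w s) := by
  obtain ⟨w, hw, h⟩ := exists_volterra_of_continuous hT
    (Q := IccExtend hT ((Icc 0 T).domRestrict Q)) hQ.domRestrict.Icc_extend'
    (Φ := IccExtend hT ((Icc 0 T).domRestrict Φ)) hΦ.domRestrict.Icc_extend'
  refine ⟨w, hw, fun t ht => ?_⟩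
  rw [h t ht, IccExtend_of_mem _ _ ht]
  congr 1
  refine intervalIntegral.integral_congr fun s hs => ?_
  rw [uIcc_of_le ht.1] at hs
  have : s ∈ Icc 0 T := ⟨hs.1, hs.2.trans ht.2⟩
  simp only [IccExtend_of_mem _ _ this, domRestrict_apply]

end Volterra

/-! ### Weighted energy inequality -/

section Energy

variable {H : Type*} [NormedAddCommGroup H] [InnerProductSpace ℂ H]

theorem norm_primitive_sub_le {E : Type*} [NormedAddCommGroup E] [NormedSpace ℝ E] {T B : ℝ}
    {g : ℝ → E} (hg : IntervalIntegrable g volume 0 T)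
    (hB : ∀ᵐ s ∂volume.restrict (Icc 0 T), ‖g s‖ ≤ B) {s t : ℝ} (hs : s ∈ Icc 0 T)
    (ht : t ∈ Icc 0 T) :
    ‖(∫ r in (0 : ℝ)..t, g r) - ∫ r in (0 : ℝ)..s, g r‖ ≤ B * |t - s| := by
  have hT : 0 ≤ T := hs.1.trans hs.2
  have hsub : ∀ {a b : ℝ}, a ∈ Icc 0 T → b ∈ Icc 0 T → IntervalIntegrable g volume a b :=
    fun {a b} ha hb => hg.mono_set (by
      rw [uIcc_of_le hT]; exact uIcc_subset_Icc ha hb)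
  rw [intervalIntegral.integral_interval_sub_left (hsub ⟨le_rfl, hT⟩ ht) (hsub ⟨le_rfl, hT⟩ hs)]
  refine intervalIntegral.norm_integral_le_of_norm_le_const_ae ?_
  rw [ae_restrict_iff' measurableSet_Icc] at hB
  filter_upwards [hB] with r hr hr'
  exact hr (uIcc_subset_Icc hs ht (uIoc_subset_uIcc hr'))

theorem energy_lipschitz {T L B D W : ℝ} {R : ℝ → H →L[ℂ] H}
    (hR : ∀ s ∈ Icc 0 T, ∀ t ∈ Icc 0 T, ‖R t - R s‖ ≤ L * |t - s|)
    (hD : ∀ t ∈ Icc 0 T, ‖R t‖ ≤ D) {w : ℝ → H}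
    (hw : ∀ s ∈ Icc 0 T, ∀ t ∈ Icc 0 T, ‖w t - w s‖ ≤ B * |t - s|)
    (hW : ∀ t ∈ Icc 0 T, ‖w t‖ ≤ W) {s t : ℝ} (hs : s ∈ Icc 0 T) (ht : t ∈ Icc 0 T) :
    |(inner ℂ (R t (w t)) (w t)).re - (inner ℂ (R s (w s)) (w s)).re|
      ≤ (L * W * W + D * B * W + D * W * B) * |t - s| := by
  have hW0 : 0 ≤ W := (norm_nonneg _).trans (hW t ht)
  have hD0 : 0 ≤ D := (norm_nonneg _).trans (hD t ht)
  have e : inner ℂ (R t (w t)) (w t) - inner ℂ (R s (w s)) (w s)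
      = inner ℂ ((R t - R s) (w t)) (w t) + inner ℂ (R s (w t - w s)) (w t)
        + inner ℂ (R s (w s)) (w t - w s) := by
    simp only [_root_.sub_apply, inner_sub_left, inner_sub_right, map_sub]
    ring
  rw [← Complex.sub_re, e]
  refine (Complex.abs_re_le_norm _).trans ?_
  have h1 : ‖inner ℂ ((R t - R s) (w t)) (w t)‖ ≤ (L * |t - s|) * W * W := by
    refine (norm_inner_le_norm _ _).trans ?_
    have h0 : 0 ≤ L * |t - s| := (norm_nonneg _).trans (hR s hs t ht)
    refine mul_le_mul ?_ (hW t ht) (norm_nonneg _) (by positivity)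
    exact (ContinuousLinearMap.le_of_opNorm_le _ (hR s hs t ht) _).trans
      (by gcongr; exact hW t ht)
  have h2 : ‖inner ℂ (R s (w t - w s)) (w t)‖ ≤ D * (B * |t - s|) * W := by
    refine (norm_inner_le_norm _ _).trans ?_
    have h0 : 0 ≤ B * |t - s| := (norm_nonneg _).trans (hw s hs t ht)
    gcongr
    · refine ((R s).le_opNorm _).trans ?_
      have := hw s hs t ht
      have := hD s hs
      gcongr
    · exact hW t ht
  have h3 : ‖inner ℂ (R s (w s)) (w t - w s)‖ ≤ D * W * (B * |t - s|) := by
    refine (norm_inner_le_norm _ _).trans ?_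
    gcongr
    · refine ((R s).le_opNorm _).trans ?_
      have := hD s hs
      have := hW s hs
      gcongr
    · exact hw s hs t ht
  calc _ ≤ _ := norm_add₃_le
    _ ≤ (L * |t - s|) * W * W + D * (B * |t - s|) * W + D * W * (B * |t - s|) := by gcongr
    _ = _ := by ring

/-- If `w' = g` almost everywhere and the symmetric weight `R` is Lipschitz in time, then
`2 Re ⟪R w, g⟫ + L ‖w‖² ≤ C ⟪R w, w⟫ + G` implies a Gronwall bound of `⟪R w, w⟫`. -/
theorem energy_gronwall [CompleteSpace H] {T L B C G : ℝ} (hT : 0 ≤ T) {R : ℝ → H →L[ℂ] H}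
    (hR : ∀ s ∈ Icc 0 T, ∀ t ∈ Icc 0 T, ‖R t - R s‖ ≤ L * |t - s|)
    (hsymm : ∀ t ∈ Icc 0 T, ∀ x y, inner ℂ (R t x) y = inner ℂ x (R t y))
    {w g : ℝ → H} {w₀ : H}
    (hg : AEStronglyMeasurable g (volume.restrict (Icc 0 T)))
    (hB : ∀ᵐ s ∂volume.restrict (Icc 0 T), ‖g s‖ ≤ B)
    (hw : ∀ t ∈ Icc 0 T, w t = w₀ + ∫ s in (0 : ℝ)..t, g s)
    (hC : 0 ≤ C) (hG : 0 ≤ G)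
    (hineq : ∀ᵐ t ∂volume.restrict (Icc 0 T),
      L * ‖w t‖ ^ 2 + 2 * (inner ℂ (R t (w t)) (g t)).re ≤ C * (inner ℂ (R t (w t)) (w t)).re + G)
    {t : ℝ} (ht : t ∈ Icc 0 T) :
    (inner ℂ (R t (w t)) (w t)).re
      ≤ Real.exp (C * t) * ((inner ℂ (R 0 (w 0)) (w 0)).re + G * t) := by
  have hgint : IntervalIntegrable g volume 0 T := by
    rw [intervalIntegrable_iff_integrableOn_Icc_of_le hT]
    exact Integrable.of_bound hg B hB
  have hwlip : ∀ s ∈ Icc 0 T, ∀ t ∈ Icc 0 T, ‖w t - w s‖ ≤ B * |t - s| := by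
    intro s hs t ht
    rw [hw t ht, hw s hs, add_sub_add_left_eq_sub]
    exact norm_primitive_sub_le hgint hB hs ht
  have h00 : (0 : ℝ) ∈ Icc 0 T := ⟨le_rfl, hT⟩
  set F : ℝ → ℝ := fun t => (inner ℂ (R t (w t)) (w t)).re with hF
  have hwcont : ContinuousOn w (Icc 0 T) := by
    refine LipschitzOnWith.continuousOn (K := Real.toNNReal B) (LipschitzOnWith.of_dist_le_mul ?_)
    intro x hx y hy
    rw [dist_eq_norm, Real.dist_eq]
    exact (hwlip y hy x hx).trans (by gcongr; exact Real.le_coe_toNNReal B)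
  have hRcont : ContinuousOn R (Icc 0 T) := by
    refine LipschitzOnWith.continuousOn (K := Real.toNNReal L) (LipschitzOnWith.of_dist_le_mul ?_)
    intro x hx y hy
    rw [dist_eq_norm, Real.dist_eq]
    exact (hR y hy x hx).trans (by gcongr; exact Real.le_coe_toNNReal L)
  obtain ⟨W, hW⟩ := isCompact_Icc.exists_bound_of_continuousOn hwcont
  obtain ⟨D, hD⟩ := isCompact_Icc.exists_bound_of_continuousOn hRcont
  -- The weight and w are only Lipschitz in time. The energy is then absolutely continuous, so a
  -- differential inequality valid almost everywhere can be integrated.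
  have hFac : AbsolutelyContinuousOnInterval F 0 t := by
    refine LipschitzOnWith.absolutelyContinuousOnInterval
      (K := Real.toNNReal (L * W * W + D * B * W + D * W * B)) (LipschitzOnWith.of_dist_le_mul ?_)
    rw [uIcc_of_le ht.1]
    intro x hx y hy
    have hx' : x ∈ Icc 0 T := ⟨hx.1, hx.2.trans ht.2⟩
    have hy' : y ∈ Icc 0 T := ⟨hy.1, hy.2.trans ht.2⟩
    rw [Real.dist_eq, Real.dist_eq]
    exact (energy_lipschitz hR hD hwlip hW hy' hx').trans (by gcongr; exact Real.le_coe_toNNReal _)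
  have hEac : AbsolutelyContinuousOnInterval (fun s => Real.exp (-(C * s))) 0 t := by
    have : ContDiffOn ℝ 1 (fun s => Real.exp (-(C * s))) (uIcc 0 t) := by
      apply ContDiff.contDiffOn; fun_prop
    obtain ⟨K, hK⟩ := this.exists_lipschitzOnWith (by norm_num) (convex_uIcc 0 t) isCompact_uIcc
    exact hK.absolutelyContinuousOnInterval
  have key : ∀ᵐ s, s ∈ uIoc 0 t →
      deriv (fun s => Real.exp (-(C * s)) * F s) s ≤ G := by
    have hd := hFac.ae_differentiableAt
    have hi := hgint.ae_hasDerivAt_integral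
    rw [ae_restrict_iff' measurableSet_Icc] at hineq
    have hne : ∀ᵐ s : ℝ, s ≠ t := by
      simp [ae_iff, measure_singleton]
    filter_upwards [hd, hi, hineq, hne] with s hs1 hs2 hs3 hs4 hs
    rw [uIoc_of_le ht.1] at hs
    have hsT : s ∈ Icc 0 T := ⟨hs.1.le, hs.2.trans ht.2⟩
    have hslt : s < T := (lt_of_le_of_ne hs.2 hs4).trans_le ht.2
    have hF' := (hs1 (by rw [uIcc_of_le ht.1]; exact ⟨hs.1.le, hs.2⟩)).hasDerivAt
    have hw' : HasDerivAt w (g s) s := by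
      have h1 := (hs2 (by rw [uIcc_of_le hT]; exact hsT) 0 (by simp)).const_add w₀
      refine h1.congr_of_eventuallyEq ?_
      filter_upwards [Ioo_mem_nhds hs.1 hslt] with r hr
      exact hw r ⟨hr.1.le, hr.2.le⟩
    have hN : HasDerivAt (fun r => (inner ℂ (R s (w r)) (w r)).re)
        (2 * (inner ℂ (R s (w s)) (g s)).re) s := by
      have hRw : HasDerivAt (fun r => R s (w r)) (R s (g s)) s :=
        ((R s).restrictScalars ℝ).hasFDerivAt.comp_hasDerivAt s hw'
      have h1 := hRw.inner ℂ hw'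
      have h2 := Complex.reCLM.hasFDerivAt.comp_hasDerivAt s h1
      refine h2.congr_deriv ?_
      simp only [Complex.reCLM_apply, Complex.add_re]
      rw [hsymm s hsT (g s) (w s), ← inner_conj_symm (g s) (R s (w s)), Complex.conj_re]
      ring
    -- The weight need not be differentiable. Right difference quotients of the energy are compared
    -- with those for the weight frozen at time s, and the change of weight costs at most L ‖w‖².
    have hle : deriv F s ≤ 2 * (inner ℂ (R s (w s)) (g s)).re + L * ‖w s‖ ^ 2 := by
      have t1 := (hasDerivAt_iff_tendsto_slope.1 hF').mono_left
        (nhdsWithin_mono s (show Ioi s ⊆ {s}ᶜ from fun x hx => ne_of_gt hx))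
      have t2 := (hasDerivAt_iff_tendsto_slope.1 hN).mono_left
        (nhdsWithin_mono s (show Ioi s ⊆ {s}ᶜ from fun x hx => ne_of_gt hx))
      have t3 : Tendsto (fun r => L * ‖w r‖ ^ 2) (𝓝[>] s) (𝓝 (L * ‖w s‖ ^ 2)) :=
        ((hw'.continuousAt.norm.pow 2).const_mul L).tendsto.mono_left nhdsWithin_le_nhds
      refine le_of_tendsto_of_tendsto t1 (t2.add t3) ?_
      filter_upwards [Ioo_mem_nhdsGT hslt] with r hr
      have hrT : r ∈ Icc 0 T := ⟨hs.1.le.trans hr.1.le, hr.2.le⟩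
      have hpos : 0 < r - s := sub_pos.2 hr.1
      rw [slope_def_field, slope_def_field, div_add' _ _ _ hpos.ne']
      gcongr
      have e : (inner ℂ (R r (w r)) (w r)).re
          = (inner ℂ ((R r - R s) (w r)) (w r)).re + (inner ℂ (R s (w r)) (w r)).re := by
        simp
      have : (inner ℂ ((R r - R s) (w r)) (w r)).re ≤ L * (r - s) * ‖w r‖ ^ 2 := by
        refine (Complex.re_le_norm _).trans ((norm_inner_le_norm _ _).trans ?_)
        rw [pow_two, ← mul_assoc]
        gcongr
        refine ((R r - R s).le_opNorm _).trans ?_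
        gcongr
        have := hR s hsT r hrT
        rwa [abs_of_pos hpos] at this
      simp only [hF]
      rw [e]
      linarith
    have hE : HasDerivAt (fun s => Real.exp (-(C * s))) (Real.exp (-(C * s)) * (-C)) s := by
      have := (((hasDerivAt_id s).const_mul C).neg).exp
      simpa using this
    rw [(hE.fun_mul hF').deriv]
    have h3 := hs3 hsT
    have hexp : Real.exp (-(C * s)) ≤ 1 := by
      rw [Real.exp_le_one_iff]; have := mul_nonneg hC hsT.1; linarith
    have hexp0 := Real.exp_pos (-(C * s))
    have : deriv F s - C * F s ≤ G := by simp only [hF] at hle h3 ⊢; linarith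
    calc _ = Real.exp (-(C * s)) * (deriv F s - C * F s) := by ring
      _ ≤ Real.exp (-(C * s)) * G := by gcongr
      _ ≤ 1 * G := by gcongr
      _ = G := one_mul G
  have hac := hEac.fun_mul hFac
  have hfin := hac.integral_deriv_eq_sub
  have hle2 : ∫ s in (0 : ℝ)..t, deriv (fun s => Real.exp (-(C * s)) * F s) s
      ≤ ∫ s in (0 : ℝ)..t, G := by
    refine intervalIntegral.integral_mono_ae_restrict ht.1 hac.intervalIntegrable_deriv (by simp) ?_
    rw [EventuallyLE, ae_restrict_iff' measurableSet_Icc]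
    have hne : ∀ᵐ s : ℝ, s ≠ 0 := by simp [ae_iff, measure_singleton]
    filter_upwards [key, hne] with s hs h0 hs'
    exact hs (by rw [uIoc_of_le ht.1]; exact ⟨lt_of_le_of_ne hs'.1 (Ne.symm h0), hs'.2⟩)
  rw [hfin] at hle2
  simp only [intervalIntegral.integral_const, sub_zero, smul_eq_mul, mul_zero, neg_zero,
    Real.exp_zero, one_mul] at hle2
  have h4 : Real.exp (-(C * t)) * F t ≤ F 0 + G * t := by linarith
  have h5 : F t = Real.exp (C * t) * (Real.exp (-(C * t)) * F t) := by
    rw [← mul_assoc, ← Real.exp_add]; simp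
  change F t ≤ Real.exp (C * t) * (F 0 + G * t)
  rw [h5]
  gcongr

end Energy

theorem intervalIntegrable_of_bound {F : Type*} [NormedAddCommGroup F] {T : ℝ} (hT : 0 ≤ T)
    {g : ℝ → F} {B : ℝ} (hg : AEStronglyMeasurable g (volume.restrict (Icc 0 T)))
    (hB : ∀ᵐ s ∂volume.restrict (Icc 0 T), ‖g s‖ ≤ B) : IntervalIntegrable g volume 0 T := by
  rw [intervalIntegrable_iff_integrableOn_Icc_of_le hT]
  exact Integrable.of_bound hg B hB

theorem intervalIntegrable_of_mem {F : Type*} [NormedAddCommGroup F] {g : ℝ → F} {t T : ℝ}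
    (ht : t ∈ Icc 0 T) (hg : IntervalIntegrable g volume 0 T) : IntervalIntegrable g volume 0 t :=
  hg.mono_set (by
    rw [uIcc_of_le (ht.1.trans ht.2), uIcc_of_le ht.1]; exact Icc_subset_Icc_right ht.2)

/-! ### Weak compactness -/

section Weak

variable {H : Type*} [NormedAddCommGroup H] [InnerProductSpace ℂ H] {ι α : Type*}

/-- Bounded sequences with convergent coefficients converge weakly, by density of the span of the
basis, and a weakly convergent sequence may be paired with a strongly convergent one. The extra room
for `v` is needed because the adjoint test vectors of the Galerkin scheme vary with N. -/
theorem tendsto_inner_of_coeff (b : HilbertBasis ι ℂ H) {l : Filter α} {x : α → H} {y : H} {B : ℝ}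
    (hB : ∀ᶠ n in l, ‖x n‖ ≤ B)
    (hc : ∀ k, Tendsto (fun n => inner ℂ (b k) (x n)) l (𝓝 (inner ℂ (b k) y)))
    {v : α → H} {v₀ : H} (hv : Tendsto v l (𝓝 v₀)) :
    Tendsto (fun n => inner ℂ (v n) (x n)) l (𝓝 (inner ℂ v₀ y)) := by
  have hspan : ∀ u ∈ Submodule.span ℂ (range b),
      Tendsto (fun n => inner ℂ u (x n)) l (𝓝 (inner ℂ u y)) := by
    intro u hu
    induction hu using Submodule.span_induction with
    | mem u hu => obtain ⟨k, rfl⟩ := hu; exact hc k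
    | zero => simp only [inner_zero_left]; exact tendsto_const_nhds
    | add u u' _ _ h h' => simpa only [inner_add_left] using h.add h'
    | smul c u _ h => simpa only [inner_smul_left] using h.const_mul _
  rw [Metric.tendsto_nhds]
  intro ε hε
  set A := max B 0 + ‖y‖ + 1 with hA
  have hA0 : 0 < A := by positivity
  have hd : v₀ ∈ closure (Submodule.span ℂ (range b) : Set H) := by
    have := b.dense_span
    rw [← Submodule.topologicalClosure_coe, this]; trivial
  obtain ⟨u, hu, hvu⟩ := Metric.mem_closure_iff.1 hd (ε / (4 * A)) (by positivity)
  rw [dist_eq_norm] at hvu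
  have h1 := (Metric.tendsto_nhds.1 (hspan u hu)) (ε / 4) (by positivity)
  have h2 := (Metric.tendsto_nhds.1 hv) (ε / (4 * A)) (by positivity)
  filter_upwards [h1, h2, hB] with n h1 h2 hB
  rw [dist_eq_norm] at h1 h2 ⊢
  have e : inner ℂ (v n) (x n) - inner ℂ v₀ y
      = inner ℂ (v n - v₀) (x n) + inner ℂ (v₀ - u) (x n)
        + (inner ℂ u (x n) - inner ℂ u y) + inner ℂ (u - v₀) y := by
    simp only [inner_sub_left]; ring
  have b1 : ‖inner ℂ (v n - v₀) (x n)‖ ≤ ε / 4 := by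
    calc _ ≤ ‖v n - v₀‖ * ‖x n‖ := norm_inner_le_norm _ _
      _ ≤ (ε / (4 * A)) * A := by
        gcongr
        exact hB.trans (by rw [hA]; linarith [le_max_left B 0, norm_nonneg y])
      _ = ε / 4 := by field_simp
  have b2 : ‖inner ℂ (v₀ - u) (x n)‖ ≤ ε / 4 := by
    calc _ ≤ ‖v₀ - u‖ * ‖x n‖ := norm_inner_le_norm _ _
      _ ≤ (ε / (4 * A)) * A := by
        gcongr
        exact hB.trans (by rw [hA]; linarith [le_max_left B 0, norm_nonneg y])
      _ = ε / 4 := by field_simp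
  have b3 : ‖inner ℂ (u - v₀) y‖ ≤ ε / 4 := by
    calc _ ≤ ‖u - v₀‖ * ‖y‖ := norm_inner_le_norm _ _
      _ ≤ (ε / (4 * A)) * A := by
        rw [norm_sub_rev]
        gcongr
        rw [hA]; linarith [le_max_right B 0]
      _ = ε / 4 := by field_simp
  rw [e]
  refine (norm_add_le _ _).trans_lt ?_
  have := norm_add₃_le (a := inner ℂ (v n - v₀) (x n)) (b := inner ℂ (v₀ - u) (x n))
    (c := inner ℂ u (x n) - inner ℂ u y)
  linarith

/-- Fatou's lemma for series: the limit coefficients are square summable because the ℓ² norms are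
uniformly bounded. -/
theorem exists_of_tendsto_coeff (b : HilbertBasis ι ℂ H) {l : Filter α} [l.NeBot] {x : α → H}
    {B : ℝ} (hB : ∀ n, ‖x n‖ ≤ B) {c : ι → ℂ}
    (hc : ∀ k, Tendsto (fun n => inner ℂ (b k) (x n)) l (𝓝 (c k))) :
    ∃ y : H, ∀ k, inner ℂ (b k) y = c k := by
  have hmem : Memℓp c 2 := by
    refine lp.memℓp_of_tendsto (l := l) (F := fun n => b.repr (x n)) ?_ ?_
    · refine isBounded_iff_forall_norm_le.2 ⟨B, ?_⟩
      rintro _ ⟨n, rfl⟩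
      rw [LinearIsometryEquiv.norm_map]; exact hB n
    · rw [tendsto_pi_nhds]
      intro k
      simpa only [b.repr_apply_apply, id] using hc k
  refine ⟨b.repr.symm ⟨c, hmem⟩, fun k => ?_⟩
  rw [← b.repr_apply_apply, LinearIsometryEquiv.apply_symm_apply]

/-- Diagonal extraction for a countable family of bounded, equi-Lipschitz sequences. -/
theorem exists_subseq_tendsto [Countable ι] {T B : ℝ} (hT : 0 ≤ T) {L : ι → ℝ} {f : ℕ → ι → ℝ → ℂ}
    (hB : ∀ N k, ∀ t ∈ Icc 0 T, ‖f N k t‖ ≤ B)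
    (hL : ∀ N k, ∀ s ∈ Icc 0 T, ∀ t ∈ Icc 0 T, ‖f N k t - f N k s‖ ≤ L k * |t - s|) :
    ∃ φ : ℕ → ℕ, StrictMono φ ∧ ∀ k, ∀ t ∈ Icc 0 T, ∃ c,
      Tendsto (fun N => f (φ N) k t) atTop (𝓝 c) := by
  -- Rationals clamped to [0,T] form a countable dense set of times. On it Tychonoff's theorem
  -- provides the subsequence, and the Lipschitz bounds, which may depend on k, carry convergence
  -- over to every time.
  let p : ℝ → ℝ := fun q => projIcc 0 T hT q
  have hp : ∀ q, p q ∈ Icc 0 T := fun q => (projIcc 0 T hT q).2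
  let X : ℕ → (ι × ℚ → ℂ) := fun N i => f N i.1 (p i.2)
  have hX : ∀ N, X N ∈ univ.pi fun _ : ι × ℚ => Metric.closedBall (0 : ℂ) B := by
    intro N i _
    simpa using hB N i.1 _ (hp _)
  obtain ⟨x, -, φ, hφ, hx⟩ := (isCompact_univ_pi
    (fun _ : ι × ℚ => isCompact_closedBall (0 : ℂ) B)).tendsto_subseq hX
  rw [tendsto_pi_nhds] at hx
  refine ⟨φ, hφ, fun k t ht => cauchySeq_tendsto_of_complete ?_⟩
  rw [Metric.cauchySeq_iff]
  intro ε hε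
  set A := |L k| + 1 with hA
  have hA0 : 0 < A := by positivity
  obtain ⟨q, hq⟩ := exists_rat_near t (show 0 < ε / (3 * A) by positivity)
  have hpt : p t = t := by simp only [p, projIcc_of_mem hT ht]
  have hqt : |t - p q| ≤ ε / (3 * A) := by
    rw [← hpt]
    exact (abs_projIcc_sub_projIcc hT).trans hq.le
  have hclose : ∀ N, ‖f N k t - f N k (p q)‖ < ε / 3 := by
    intro N
    calc _ ≤ L k * |t - p q| := hL N k _ (hp _) _ ht
      _ ≤ |L k| * |t - p q| := by gcongr; exact le_abs_self _
      _ ≤ |L k| * (ε / (3 * A)) := by gcongr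
      _ < A * (ε / (3 * A)) := by
        have : 0 < ε / (3 * A) := by positivity
        gcongr; rw [hA]; linarith
      _ = ε / 3 := by field_simp
  obtain ⟨N₀, hN₀⟩ := Metric.cauchySeq_iff.1 (hx (k, q)).cauchySeq (ε / 3) (by positivity)
  refine ⟨N₀, fun m hm n hn => ?_⟩
  have h1 := hclose (φ m)
  have h2 := hclose (φ n)
  have h3 := hN₀ m hm n hn
  rw [dist_eq_norm] at h3 ⊢
  simp only [Function.comp_apply, X] at h3
  have e : f (φ m) k t - f (φ n) k t = (f (φ m) k t - f (φ m) k (p q))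
      + (f (φ m) k (p q) - f (φ n) k (p q)) - (f (φ n) k t - f (φ n) k (p q)) := by ring
  rw [e]
  refine (norm_sub_le _ _).trans_lt ?_
  have := norm_add_le (f (φ m) k t - f (φ m) k (p q)) (f (φ m) k (p q) - f (φ n) k (p q))
  linarith

/-- Weak lower semicontinuity of a nonnegative quadratic form: expanding 0 ≤ ⟨R(x - y), x - y⟩
bounds ⟨Rx, x⟩ below by 2 Re ⟨Ry, x⟩ - ⟨Ry, y⟩, which is continuous under weak convergence. -/
theorem le_of_weak_limit {l : Filter ℕ} [l.NeBot] (b : HilbertBasis ι ℂ H) {R : H →L[ℂ] H}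
    (hsymm : ∀ x y, inner ℂ (R x) y = inner ℂ x (R y)) (hpos : ∀ x, 0 ≤ (inner ℂ (R x) x).re)
    {x : ℕ → H} {y : H} {B : ℝ} (hB : ∀ n, ‖x n‖ ≤ B)
    (hc : ∀ k, Tendsto (fun n => inner ℂ (b k) (x n)) l (𝓝 (inner ℂ (b k) y)))
    {A : ℕ → ℝ} {A₀ : ℝ} (hA : Tendsto A l (𝓝 A₀))
    (hle : ∀ n, (inner ℂ (R (x n)) (x n)).re ≤ A n) : (inner ℂ (R y) y).re ≤ A₀ := by
  have h1 := tendsto_inner_of_coeff b (Eventually.of_forall hB) hc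
    (tendsto_const_nhds (x := R y))
  have h2 : Tendsto (fun n => 2 * (inner ℂ (R y) (x n)).re - (inner ℂ (R y) y).re) l
      (𝓝 (2 * (inner ℂ (R y) y).re - (inner ℂ (R y) y).re)) :=
    (((Complex.continuous_re.tendsto _).comp h1).const_mul 2).sub_const _
  have h3 := le_of_tendsto_of_tendsto h2 hA (Eventually.of_forall fun n => by
    have := hpos (x n - y)
    simp only [map_sub, inner_sub_left, inner_sub_right, Complex.sub_re] at this
    have e : (inner ℂ (R (x n)) y).re = (inner ℂ (R y) (x n)).re := by
      rw [hsymm, ← inner_conj_symm, Complex.conj_re]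
    have := hle n
    linarith)
  linarith

end Weak

/-! ### The Galerkin limit -/

section Galerkin

variable {H : Type*} [NormedAddCommGroup H] [InnerProductSpace ℂ H]

/-- A bounded, symmetric, coercive weight, Lipschitz in time. -/
structure IsWeight (T L m D : ℝ) (R : ℝ → H →L[ℂ] H) : Prop where
  m_pos : 0 < m
  D_nonneg : 0 ≤ D
  L_nonneg : 0 ≤ L
  lipschitz : ∀ s ∈ Icc 0 T, ∀ t ∈ Icc 0 T, ‖R t - R s‖ ≤ L * |t - s|
  symm : ∀ t ∈ Icc 0 T, ∀ x y, inner ℂ (R t x) y = inner ℂ x (R t y)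
  coercive : ∀ t ∈ Icc 0 T, ∀ x, m * ‖x‖ ^ 2 ≤ (inner ℂ (R t x) x).re
  bounded : ∀ t ∈ Icc 0 T, ‖R t‖ ≤ D

/-- The rate collects the variation L of the weight, the generator's contribution 2C, and D from
splitting 2D‖w‖E ≤ D(‖w‖² + E²); division by m converts ‖w‖² into the energy. -/
theorem IsWeight.energy_le [CompleteSpace H] {T L m D : ℝ} {R : ℝ → H →L[ℂ] H} (hR : IsWeight T L m D R)
    (hT : 0 ≤ T) {C E B : ℝ} (hC : 0 ≤ C) {w q f : ℝ → H} {w₀ : H}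
    (hg : AEStronglyMeasurable (fun s => q s + f s) (volume.restrict (Icc 0 T)))
    (hB : ∀ᵐ s ∂volume.restrict (Icc 0 T), ‖q s + f s‖ ≤ B)
    (hq : ∀ᵐ s ∂volume.restrict (Icc 0 T), (inner ℂ (R s (w s)) (q s)).re ≤ C * ‖w s‖ ^ 2)
    (hf : ∀ᵐ s ∂volume.restrict (Icc 0 T), ‖f s‖ ≤ E)
    (hw : ∀ t ∈ Icc 0 T, w t = w₀ + ∫ s in (0 : ℝ)..t, (q s + f s))
    {t : ℝ} (ht : t ∈ Icc 0 T) :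
    (inner ℂ (R t (w t)) (w t)).re ≤ Real.exp ((L + 2 * C + D) / m * t)
      * ((inner ℂ (R 0 (w 0)) (w 0)).re + D * E ^ 2 * t) := by
  have hm := hR.m_pos
  have hD := hR.D_nonneg
  have hL := hR.L_nonneg
  refine energy_gronwall hT hR.lipschitz hR.symm hg hB hw (by positivity) (by positivity) ?_ ht
  filter_upwards [hq, hf, ae_restrict_mem measurableSet_Icc] with s hq hf hs
  rw [inner_add_right, Complex.add_re]
  have h1 : (inner ℂ (R s (w s)) (f s)).re ≤ D * ‖w s‖ * E := by
    refine (Complex.re_le_norm _).trans ((norm_inner_le_norm _ _).trans ?_)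
    gcongr
    exact ContinuousLinearMap.le_of_opNorm_le _ (hR.bounded s hs) _
  have h2 : 2 * (‖w s‖ * E) ≤ ‖w s‖ ^ 2 + E ^ 2 := by nlinarith [sq_nonneg (‖w s‖ - E)]
  have h3 := hR.coercive s hs (w s)
  have h4 : ‖w s‖ ^ 2 ≤ (inner ℂ (R s (w s)) (w s)).re / m := by
    rw [le_div_iff₀ hm]; linarith
  have h5 : (L + 2 * C + D) * ‖w s‖ ^ 2
      ≤ (L + 2 * C + D) / m * (inner ℂ (R s (w s)) (w s)).re := by
    calc _ ≤ (L + 2 * C + D) * ((inner ℂ (R s (w s)) (w s)).re / m) := by gcongr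
      _ = _ := by ring
  have h6 : 2 * (D * ‖w s‖ * E) ≤ D * (‖w s‖ ^ 2 + E ^ 2) := by
    calc _ = D * (2 * (‖w s‖ * E)) := by ring
      _ ≤ _ := by gcongr
  linarith

theorem IsWeight.norm_sq_le {T L m D : ℝ} {R : ℝ → H →L[ℂ] H} (hR : IsWeight T L m D R)
    {t A : ℝ} (ht : t ∈ Icc 0 T) {x : H} (h : (inner ℂ (R t x) x).re ≤ A) :
    ‖x‖ ≤ Real.sqrt (A / m) := by
  refine Real.le_sqrt_of_sq_le ?_
  rw [le_div_iff₀ hR.m_pos]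
  have := hR.coercive t ht x
  linarith

theorem IsWeight.inner_le {T L m D : ℝ} {R : ℝ → H →L[ℂ] H} (hR : IsWeight T L m D R)
    {t : ℝ} (ht : t ∈ Icc 0 T) (x : H) : (inner ℂ (R t x) x).re ≤ D * ‖x‖ ^ 2 := by
  refine (Complex.re_le_norm _).trans ((norm_inner_le_norm _ _).trans ?_)
  rw [pow_two, ← mul_assoc]
  gcongr
  exact ContinuousLinearMap.le_of_opNorm_le _ (hR.bounded t ht) _

/-- The energy inequality with the constant weight 1. It serves to show that the Galerkin
approximations are real. -/
theorem volterra_unique [CompleteSpace H] {T : ℝ} (hT : 0 ≤ T) {Q : ℝ → H →L[ℂ] H}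
    (hQ : ContinuousOn Q (Icc 0 T)) {z : ℝ → H} (hz : ContinuousOn z (Icc 0 T))
    (h : ∀ t ∈ Icc 0 T, z t = ∫ s in (0 : ℝ)..t, Q s (z s)) : ∀ t ∈ Icc 0 T, z t = 0 := by
  obtain ⟨C, hC⟩ := isCompact_Icc.exists_bound_of_continuousOn hQ
  have hcont : ContinuousOn (fun s => Q s (z s)) (Icc 0 T) := hQ.clm_apply hz
  obtain ⟨B, hB⟩ := isCompact_Icc.exists_bound_of_continuousOn hcont
  have hC0 : 0 ≤ C := (norm_nonneg _).trans (hC 0 ⟨le_rfl, hT⟩)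
  have hR : IsWeight T 0 1 1 (fun _ => ContinuousLinearMap.id ℂ H) :=
    { m_pos := one_pos, D_nonneg := zero_le_one, L_nonneg := le_rfl
      lipschitz := by simp
      symm := by simp
      coercive := fun _ _ x => by simp [← Complex.ofReal_pow, inner_self_eq_norm_sq_to_K]
      bounded := fun _ _ => ContinuousLinearMap.norm_id_le }
  intro t ht
  have hz0 : z 0 = 0 := by rw [h 0 ⟨le_rfl, hT⟩]; simp
  have := hR.energy_le hT hC0 (w := z) (q := fun s => Q s (z s)) (f := fun _ => 0) (w₀ := 0)
    (E := 0) (B := B)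
    (by simpa using hcont.aestronglyMeasurable measurableSet_Icc)
    (by
      filter_upwards [ae_restrict_mem measurableSet_Icc] with s hs
      simpa using hB s hs)
    (by
      filter_upwards [ae_restrict_mem measurableSet_Icc] with s hs
      refine (Complex.re_le_norm _).trans ((norm_inner_le_norm _ _).trans ?_)
      simp only [ContinuousLinearMap.id_apply]
      have := ContinuousLinearMap.le_of_opNorm_le _ (hC s hs) (z s)
      nlinarith [norm_nonneg (z s)])
    (by simp) (by simpa using h) ht
  rw [hz0] at this
  have := hR.norm_sq_le ht this
  simpa using this

/-- Existence for `w' = 𝓛 w + f` by bounded approximations `Q N` of `𝓛`, in the weak form given by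
the limits of `(Q N)* (b k)`, together with the weighted energy bound. -/
theorem exists_galerkin_limit [CompleteSpace H] (b : HilbertBasis ℤ ℂ H) {T L m D C E : ℝ} (hT : 0 ≤ T)
    {R : ℝ → H →L[ℂ] H} (hR : IsWeight T L m D R) (hC : 0 ≤ C)
    {P : ℕ → H →L[ℂ] H} (hP1 : ∀ N, ‖P N‖ ≤ 1) (hP : ∀ x, Tendsto (fun N => P N x) atTop (𝓝 x))
    {Q : ℕ → ℝ → H →L[ℂ] H} (hQ : ∀ N, ContinuousOn (Q N) (Icc 0 T))
    (hQE : ∀ N, ∀ t ∈ Icc 0 T, ∀ w, (inner ℂ (R t w) (Q N t w)).re ≤ C * ‖w‖ ^ 2)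
    {η : ℤ → ℝ → H} {Bη : ℤ → ℝ}
    (hη : ∀ k, ∀ t ∈ Icc 0 T,
      Tendsto (fun N => ContinuousLinearMap.adjoint (Q N t) (b k)) atTop (𝓝 (η k t)))
    (hηB : ∀ N k, ∀ t ∈ Icc 0 T, ‖ContinuousLinearMap.adjoint (Q N t) (b k)‖ ≤ Bη k)
    {f : ℝ → H} (hf : AEStronglyMeasurable f (volume.restrict (Icc 0 T)))
    (hfE : ∀ᵐ t ∂volume.restrict (Icc 0 T), ‖f t‖ ≤ E) (w₀ : H)
    {J : H →L[ℝ] H} (hJ : ∀ w k, inner ℂ (b k) (J w) = starRingEnd ℂ (inner ℂ (b (-k)) w))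
    (hJP : ∀ N x, J (P N x) = P N (J x)) (hJQ : ∀ N, ∀ t ∈ Icc 0 T, ∀ x, J (Q N t x) = Q N t (J x))
    (hJf : ∀ᵐ t ∂volume.restrict (Icc 0 T), J (f t) = f t) (hJw : J w₀ = w₀) :
    ∃ w : ℝ → H, w 0 = w₀ ∧ (∀ t ∈ Icc 0 T, J (w t) = w t) ∧
      (∀ k, ∀ t ∈ Icc 0 T, inner ℂ (b k) (w t)
        = inner ℂ (b k) w₀ + ∫ s in (0 : ℝ)..t, (inner ℂ (η k s) (w s) + inner ℂ (b k) (f s))) ∧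
      (∀ k, ∃ A, ∀ s ∈ Icc 0 T, ∀ t ∈ Icc 0 T,
        ‖inner ℂ (b k) (w t) - inner ℂ (b k) (w s)‖ ≤ A * |t - s|) ∧
      ∀ t ∈ Icc 0 T, (inner ℂ (R t (w t)) (w t)).re ≤ Real.exp ((L + 2 * C + D) / m * t)
        * ((inner ℂ (R 0 w₀) w₀).re + D * E ^ 2 * t) := by
  have h00 : (0 : ℝ) ∈ Icc 0 T := ⟨le_rfl, hT⟩
  have hext : ∀ {x y : H}, (∀ k, inner ℂ (b k) x = inner ℂ (b k) y) → x = y := fun {x y} h =>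
    b.repr.injective (lp.ext (funext fun k => by simpa only [b.repr_apply_apply] using h k))
  set ν := volume.restrict (Icc (0 : ℝ) T) with hν
  have hPf : ∀ N, AEStronglyMeasurable (fun s => P N (f s)) ν := fun N =>
    (P N).continuous.comp_aestronglyMeasurable hf
  have hPfE : ∀ N, ∀ᵐ s ∂ν, ‖P N (f s)‖ ≤ E := fun N => by
    filter_upwards [hfE] with s hs
    exact (ContinuousLinearMap.le_of_opNorm_le _ (hP1 N) _).trans (by simpa using hs)
  have hsol : ∀ N, ∃ w : ℝ → H, Continuous w ∧ ∀ t ∈ Icc 0 T,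
      w t = P N w₀ + ∫ s in (0 : ℝ)..t, (Q N s (w s) + P N (f s)) := by
    intro N
    have hΦ : ContinuousOn (fun t => P N w₀ + ∫ s in (0 : ℝ)..t, P N (f s)) (Icc 0 T) := by
      refine continuousOn_const.add ?_
      have := intervalIntegral.continuousOn_primitive_interval'
        (intervalIntegrable_of_bound hT (hPf N) (hPfE N)) (left_mem_uIcc)
      rwa [uIcc_of_le hT] at this
    have hQ' : ContinuousOn (fun t => (Q N t).restrictScalars ℝ) (Icc 0 T) :=
      (ContinuousLinearMap.restrictScalarsL ℂ H H ℝ ℝ).continuous.comp_continuousOn (hQ N)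
    obtain ⟨w, hw, h⟩ := exists_volterra hT hQ' hΦ
    refine ⟨w, hw, fun t ht => ?_⟩
    rw [h t ht, intervalIntegral.integral_add _ (intervalIntegrable_of_mem ht (intervalIntegrable_of_bound hT (hPf N) (hPfE N)))]
    · simp only [ContinuousLinearMap.coe_restrictScalars']; abel
    · refine ContinuousOn.intervalIntegrable ?_
      rw [uIcc_of_le ht.1]
      exact ((hQ N).mono (Icc_subset_Icc_right ht.2)).clm_apply hw.continuousOn
  choose w hwc hw using hsol
  have hQw : ∀ N, ContinuousOn (fun s => Q N s (w N s)) (Icc 0 T) :=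
    fun N => (hQ N).clm_apply (hwc N).continuousOn
  have hgm : ∀ N, AEStronglyMeasurable (fun s => Q N s (w N s) + P N (f s)) ν :=
    fun N => ((hQw N).aestronglyMeasurable measurableSet_Icc).add (hPf N)
  have hgB : ∀ N, ∃ B, ∀ᵐ s ∂ν, ‖Q N s (w N s) + P N (f s)‖ ≤ B := by
    intro N
    obtain ⟨B, hB⟩ := isCompact_Icc.exists_bound_of_continuousOn (hQw N)
    refine ⟨B + E, ?_⟩
    filter_upwards [hPfE N, ae_restrict_mem measurableSet_Icc] with s h1 h2
    exact (norm_add_le _ _).trans (add_le_add (hB s h2) h1)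
  have hgi : ∀ N, IntervalIntegrable (fun s => Q N s (w N s) + P N (f s)) volume 0 T := fun N =>
    intervalIntegrable_of_bound hT (hgm N) (hgB N).choose_spec
  have hw0 : ∀ N, w N 0 = P N w₀ := fun N => by simp [hw N 0 h00]
  set Γ := (L + 2 * C + D) / m with hΓ
  have hm := hR.m_pos
  have hD := hR.D_nonneg
  have hL := hR.L_nonneg
  have hΓ0 : 0 ≤ Γ := by positivity
  have hen : ∀ N, ∀ t ∈ Icc 0 T, (inner ℂ (R t (w N t)) (w N t)).re ≤ Real.exp (Γ * t)
      * ((inner ℂ (R 0 (P N w₀)) (P N w₀)).re + D * E ^ 2 * t) := by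
    intro N t ht
    obtain ⟨B, hB⟩ := hgB N
    have := hR.energy_le hT hC (hgm N) hB (by
      filter_upwards [ae_restrict_mem measurableSet_Icc] with s hs
      exact hQE N s hs _) (hPfE N) (hw N) ht
    rwa [hw0] at this
  -- This bound is uniform in N: the energy constants do not involve N, and ‖P_N w₀‖ ≤ ‖w₀‖.
  obtain ⟨W, hW⟩ : ∃ W, ∀ N, ∀ t ∈ Icc 0 T, ‖w N t‖ ≤ W := by
    refine ⟨Real.sqrt (Real.exp (Γ * T) * (D * ‖w₀‖ ^ 2 + D * E ^ 2 * T) / m), fun N t ht => ?_⟩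
    refine hR.norm_sq_le ht ((hen N t ht).trans ?_)
    have h1 := hR.inner_le h00 (P N w₀)
    have h2 : ‖P N w₀‖ ≤ ‖w₀‖ := by
      simpa using ContinuousLinearMap.le_of_opNorm_le _ (hP1 N) w₀
    have h3 : (inner ℂ (R 0 (P N w₀)) (P N w₀)).re ≤ D * ‖w₀‖ ^ 2 := h1.trans (by gcongr)
    have h4 := ht.1
    have h5 := ht.2
    have h6 : 0 ≤ (inner ℂ (R 0 (P N w₀)) (P N w₀)).re :=
      (by positivity : 0 ≤ m * ‖P N w₀‖ ^ 2).trans (hR.coercive 0 h00 _)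
    gcongr
  have hW0 : 0 ≤ W := (norm_nonneg _).trans (hW 0 0 h00)
  have hE0 : 0 ≤ |E| := abs_nonneg E
  -- the equation for the coefficients
  have hcoef : ∀ N k, ∀ t ∈ Icc 0 T, inner ℂ (b k) (w N t) = inner ℂ (b k) (P N w₀)
      + ∫ s in (0 : ℝ)..t, (inner ℂ (ContinuousLinearMap.adjoint (Q N s) (b k)) (w N s)
        + inner ℂ (b k) (P N (f s))) := by
    intro N k t ht
    rw [hw N t ht, inner_add_right]
    congr 1
    have := (innerSL ℂ (b k)).intervalIntegral_comp_comm (intervalIntegrable_of_mem ht (hgi N))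
    simp only [innerSL_apply_apply] at this
    rw [← this]
    simp only [inner_add_right, ContinuousLinearMap.adjoint_inner_left]
  have hbk : ∀ k, ‖b k‖ = 1 := fun k => b.orthonormal.1 k
  have hcb : ∀ N k, ∀ᵐ s ∂ν, ‖inner ℂ (ContinuousLinearMap.adjoint (Q N s) (b k)) (w N s)
        + inner ℂ (b k) (P N (f s))‖ ≤ Bη k * W + E := by
    intro N k
    filter_upwards [hPfE N, ae_restrict_mem measurableSet_Icc] with s h1 h2
    refine (norm_add_le _ _).trans (add_le_add ?_ ?_)
    · refine (norm_inner_le_norm _ _).trans ?_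
      have := hηB N k s h2
      have h0 : 0 ≤ Bη k := (norm_nonneg _).trans this
      have := hW N s h2
      gcongr
    · refine (norm_inner_le_norm _ _).trans ?_
      rw [hbk, one_mul]; exact h1
  have hcm : ∀ N k, AEStronglyMeasurable (fun s =>
      inner ℂ (ContinuousLinearMap.adjoint (Q N s) (b k)) (w N s) + inner ℂ (b k) (P N (f s))) ν := by
    intro N k
    have := (innerSL ℂ (b k)).continuous.comp_aestronglyMeasurable (hgm N)
    simpa only [innerSL_apply_apply, inner_add_right, ContinuousLinearMap.adjoint_inner_left]
      using this
  have hlip : ∀ N k, ∀ s ∈ Icc 0 T, ∀ t ∈ Icc 0 T,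
      ‖inner ℂ (b k) (w N t) - inner ℂ (b k) (w N s)‖ ≤ (Bη k * W + E) * |t - s| := by
    intro N k s hs t ht
    rw [hcoef N k t ht, hcoef N k s hs, add_sub_add_left_eq_sub]
    exact norm_primitive_sub_le (intervalIntegrable_of_bound hT (hcm N k) (hcb N k)) (hcb N k) hs ht
  obtain ⟨φ, hφ, hlim⟩ := exists_subseq_tendsto hT (f := fun N k t => inner ℂ (b k) (w N t)) (B := W)
    (fun N k t ht => (norm_inner_le_norm _ _).trans (by rw [hbk, one_mul]; exact hW N t ht)) hlip
  have hexw : ∀ t, ∃ y : H, t ∈ Icc 0 T →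
      ∀ k, Tendsto (fun N => inner ℂ (b k) (w (φ N) t)) atTop (𝓝 (inner ℂ (b k) y)) := by
    intro t
    by_cases ht : t ∈ Icc 0 T
    · choose c hc using fun k => hlim k t ht
      obtain ⟨y, hy⟩ := exists_of_tendsto_coeff b (fun N => hW (φ N) t ht) hc
      exact ⟨y, fun _ k => by rw [hy]; exact hc k⟩
    · exact ⟨0, fun h => absurd h ht⟩
  choose v hv using hexw
  have hPφ : ∀ x, Tendsto (fun N => P (φ N) x) atTop (𝓝 x) := fun x =>
    (hP x).comp hφ.tendsto_atTop
  refine ⟨v, ?_, ?_, ?_, ?_, ?_⟩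
  · refine hext fun k => tendsto_nhds_unique (hv 0 h00 k) ?_
    simp only [hw0]
    exact tendsto_const_nhds.inner (hPφ w₀)
  -- The conjugate of the approximate solution solves the same Volterra equation, so uniqueness
  -- makes each approximation real. The symmetry of the coefficients then passes to the limit.
  · have hJw : ∀ N, ∀ t ∈ Icc 0 T, J (w N t) = w N t := by
      intro N t ht
      have := volterra_unique hT (hQ N) (z := fun t => J (w N t) - w N t)
        ((J.continuous.comp (hwc N)).sub (hwc N)).continuousOn (fun t ht => by
          have hi := intervalIntegrable_of_mem ht (hgi N)
          have h1 : J (w N t) = P N w₀ + ∫ s in (0 : ℝ)..t, (Q N s (J (w N s)) + P N (f s)) := by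
            rw [hw N t ht, map_add, hJP, hJw, ← J.intervalIntegral_comp_comm hi]
            congr 1
            refine intervalIntegral.integral_congr_ae ?_
            rw [ae_restrict_iff' measurableSet_Icc] at hJf
            filter_upwards [hJf] with s hs hs'
            rw [uIoc_of_le ht.1] at hs'
            have hsT : s ∈ Icc 0 T := ⟨hs'.1.le, hs'.2.trans ht.2⟩
            rw [map_add, hJQ N s hsT, hJP, hs hsT]
          have hi' : IntervalIntegrable (fun s => Q N s (J (w N s)) + P N (f s)) volume 0 t := by
            refine IntervalIntegrable.add ?_ (intervalIntegrable_of_mem ht (intervalIntegrable_of_bound hT (hPf N) (hPfE N)))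
            refine ContinuousOn.intervalIntegrable ?_
            rw [uIcc_of_le ht.1]
            exact ((hQ N).mono (Icc_subset_Icc_right ht.2)).clm_apply
              (J.continuous.comp (hwc N)).continuousOn
          rw [h1, hw N t ht, add_sub_add_left_eq_sub, ← intervalIntegral.integral_sub hi' hi]
          refine intervalIntegral.integral_congr fun s _ => ?_
          simp only [map_sub, add_sub_add_right_eq_sub]) t ht
      exact sub_eq_zero.1 this
    intro t ht
    refine hext fun k => ?_
    rw [hJ]
    refine tendsto_nhds_unique ((Complex.continuous_conj.tendsto _).comp (hv t ht (-k))) ?_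
    refine (hv t ht k).congr fun N => ?_
    rw [Function.comp_apply, ← hJ, hJw _ t ht]
  -- With the operator moved onto the basis vector, the integrand pairs a strongly convergent test
  -- vector with a weakly convergent solution; the uniform bounds allow dominated convergence.
  · intro k t ht
    refine tendsto_nhds_unique (hv t ht k) ?_
    simp only [hcoef _ k t ht]
    refine (tendsto_const_nhds.inner (hPφ w₀)).add ?_
    have hsubt : uIoc 0 t ⊆ Icc 0 T := by
      rw [uIoc_of_le ht.1]; exact fun s hs => ⟨hs.1.le, hs.2.trans ht.2⟩
    have hac : volume.restrict (uIoc 0 t) ≤ ν := Measure.restrict_mono hsubt le_rfl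
    refine intervalIntegral.tendsto_integral_filter_of_dominated_convergence
      (fun _ => Bη k * W + E) ?_ ?_ ?_ ?_
    · exact Eventually.of_forall fun N => (hcm (φ N) k).mono_measure hac
    · refine Eventually.of_forall fun N => ?_
      exact (ae_restrict_iff' measurableSet_uIoc).1 (ae_mono hac (hcb (φ N) k))
    · simp
    · refine Eventually.of_forall fun s hs => ?_
      have hs' := hsubt hs
      refine Tendsto.add ?_ (tendsto_const_nhds.inner (hPφ (f s)))
      exact tendsto_inner_of_coeff b (Eventually.of_forall fun N => hW (φ N) s hs') (hv s hs')
        ((hη k s hs').comp hφ.tendsto_atTop)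
  · intro k
    refine ⟨Bη k * W + E, fun s hs t ht => ?_⟩
    exact le_of_tendsto ((hv t ht k).sub (hv s hs k)).norm
      (Eventually.of_forall fun N => hlip (φ N) k s hs t ht)
  · intro t ht
    refine le_of_weak_limit b (hR.symm t ht)
      (fun x => (by positivity : 0 ≤ m * ‖x‖ ^ 2).trans (hR.coercive t ht x))
      (fun N => hW (φ N) t ht) (hv t ht) ?_ (fun N => hen (φ N) t ht)
    refine ((Tendsto.add ?_ tendsto_const_nhds)).const_mul _
    have h1 := hPφ w₀
    exact (Complex.continuous_re.tendsto _).comp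
      ((((R 0).continuous.tendsto _).comp h1).inner h1)

end Galerkin

/-! ### Operators on `L²` of the circle -/

section Circle

open AddCircle ENNReal

/-- The wave number `2πk/M`. -/
def waveNumber (M : ℝ) (k : ℤ) : ℝ := 2 * Real.pi * k / M

/-- The symbol of `1 + ∂ₓ`. -/
def symb (M : ℝ) (k : ℤ) : ℂ := 1 + waveNumber M k * Complex.I

theorem symb_re {M : ℝ} (k : ℤ) : (symb M k).re = 1 := by simp [symb]

theorem one_le_norm_symb {M : ℝ} (k : ℤ) : 1 ≤ ‖symb M k‖ := by
  have := Complex.re_le_norm (symb M k)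
  rwa [symb_re] at this

theorem symb_ne_zero {M : ℝ} (k : ℤ) : symb M k ≠ 0 :=
  norm_pos_iff.1 (one_pos.trans_le (one_le_norm_symb k))

/-- The reason for working with 1 + ∂ₓ: its symbol has exactly the modulus of the Sobolev weight,
while, unlike (1 - ∂ₓ²)^(1/2), it obeys a Leibniz rule. -/
theorem norm_symb_sq {M : ℝ} (k : ℤ) : ‖symb M k‖ ^ 2 = 1 + waveNumber M k ^ 2 := by
  rw [Complex.sq_norm, Complex.normSq_apply]
  simp [symb]; ring

theorem symb_neg {M : ℝ} (k : ℤ) : symb M (-k) = starRingEnd ℂ (symb M k) := by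
  exact Complex.ext (by simp [symb]) (by simp [symb, waveNumber, neg_div])

theorem norm_symb_inv_le {M : ℝ} (k : ℤ) : ‖(symb M k)⁻¹‖ ≤ 1 := by
  rw [norm_inv]; exact inv_le_one_of_one_le₀ (one_le_norm_symb k)

theorem norm_symb_le (M : ℝ) {k : ℤ} {N : ℕ} (hk : k.natAbs ≤ N) :
    ‖symb M k‖ ≤ 1 + |2 * Real.pi / M| * N := by
  refine (norm_add_le _ _).trans ?_
  simp only [norm_one, norm_mul, Complex.norm_I, mul_one, Complex.norm_real, Real.norm_eq_abs,
    waveNumber]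
  rw [mul_div_right_comm, abs_mul]
  gcongr
  rw [← Int.cast_abs, Int.abs_eq_natAbs]
  exact_mod_cast hk

variable {M : ℝ} [hM : Fact (0 < M)]

/-- `L²` of the circle of length `M`, with normalized measure. -/
abbrev CircleL2 (M : ℝ) [Fact (0 < M)] := Lp ℂ 2 (haarAddCircle (T := M))

/-- The Fourier coefficients of an element of `L²`. -/
def fc (w : CircleL2 M) (k : ℤ) : ℂ := fourierBasis.repr w k

theorem fc_eq_inner (w : CircleL2 M) (k : ℤ) : fc w k = inner ℂ (fourierBasis k) w :=
  fourierBasis.repr_apply_apply w k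

theorem fc_ext {v w : CircleL2 M} (h : ∀ k, fc v k = fc w k) : v = w :=
  fourierBasis.repr.injective (lp.ext (funext h))

theorem fc_add (v w : CircleL2 M) (k : ℤ) : fc (v + w) k = fc v k + fc w k := by
  simp [fc_eq_inner, inner_add_right]

theorem fc_sub (v w : CircleL2 M) (k : ℤ) : fc (v - w) k = fc v k - fc w k := by
  simp [fc_eq_inner, inner_sub_right]

theorem fc_smul (c : ℂ) (w : CircleL2 M) (k : ℤ) : fc (c • w) k = c * fc w k := by
  simp [fc_eq_inner, inner_smul_right]

theorem hasSum_fc_sq (w : CircleL2 M) : HasSum (fun k => ‖fc w k‖ ^ 2) (‖w‖ ^ 2) := by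
  have h := lp.hasSum_norm (p := 2) (by norm_num) (fourierBasis.repr w)
  simpa [fc] using h

theorem inner_eq_tsum_fc (v w : CircleL2 M) :
    inner ℂ v w = ∑' k, inner ℂ (fc v k) (fc w k) := by
  rw [← fourierBasis.repr.inner_map_map, lp.inner_eq_tsum]; rfl

/-- The element of `L²` with given square-summable Fourier coefficients. -/
def ofCoeff (c : ℤ → ℂ) (hc : Summable fun k => ‖c k‖ ^ 2) : CircleL2 M :=
  fourierBasis.repr.symm ⟨c, memℓp_gen (by simpa using hc)⟩

theorem fc_ofCoeff (c : ℤ → ℂ) (hc : Summable fun k => ‖c k‖ ^ 2) (k : ℤ) :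
    fc (ofCoeff (M := M) c hc) k = c k := by
  simp [fc, ofCoeff]

theorem summable_mul_fc {m : ℤ → ℂ} {C : ℝ} (hm : ∀ k, ‖m k‖ ≤ C) (w : CircleL2 M) :
    Summable fun k => ‖m k * fc w k‖ ^ 2 := by
  refine Summable.of_nonneg_of_le (fun _ => by positivity) (fun k => ?_)
    ((hasSum_fc_sq w).summable.mul_left (C ^ 2))
  rw [norm_mul, mul_pow]
  gcongr
  exact hm k

theorem norm_le_of_fc_le {C : ℝ} (hC : 0 ≤ C) {v w : CircleL2 M}
    (h : ∀ k, ‖fc v k‖ ≤ C * ‖fc w k‖) : ‖v‖ ≤ C * ‖w‖ := by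
  refine le_of_sq_le_sq ?_ (by positivity)
  rw [mul_pow, ← (hasSum_fc_sq v).tsum_eq, ← (hasSum_fc_sq w).tsum_eq, ← tsum_mul_left]
  refine (hasSum_fc_sq v).summable.tsum_le_tsum (fun k => ?_)
    ((hasSum_fc_sq w).summable.mul_left _)
  rw [← mul_pow]
  gcongr
  exact h k

/-- The Fourier multiplier with a bounded symbol. -/
def diagOp (m : ℤ → ℂ) (C : ℝ) (hm : ∀ k, ‖m k‖ ≤ C) : CircleL2 M →L[ℂ] CircleL2 M :=
  LinearMap.mkContinuous
    { toFun := fun w => ofCoeff (fun k => m k * fc w k) (summable_mul_fc hm w)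
      map_add' := fun v w => fc_ext fun k => by
        simp only [fc_ofCoeff, fc_add]; ring
      map_smul' := fun c w => fc_ext fun k => by
        simp only [fc_ofCoeff, fc_smul, RingHom.id_apply]; ring } C
    (fun w => norm_le_of_fc_le ((norm_nonneg _).trans (hm 0)) fun k => by
      simp only [LinearMap.coe_mk, AddHom.coe_mk, fc_ofCoeff, norm_mul]
      gcongr
      exact hm k)

@[simp] theorem fc_diagOp (m : ℤ → ℂ) (C : ℝ) (hm : ∀ k, ‖m k‖ ≤ C) (w : CircleL2 M) (k : ℤ) :
    fc (diagOp m C hm w) k = m k * fc w k :=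
  fc_ofCoeff _ (summable_mul_fc hm w) k

theorem norm_diagOp_le (m : ℤ → ℂ) (C : ℝ) (hm : ∀ k, ‖m k‖ ≤ C) :
    ‖diagOp (M := M) m C hm‖ ≤ C :=
  LinearMap.mkContinuous_norm_le _ ((norm_nonneg _).trans (hm 0)) _

/-- The operator `(1 + ∂ₓ)⁻¹`. -/
def smoothOp (M : ℝ) [Fact (0 < M)] : CircleL2 M →L[ℂ] CircleL2 M :=
  diagOp (fun k => (symb M k)⁻¹) 1 norm_symb_inv_le

@[simp] theorem fc_smoothOp (w : CircleL2 M) (k : ℤ) :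
    fc (smoothOp M w) k = (symb M k)⁻¹ * fc w k := fc_diagOp _ _ _ _ _

theorem fc_smoothOp_pow (j : ℕ) (w : CircleL2 M) (k : ℤ) :
    fc ((smoothOp M ^ j) w) k = (symb M k)⁻¹ ^ j * fc w k := by
  induction j with
  | zero => simp
  | succ j ih => rw [pow_succ', mul_apply_eq_comp, fc_smoothOp, ih]; ring

theorem norm_smoothOp_le : ‖smoothOp M‖ ≤ 1 := norm_diagOp_le _ _ _

/-- The Fourier projection to the modes `|k| ≤ N`. -/
def projOp (M : ℝ) [Fact (0 < M)] (N : ℕ) : CircleL2 M →L[ℂ] CircleL2 M :=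
  diagOp (fun k => if k.natAbs ≤ N then 1 else 0) 1 (fun k => by split_ifs <;> simp)

@[simp] theorem fc_projOp (N : ℕ) (w : CircleL2 M) (k : ℤ) :
    fc (projOp M N w) k = if k.natAbs ≤ N then fc w k else 0 := by
  rw [projOp, fc_diagOp]; split_ifs <;> simp

theorem norm_projOp_le (N : ℕ) : ‖projOp M N‖ ≤ 1 := norm_diagOp_le _ _ _

theorem projOp_symm (N : ℕ) (v w : CircleL2 M) :
    inner ℂ (projOp M N v) w = inner ℂ v (projOp M N w) := by
  simp only [inner_eq_tsum_fc, fc_projOp]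
  congr 1; ext k
  split_ifs <;> simp

/-- The operator `(1 + ∂ₓ)ⁿ` on the modes `|k| ≤ N`. -/
def derivProjOp (M : ℝ) [Fact (0 < M)] (n N : ℕ) : CircleL2 M →L[ℂ] CircleL2 M :=
  diagOp (fun k => if k.natAbs ≤ N then symb M k ^ n else 0) ((1 + |2 * Real.pi / M| * N) ^ n)
    (fun k => by
      split_ifs with h
      · rw [norm_pow]; gcongr; exact norm_symb_le M h
      · rw [norm_zero]; positivity)

@[simp] theorem fc_derivProjOp (n N : ℕ) (w : CircleL2 M) (k : ℤ) :
    fc (derivProjOp M n N w) k = if k.natAbs ≤ N then symb M k ^ n * fc w k else 0 := by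
  rw [derivProjOp, fc_diagOp]; split_ifs <;> simp

theorem derivProjOp_smoothOp_pow (n N : ℕ) (w : CircleL2 M) :
    derivProjOp M n N ((smoothOp M ^ n) w) = projOp M N w := by
  refine fc_ext fun k => ?_
  simp only [fc_derivProjOp, fc_smoothOp_pow, fc_projOp]
  split_ifs
  · rw [← mul_assoc, ← mul_pow, mul_inv_cancel₀ (symb_ne_zero k), one_pow, one_mul]
  · rfl

theorem hasSum_fc_smul (w : CircleL2 M) : HasSum (fun k => fc w k • fourierBasis k) w :=
  fourierBasis.hasSum_repr w

theorem tendsto_projOp (w : CircleL2 M) :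
    Tendsto (fun N => projOp M N w) atTop (𝓝 w) := by
  have h : ∀ N : ℕ, projOp M N w = ∑ k ∈ Finset.Icc (-(N : ℤ)) N, fc w k • fourierBasis k := by
    intro N
    refine fc_ext fun k => ?_
    rw [fc_projOp, fc_eq_inner, fc_eq_inner, inner_sum]
    simp only [inner_smul_right, orthonormal_iff_ite.1 fourierBasis.orthonormal, fc_eq_inner,
      mul_ite, mul_one, mul_zero, Finset.sum_ite_eq]
    congr 1
    rw [Finset.mem_Icc, eq_iff_iff]
    omega
  simp only [h]
  refine (hasSum_fc_smul w).comp ?_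
  refine tendsto_atTop_finset_of_monotone ?_ ?_
  · intro a b hab
    apply Finset.Icc_subset_Icc <;> omega
  · intro k
    exact ⟨k.natAbs, by rw [Finset.mem_Icc]; omega⟩

/-! ### Multiplication operators -/

/-- A continuous function as an element of `L²`. -/
def toL2 : C(AddCircle M, ℂ) →L[ℂ] CircleL2 M := ContinuousMap.toLp 2 haarAddCircle ℂ

theorem toL2_injective : Function.Injective (toL2 (M := M)) :=
  ContinuousMap.toLp_injective haarAddCircle

theorem fc_toL2 (f : C(AddCircle M, ℂ)) (k : ℤ) : fc (toL2 f) k = fourierCoeff f k := by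
  rw [fc, fourierBasis_repr]; exact fourierCoeff_toLp f k

theorem toL2_fourier (k : ℤ) : toL2 (fourier k) = fourierBasis (T := M) k := by
  rw [coe_fourierBasis]; rfl

/-- Multiplication by a continuous function. -/
def mulOp : C(AddCircle M, ℂ) →L[ℂ] CircleL2 M →L[ℂ] CircleL2 M :=
  ((ContinuousLinearMap.mul ℂ ℂ).holderL haarAddCircle ∞ 2 2).comp
    (ContinuousMap.toLp ∞ haarAddCircle ℂ)

theorem coeFn_mulOp (g : C(AddCircle M, ℂ)) (w : CircleL2 M) :
    mulOp g w =ᵐ[haarAddCircle] fun x => g x * w x := by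
  have h1 := (ContinuousLinearMap.mul ℂ ℂ).coeFn_holder (r := 2)
    (ContinuousMap.toLp ∞ haarAddCircle ℂ g) w
  have h2 := ContinuousMap.coeFn_toLp (p := ∞) (𝕜 := ℂ) haarAddCircle g
  have h3 : mulOp g w = (ContinuousLinearMap.mul ℂ ℂ).holder 2
    (ContinuousMap.toLp ∞ haarAddCircle ℂ g) w := rfl
  rw [h3]
  filter_upwards [h1, h2] with x h1 h2
  rw [h1, h2]; rfl

theorem coeFn_toL2 (f : C(AddCircle M, ℂ)) : toL2 f =ᵐ[haarAddCircle] f :=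
  ContinuousMap.coeFn_toLp (p := 2) (𝕜 := ℂ) haarAddCircle f

theorem mulOp_toL2 (g f : C(AddCircle M, ℂ)) : mulOp g (toL2 f) = toL2 (g * f) := by
  refine Lp.ext ?_
  filter_upwards [coeFn_mulOp g (toL2 f), coeFn_toL2 f, coeFn_toL2 (g * f)] with x h1 h2 h3
  rw [h1, h2, h3]; rfl

theorem mulOp_mulOp (g h : C(AddCircle M, ℂ)) (w : CircleL2 M) :
    mulOp g (mulOp h w) = mulOp (g * h) w := by
  refine Lp.ext ?_
  filter_upwards [coeFn_mulOp g (mulOp h w), coeFn_mulOp h w, coeFn_mulOp (g * h) w]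
    with x h1 h2 h3
  rw [h1, h2, h3, ContinuousMap.mul_apply, mul_assoc]

theorem mulOp_one (w : CircleL2 M) : mulOp 1 w = w := by
  refine Lp.ext ?_
  filter_upwards [coeFn_mulOp 1 w] with x h1
  rw [h1, ContinuousMap.one_apply, one_mul]

theorem norm_mulOp_apply_le {g : C(AddCircle M, ℂ)} {C : ℝ} (hg : ∀ x, ‖g x‖ ≤ C)
    (w : CircleL2 M) : ‖mulOp g w‖ ≤ C * ‖w‖ := by
  refine Lp.norm_le_mul_norm_of_ae_le_mul ?_
  filter_upwards [coeFn_mulOp g w] with x h1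
  rw [h1, norm_mul]
  gcongr
  exact hg x

theorem norm_mulOp_le {g : C(AddCircle M, ℂ)} {C : ℝ} (hC : 0 ≤ C) (hg : ∀ x, ‖g x‖ ≤ C) :
    ‖mulOp g‖ ≤ C :=
  ContinuousLinearMap.opNorm_le_bound _ hC (norm_mulOp_apply_le hg)

theorem inner_mulOp (g : C(AddCircle M, ℂ)) (v w : CircleL2 M) :
    inner ℂ (mulOp g v) w = inner ℂ v (mulOp (star g) w) := by
  rw [L2.inner_def, L2.inner_def]
  refine integral_congr_ae ?_
  filter_upwards [coeFn_mulOp g v, coeFn_mulOp (star g) w] with x h1 h2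
  rw [h1, h2]
  simp only [RCLike.inner_apply, map_mul, ContinuousMap.star_apply, RCLike.star_def]
  ring

theorem re_inner_mulOp_self_ge {g : C(AddCircle M, ℂ)} {c : ℝ} (hg : ∀ x, c ≤ (g x).re)
    (w : CircleL2 M) : c * ‖w‖ ^ 2 ≤ (inner ℂ (mulOp g w) w).re := by
  have h1 : Integrable (fun x => inner ℂ (mulOp g w x) (w x)) (haarAddCircle (T := M)) :=
    L2.integrable_inner _ _
  have h2 : Integrable (fun x => inner ℂ (w x) (w x)) (haarAddCircle (T := M)) :=
    L2.integrable_inner _ _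
  have h3 : ‖w‖ ^ 2 = (inner ℂ w w).re := by
    rw [inner_self_eq_norm_sq_to_K]; norm_cast
  rw [h3, L2.inner_def, L2.inner_def]
  have e1 := integral_re h1
  have e2 := integral_re h2
  simp only [RCLike.re_to_complex] at e1 e2
  rw [← e1, ← e2, ← integral_const_mul]
  refine integral_mono_ae (h2.re.const_mul c) h1.re ?_
  filter_upwards [coeFn_mulOp g w] with x hx
  rw [hx]
  have e : (inner ℂ (w x) (w x)).re = ‖w x‖ ^ 2 := by
    rw [inner_self_eq_norm_sq_to_K]; norm_cast
  have e' : (inner ℂ (g x * w x) (w x)).re = (g x).re * ‖w x‖ ^ 2 := by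
    rw [← smul_eq_mul, inner_smul_left, inner_self_eq_norm_sq_to_K, ← RCLike.ofReal_pow]
    exact (Complex.re_mul_ofReal _ _).trans (by rw [Complex.conj_re]; rfl)
  change c * (inner ℂ (w x) (w x)).re ≤ (inner ℂ (g x * w x) (w x)).re
  rw [e, e']
  gcongr
  exact hg x

/-- Complex conjugation on `L²`. -/
def conjOp : CircleL2 M →L[ℝ] CircleL2 M :=
  (Complex.conjCLE : ℂ →L[ℝ] ℂ).compLpL 2 haarAddCircle

theorem coeFn_conjOp (w : CircleL2 M) :
    conjOp w =ᵐ[haarAddCircle] fun x => starRingEnd ℂ (w x) := by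
  filter_upwards [ContinuousLinearMap.coeFn_compLpL (p := 2) (Complex.conjCLE : ℂ →L[ℝ] ℂ) w]
    with x hx
  rw [conjOp, hx]; simp

theorem fc_conjOp (w : CircleL2 M) (k : ℤ) : fc (conjOp w) k = starRingEnd ℂ (fc w (-k)) := by
  rw [fc, fc, fourierBasis_repr, fourierBasis_repr, fourierCoeff, fourierCoeff, ← integral_conj]
  refine integral_congr_ae ?_
  filter_upwards [coeFn_conjOp w] with x hx
  rw [hx, smul_eq_mul, smul_eq_mul, map_mul, fourier_neg (n := -k)]
  simp

theorem conjOp_mulOp {g : C(AddCircle M, ℂ)} (hg : star g = g) (w : CircleL2 M) :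
    conjOp (mulOp g w) = mulOp g (conjOp w) := by
  refine Lp.ext ?_
  filter_upwards [coeFn_conjOp (mulOp g w), coeFn_mulOp g w, coeFn_mulOp g (conjOp w),
    coeFn_conjOp w] with x h1 h2 h3 h4
  rw [h1, h2, h3, h4, map_mul]
  congr 1
  exact DFunLike.congr_fun hg x

theorem conjOp_projOp (N : ℕ) (w : CircleL2 M) : conjOp (projOp M N w) = projOp M N (conjOp w) := by
  refine fc_ext fun k => ?_
  simp only [fc_conjOp, fc_projOp, Int.natAbs_neg]
  split_ifs <;> simp

theorem conjOp_derivProjOp (n N : ℕ) (w : CircleL2 M) :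
    conjOp (derivProjOp M n N w) = derivProjOp M n N (conjOp w) := by
  refine fc_ext fun k => ?_
  simp only [fc_conjOp, fc_derivProjOp, Int.natAbs_neg]
  split_ifs <;> simp [symb_neg]

end Circle

/-! ### Derivatives on the circle and the exact Leibniz rule for powers of (1 + ∂ₓ)⁻¹ -/

section Derivatives

open AddCircle ENNReal

variable {M : ℝ}

/-- `f'` is the derivative of `f`, both being continuous functions on the circle. -/
def IsDeriv (f f' : C(AddCircle M, ℂ)) : Prop :=
  ∀ x : ℝ, HasDerivAt (fun y : ℝ => f (y : AddCircle M)) (f' (x : AddCircle M)) x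

namespace IsDeriv

variable {f f' g g' : C(AddCircle M, ℂ)}

theorem congr_deriv (h : IsDeriv f f') (e : f' = g') : IsDeriv f g' := e ▸ h

theorem add (hf : IsDeriv f f') (hg : IsDeriv g g') : IsDeriv (f + g) (f' + g') :=
  fun x => (hf x).add (hg x)

theorem sub (hf : IsDeriv f f') (hg : IsDeriv g g') : IsDeriv (f - g) (f' - g') :=
  fun x => (hf x).sub (hg x)

theorem neg (hf : IsDeriv f f') : IsDeriv (-f) (-f') := fun x => (hf x).neg

theorem const_smul (c : ℂ) (hf : IsDeriv f f') : IsDeriv (c • f) (c • f') :=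
  fun x => (hf x).const_smul c

theorem mul (hf : IsDeriv f f') (hg : IsDeriv g g') : IsDeriv (f * g) (f' * g + f * g') :=
  fun x => (hf x).mul (hg x)

theorem star (hf : IsDeriv f f') : IsDeriv (star f) (star f') := fun x =>
  (Complex.conjCLE : ℂ →L[ℝ] ℂ).hasFDerivAt.comp_hasDerivAt x (hf x)

theorem sum {ι : Type*} {s : Finset ι} {F F' : ι → C(AddCircle M, ℂ)}
    (h : ∀ i ∈ s, IsDeriv (F i) (F' i)) : IsDeriv (∑ i ∈ s, F i) (∑ i ∈ s, F' i) := by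
  intro x
  simpa only [ContinuousMap.sum_apply] using HasDerivAt.fun_sum fun i hi => h i hi x

theorem inv (hf : IsDeriv f f') (h : f * g = 1) : IsDeriv g (-(g * g * f')) := by
  have hp : ∀ x, f x * g x = 1 := fun x => DFunLike.congr_fun h x
  have hg : ∀ x, g x = (f x)⁻¹ := fun x => eq_inv_of_mul_eq_one_right (hp x)
  intro x
  have hne : f (x : AddCircle M) ≠ 0 := left_ne_zero_of_mul_eq_one (hp x)
  have := (hf x).inv hne
  simp only [Pi.inv_def, ← hg] at this
  refine this.congr_deriv ?_
  simp only [ContinuousMap.neg_apply, ContinuousMap.mul_apply, hg]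
  field_simp

end IsDeriv

theorem isDeriv_fourier (k : ℤ) :
    IsDeriv (fourier (T := M) k) ((waveNumber M k * Complex.I : ℂ) • fourier k) := by
  intro x
  refine (hasDerivAt_fourier M k x).congr_deriv ?_
  rw [ContinuousMap.smul_apply, smul_eq_mul]
  congr 1
  simp only [waveNumber]
  push_cast
  ring

variable [hM : Fact (0 < M)]

theorem IsDeriv.fourierCoeff {f f' : C(AddCircle M, ℂ)} (hf : IsDeriv f f') (k : ℤ) :
    fourierCoeff f' k = waveNumber M k * Complex.I * fourierCoeff f k := by
  have h := (isDeriv_fourier (M := M) (-k)).mul hf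
  have hint : ∀ g : C(AddCircle M, ℂ), IntervalIntegrable (fun x : ℝ => g (x : AddCircle M))
      volume 0 M := fun g => (g.continuous.comp (AddCircle.continuous_mk' M)).intervalIntegrable _ _
  have e := intervalIntegral.integral_eq_sub_of_hasDerivAt (fun x _ => h x) (hint _)
  have hMz : ((M : ℝ) : AddCircle M) = ((0 : ℝ) : AddCircle M) := by
    rw [AddCircle.coe_period, AddCircle.coe_zero]
  rw [hMz, sub_self] at e
  set F₁ : C(AddCircle M, ℂ) := ((waveNumber M (-k) * Complex.I : ℂ) • fourier (-k)) * f with hF₁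
  set F₂ : C(AddCircle M, ℂ) := fourier (-k) * f' with hF₂
  set F₃ : C(AddCircle M, ℂ) := fourier (-k) * f with hF₃
  have e2 : (∫ x : ℝ in 0..M, F₁ (x : AddCircle M)) + ∫ x : ℝ in 0..M, F₂ (x : AddCircle M) = 0 := by
    rw [← intervalIntegral.integral_add (hint _) (hint _)]; exact e
  have e3 : (∫ x : ℝ in 0..M, F₁ (x : AddCircle M))
      = -(waveNumber M k * Complex.I) * ∫ x : ℝ in 0..M, F₃ (x : AddCircle M) := by
    rw [← intervalIntegral.integral_const_mul]
    refine intervalIntegral.integral_congr fun x _ => ?_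
    simp only [hF₁, hF₃, ContinuousMap.mul_apply, ContinuousMap.smul_apply, smul_eq_mul, waveNumber]
    push_cast
    ring
  rw [e3] at e2
  have e4 : (∫ x : ℝ in 0..M, F₂ (x : AddCircle M))
      = (waveNumber M k * Complex.I) * ∫ x : ℝ in 0..M, F₃ (x : AddCircle M) := by
    linear_combination e2
  rw [fourierCoeff_eq_intervalIntegral _ _ 0, fourierCoeff_eq_intervalIntegral _ _ 0, zero_add]
  have e5 := congrArg (fun z : ℂ => (1 / M : ℝ) • z) e4
  simp only [hF₂, hF₃, ContinuousMap.mul_apply] at e5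
  simp only [smul_eq_mul] at e5 ⊢
  rw [e5, mul_smul_comm]

theorem IsDeriv.fc {f f' : C(AddCircle M, ℂ)} (hf : IsDeriv f f') (k : ℤ) :
    fc (toL2 f') k = (symb M k - 1) * fc (toL2 f) k := by
  rw [fc_toL2, fc_toL2, hf.fourierCoeff, symb]; ring

theorem IsDeriv.smoothOp_add {f f' : C(AddCircle M, ℂ)} (hf : IsDeriv f f') :
    smoothOp M (toL2 f + toL2 f') = toL2 f := by
  refine fc_ext fun k => ?_
  rw [fc_smoothOp, fc_add, hf.fc]
  have := symb_ne_zero (M := M) k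
  field_simp
  ring

theorem IsDeriv.smoothOp_deriv {f f' : C(AddCircle M, ℂ)} (hf : IsDeriv f f') :
    smoothOp M (toL2 f') = toL2 f - smoothOp M (toL2 f) := by
  rw [eq_sub_iff_add_eq', ← map_add, hf.smoothOp_add]

theorem IsDeriv.integral_eq_zero {f f' : C(AddCircle M, ℂ)} (hf : IsDeriv f f') :
    ∫ x, f' x ∂(haarAddCircle (T := M)) = 0 := by
  have := hf.fourierCoeff 0
  simpa [_root_.fourierCoeff, waveNumber] using this

/-- The commutator of a multiplication with `(1 + ∂ₓ)⁻¹`. -/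
theorem IsDeriv.mulOp_smoothOp {a a' : C(AddCircle M, ℂ)} (ha : IsDeriv a a') :
    mulOp a * smoothOp M = smoothOp M * (mulOp a + mulOp a' * smoothOp M) := by
  -- Both sides are bounded, so Fourier modes suffice. On a mode e, (1 + ∂ₓ)⁻¹ is explicit, and
  -- applying it to ae + (ae)' returns ae.
  refine ContinuousLinearMap.ext_on (s := range (fourierBasis (T := M))) ?_ ?_
  · rw [dense_iff_closure_eq, ← Submodule.topologicalClosure_coe, fourierBasis.dense_span]; rfl
  · rintro _ ⟨k, rfl⟩
    have hS : smoothOp M (fourierBasis k) = (symb M k)⁻¹ • fourierBasis k := by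
      refine fc_ext fun l => ?_
      rw [fc_smoothOp, fc_smul, fc_eq_inner, orthonormal_iff_ite.1 fourierBasis.orthonormal]
      split_ifs with h
      · rw [h]
      · simp
    have hd := (ha.mul (isDeriv_fourier (M := M) k)).smoothOp_add
    simp only [mul_apply_eq_comp, _root_.add_apply, hS, map_smul]
    simp only [mul_smul_comm, map_add, map_smul] at hd
    simp only [← toL2_fourier, mulOp_toL2, map_add, map_smul]
    conv_lhs => rw [← hd]
    have hc : (symb M k)⁻¹ * (1 + waveNumber M k * Complex.I : ℂ) = 1 :=
      inv_mul_cancel₀ (symb_ne_zero k)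
    generalize smoothOp M (toL2 (a * fourier k)) = X
    generalize smoothOp M (toL2 (a' * fourier k)) = Y
    calc _ = ((symb M k)⁻¹ * (1 + waveNumber M k * Complex.I : ℂ)) • X + (symb M k)⁻¹ • Y := by
          module
      _ = _ := by rw [hc, one_smul]

/-- `∂ₓ^j` acts on a chain by shifting. -/
def IsChain (J : ℕ) (A : ℕ → C(AddCircle M, ℂ)) : Prop := ∀ j < J, IsDeriv (A j) (A (j + 1))

/-- The terms of the Leibniz expansion of `(1 + ∂ₓ)ⁿ ∘ A₀ ∘ (1 + ∂ₓ)⁻ⁿ` from the `i`-th on, with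
`(1 + ∂ₓ)⁻ⁱ` split off. -/
def leibnizTail (n : ℕ) (A : ℕ → C(AddCircle M, ℂ)) (i : ℕ) : CircleL2 M →L[ℂ] CircleL2 M :=
  ∑ j ∈ Finset.range (n + 1 - i),
    ((n.choose (i + j) : ℕ) : ℂ) • (mulOp (A (i + j)) * smoothOp M ^ j)

theorem leibnizTail_zero_eq {n i : ℕ} (hi : i ≤ n) (A : ℕ → C(AddCircle M, ℂ)) :
    leibnizTail n A 0 = (∑ j ∈ Finset.range i,
      ((n.choose j : ℕ) : ℂ) • (mulOp (A j) * smoothOp M ^ j))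
      + leibnizTail n A i * smoothOp M ^ i := by
  have e : n + 1 - 0 = i + (n + 1 - i) := by omega
  rw [leibnizTail, e, Finset.sum_range_add, leibnizTail, Finset.sum_mul]
  simp only [zero_add, smul_mul_assoc, mul_assoc, ← pow_add]
  congr 1
  refine Finset.sum_congr rfl fun j _ => ?_
  rw [add_comm j i]

/-- The binomial coefficients sum to 2ⁿ, and powers of (1 + ∂ₓ)⁻¹ are contractions. -/
theorem norm_leibnizTail_apply_le {n : ℕ} {A : ℕ → C(AddCircle M, ℂ)} {r : ℝ}
    (hA : ∀ j ≤ n, ∀ x, ‖A j x‖ ≤ r) (i : ℕ) (w : CircleL2 M) :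
    ‖leibnizTail n A i w‖ ≤ 2 ^ n * r * ‖w‖ := by
  have hr : 0 ≤ r := (norm_nonneg _).trans (hA 0 (Nat.zero_le n) 0)
  refine ContinuousLinearMap.le_of_opNorm_le _ ?_ w
  rw [leibnizTail]
  have hterm : ∀ j ∈ Finset.range (n + 1 - i),
      ‖((n.choose (i + j) : ℕ) : ℂ) • (mulOp (A (i + j)) * smoothOp M ^ j)‖
        ≤ (n.choose (i + j) : ℝ) * r := by
    intro j hj
    rw [Finset.mem_range] at hj
    rw [norm_smul, Complex.norm_natCast]
    gcongr
    refine (norm_mul_le _ _).trans ?_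
    rw [← mul_one r]
    have hS : ‖smoothOp M ^ j‖ ≤ 1 := by
      refine ContinuousLinearMap.opNorm_le_bound _ zero_le_one fun w => ?_
      refine norm_le_of_fc_le zero_le_one fun k => ?_
      rw [fc_smoothOp_pow, norm_mul, norm_pow]
      gcongr
      exact pow_le_one₀ (norm_nonneg _) (norm_symb_inv_le k)
    gcongr
    exact norm_mulOp_le hr (hA _ (by omega))
  refine (norm_sum_le_of_le _ hterm).trans ?_
  rw [← Finset.sum_mul]
  gcongr
  have h2 : ∑ j ∈ Finset.range (n + 1 - i), n.choose (i + j) ≤ 2 ^ n := by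
    rw [← Nat.sum_range_choose n]
    rcases le_or_gt i (n + 1) with hi | hi
    · have e : n + 1 = i + (n + 1 - i) := by omega
      conv_rhs => rw [e, Finset.sum_range_add]
      omega
    · have : n + 1 - i = 0 := by omega
      simp [this]
  exact_mod_cast h2

/-- Induction on n: each further factor (1 + ∂ₓ)⁻¹ is commuted past every term by the first-order
commutator, and Pascal's rule recombines the two resulting sums. -/
theorem mulOp_smoothOp_pow {n : ℕ} {A : ℕ → C(AddCircle M, ℂ)} (hA : IsChain n A) :
    mulOp (A 0) * smoothOp M ^ n = smoothOp M ^ n * leibnizTail n A 0 := by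
  induction n with
  | zero => simp [leibnizTail]
  | succ n ih =>
    have hA' : IsChain n A := fun j hj => hA j (by omega)
    rw [pow_succ, ← mul_assoc, ih hA', mul_assoc, mul_assoc]
    congr 1
    have h1 : leibnizTail n A 0 * smoothOp M = smoothOp M * ∑ j ∈ Finset.range (n + 1),
        ((n.choose j : ℕ) : ℂ) • (mulOp (A j) * smoothOp M ^ j
          + mulOp (A (j + 1)) * smoothOp M ^ (j + 1)) := by
      rw [leibnizTail, Finset.sum_mul, Finset.mul_sum]
      refine Finset.sum_congr rfl fun j hj => ?_
      rw [Finset.mem_range] at hj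
      have := (hA j (by omega)).mulOp_smoothOp
      rw [zero_add, smul_mul_assoc, mul_smul_comm, mul_assoc, ← pow_succ, pow_succ', ← mul_assoc,
        this, mul_assoc, add_mul, mul_assoc (mulOp (A (j + 1)))]
    rw [h1]
    congr 1
    simp only [leibnizTail, Nat.sub_zero, zero_add]
    rw [Finset.sum_range_succ' _ (n + 1)]
    simp only [Nat.choose_succ_succ, Nat.cast_add, add_smul, smul_add, Finset.sum_add_distrib,
      Nat.choose_zero_right, Nat.cast_one, one_smul]
    rw [add_comm (∑ j ∈ Finset.range (n + 1), ((n.choose j : ℕ) : ℂ) •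
      (mulOp (A j) * smoothOp M ^ j)), add_assoc]
    congr 1
    rw [Finset.sum_range_succ', Finset.sum_range_succ _ n]
    simp

/-! ### The embedding of `H¹` into the continuous functions -/

theorem summable_symb_inv_sq : Summable fun k : ℤ => ‖(symb M k)⁻¹‖ ^ 2 := by
  have h : ∀ k : ℤ, ‖(symb M k)⁻¹‖ ^ 2 = (1 + waveNumber M k ^ 2)⁻¹ := by
    intro k; rw [norm_inv, inv_pow, norm_symb_sq]
  simp only [h]
  set c := (2 * Real.pi / M) ^ 2 with hc
  have hc0 : 0 < c := by
    have := hM.out; have := Real.pi_pos; positivity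
  have hw : ∀ k : ℤ, waveNumber M k ^ 2 = c * (k : ℝ) ^ 2 := by
    intro k; rw [waveNumber, hc]; ring
  have hs : Summable fun k : ℤ => c⁻¹ * (1 / (k : ℝ) ^ 2) :=
    (Real.summable_one_div_int_pow.2 one_lt_two).mul_left _
  refine Summable.of_norm_bounded_eventually hs ?_
  rw [eventually_cofinite]
  refine (finite_singleton (0 : ℤ)).subset fun k hk => ?_
  by_contra hk0
  apply hk
  have hk1 : (0 : ℝ) < (k : ℝ) ^ 2 := by
    have : (k : ℝ) ≠ 0 := by exact_mod_cast hk0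
    positivity
  rw [Real.norm_of_nonneg (by positivity), hw, one_div, ← mul_inv]
  apply inv_anti₀ (by positivity)
  linarith

theorem summable_embed (w : CircleL2 M) : Summable fun k => ‖(symb M k)⁻¹ * fc w k‖ := by
  have := (summable_symb_inv_sq (M := M)).add (hasSum_fc_sq w).summable
  refine Summable.of_nonneg_of_le (fun _ => norm_nonneg _) (fun k => ?_) this
  rw [norm_mul]
  nlinarith [sq_nonneg (‖(symb M k)⁻¹‖ - ‖fc w k‖), sq_nonneg ‖(symb M k)⁻¹‖, sq_nonneg ‖fc w k‖,
    norm_nonneg (symb M k)⁻¹, norm_nonneg (fc w k)]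

theorem summable_embed_fourier (w : CircleL2 M) :
    Summable fun k => ((symb M k)⁻¹ * fc w k) • fourier (T := M) k := by
  refine Summable.of_norm ?_
  simpa only [norm_smul, fourier_norm, mul_one] using summable_embed w

/-- The continuous representative of `(1 + ∂ₓ)⁻¹ w`. -/
def embed : CircleL2 M →L[ℂ] C(AddCircle M, ℂ) :=
  LinearMap.mkContinuous
    { toFun := fun w => ∑' k, ((symb M k)⁻¹ * fc w k) • fourier (T := M) k
      map_add' := fun v w => by
        rw [← (summable_embed_fourier v).tsum_add (summable_embed_fourier w)]
        simp only [fc_add, mul_add, add_smul]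
      map_smul' := fun c w => by
        rw [RingHom.id_apply, ← (summable_embed_fourier w).tsum_const_smul]
        simp only [fc_smul, smul_smul]
        congr 1; ext1 k; congr 1; ring }
    (Real.sqrt (∑' k : ℤ, ‖(symb M k)⁻¹‖ ^ 2)) (fun w => by
      simp only [LinearMap.coe_mk, AddHom.coe_mk]
      refine (norm_tsum_le_tsum_norm ?_).trans ?_
      · simpa only [norm_smul, fourier_norm, mul_one] using summable_embed w
      · simp only [norm_smul, fourier_norm, mul_one, norm_mul]
        have h := Real.inner_le_Lp_mul_Lq_tsum_of_nonneg (p := 2) (q := 2)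
          (f := fun k : ℤ => ‖(symb M k)⁻¹‖) (g := fun k => ‖fc w k‖) (by constructor <;> norm_num)
          (fun _ => norm_nonneg _) (fun _ => norm_nonneg _)
          (by simpa using summable_symb_inv_sq (M := M)) (by simpa using (hasSum_fc_sq w).summable)
        have h2 := h
        simp only [Real.rpow_two, (hasSum_fc_sq w).tsum_eq, ← Real.sqrt_eq_rpow,
          Real.sqrt_sq (norm_nonneg w)] at h2
        exact h2)

theorem embed_apply (w : CircleL2 M) :
    embed w = ∑' k, ((symb M k)⁻¹ * fc w k) • fourier (T := M) k := rfl

theorem toL2_embed (w : CircleL2 M) : toL2 (embed w) = smoothOp M w := by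
  rw [embed_apply, toL2.map_tsum (summable_embed_fourier w)]
  rw [← (hasSum_fc_smul (smoothOp M w)).tsum_eq]
  simp only [map_smul, toL2_fourier, fc_smoothOp]

/-- The identity is ∂ₓ(1 + ∂ₓ)⁻¹ = 1 - (1 + ∂ₓ)⁻¹. Termwise differentiation is justified because the
differentiated Fourier series is dominated by twice the absolutely convergent series of `embed w`.
-/
theorem isDeriv_embed (w : CircleL2 M) :
    IsDeriv (embed (smoothOp M w)) (embed (w - smoothOp M w)) := by
  intro x
  have hpt : ∀ (v : CircleL2 M) (y : AddCircle M),
      embed v y = ∑' k, ((symb M k)⁻¹ * fc v k) * fourier (T := M) k y := by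
    intro v y
    rw [embed_apply]
    have := (ContinuousMap.evalCLM ℂ y).map_tsum (summable_embed_fourier v)
    simpa using this
  simp only [hpt]
  have hbound : ∀ k, ‖(symb M k)⁻¹ * fc (w - smoothOp M w) k‖ ≤ 2 * ‖(symb M k)⁻¹ * fc w k‖ := by
    intro k
    rw [fc_sub, fc_smoothOp, norm_mul, norm_mul]
    have : ‖fc w k - (symb M k)⁻¹ * fc w k‖ ≤ 2 * ‖fc w k‖ := by
      refine (norm_sub_le _ _).trans ?_
      rw [norm_mul]
      nlinarith [norm_symb_inv_le (M := M) k, norm_nonneg (fc w k)]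
    nlinarith [norm_nonneg (symb M k)⁻¹]
  refine hasDerivAt_tsum (u := fun k => 2 * ‖(symb M k)⁻¹ * fc w k‖)
    ((summable_embed w).mul_left 2) (y₀ := (0 : ℝ))
    (g := fun k (y : ℝ) => ((symb M k)⁻¹ * fc (smoothOp M w) k) * fourier (T := M) k (y : AddCircle M))
    (g' := fun k (y : ℝ) => ((symb M k)⁻¹ * fc (w - smoothOp M w) k)
      * fourier (T := M) k (y : AddCircle M)) ?_ ?_ ?_ x
  · intro k y
    refine (HasDerivAt.const_mul ((symb M k)⁻¹ * fc (smoothOp M w) k)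
      (isDeriv_fourier (M := M) k y)).congr_deriv ?_
    rw [fc_sub, fc_smoothOp, ContinuousMap.smul_apply, smul_eq_mul]
    have e : (waveNumber M k * Complex.I : ℂ) = symb M k - 1 := by rw [symb]; ring
    have := symb_ne_zero (M := M) k
    rw [e]
    field_simp
  · intro k y
    rw [norm_mul]
    refine (mul_le_of_le_one_right (norm_nonneg _) ?_).trans (hbound k)
    exact ((fourier k).norm_coe_le_norm _).trans (fourier_norm k).le
  · refine Summable.of_norm ?_
    refine Summable.of_nonneg_of_le (fun _ => norm_nonneg _) (fun k => ?_)
      (summable_embed (smoothOp M w))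
    rw [norm_mul]
    refine mul_le_of_le_one_right (norm_nonneg _) ?_
    exact ((fourier k).norm_coe_le_norm _).trans (fourier_norm k).le

end Derivatives

/-! ### Weighted energy estimate for third-order operators -/

section EnergyEstimate

open AddCircle ENNReal

variable {M : ℝ}

/-- `c` is a uniform bound of `u`. -/
def IsBd (u : C(AddCircle M, ℂ)) (c : ℝ) : Prop := ∀ x, ‖u x‖ ≤ c

namespace IsBd

variable {u v : C(AddCircle M, ℂ)} {a b : ℝ}

theorem nonneg (hu : IsBd u a) : 0 ≤ a := (norm_nonneg _).trans (hu 0)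

theorem mono (hu : IsBd u a) (h : a ≤ b) : IsBd u b := fun x => (hu x).trans h

theorem mul (hu : IsBd u a) (hv : IsBd v b) : IsBd (u * v) (a * b) := fun x => by
  rw [ContinuousMap.mul_apply, norm_mul]
  exact mul_le_mul (hu x) (hv x) (norm_nonneg _) hu.nonneg

theorem add (hu : IsBd u a) (hv : IsBd v b) : IsBd (u + v) (a + b) := fun x =>
  (norm_add_le _ _).trans (add_le_add (hu x) (hv x))

theorem sub (hu : IsBd u a) (hv : IsBd v b) : IsBd (u - v) (a + b) := fun x =>
  (norm_sub_le _ _).trans (add_le_add (hu x) (hv x))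

theorem neg (hu : IsBd u a) : IsBd (-u) a := fun x => by
  rw [ContinuousMap.neg_apply, norm_neg]; exact hu x

theorem smul (hu : IsBd u a) {c : ℂ} {d : ℝ} (hc : ‖c‖ ≤ d) : IsBd (c • u) (d * a) := fun x => by
  rw [ContinuousMap.smul_apply, norm_smul]
  exact mul_le_mul hc (hu x) (norm_nonneg _) ((norm_nonneg _).trans hc)

end IsBd

variable [hM : Fact (0 < M)]

theorem inner_toL2 (u v : C(AddCircle M, ℂ)) :
    inner ℂ (toL2 u) (toL2 v) = ∫ x, (v * star u) x ∂(haarAddCircle (T := M)) :=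
  ContinuousMap.inner_toLp haarAddCircle u v

/-- The basic integration by parts: if `f' = (2/3) g`, then the quadratic form of
`f ∂ₓ³ + g ∂ₓ² + h ∂ₓ` is of order zero. -/
theorem re_inner_third_order_le {f g h g₁ g₂ h₁ : C(AddCircle M, ℂ)}
    (hf : IsDeriv f ((2 / 3 : ℂ) • g)) (hg : IsDeriv g g₁) (hg₁ : IsDeriv g₁ g₂)
    (hh : IsDeriv h h₁) (sf : star f = f) (sg : star g = g) (sh : star h = h)
    {Y : ℕ → C(AddCircle M, ℂ)} (hY : IsChain 3 Y) {B : ℝ}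
    (hB : IsBd ((1 / 3 : ℂ) • g₂ - h₁) (2 * B)) :
    (inner ℂ (toL2 (Y 0)) (toL2 (f * Y 3 + g * Y 2 + h * Y 1))).re ≤ B * ‖toL2 (Y 0)‖ ^ 2 := by
  set X : C(AddCircle M, ℂ) := (f * Y 3 + g * Y 2 + h * Y 1) * star (Y 0) with hX
  set Z : C(AddCircle M, ℂ) := ((1 / 3 : ℂ) • g₂ - h₁) * Y 0 * star (Y 0) with hZ
  have y0 := hY 0 (by norm_num)
  have y1 := hY 1 (by norm_num)
  have y2 := hY 2 (by norm_num)
  -- The explicit antiderivative is f(2 Re ȳy'' - |y'|²) + (2/3) g Re ȳy' - (1/3) g'|y|² + h|y|². By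
  -- f' = (2/3) g, all |y'|² terms cancel in its derivative, which equals 2 Re of the integrand
  -- minus (g''/3 - h')|y|².
  have hd := ((hf.mul ((y0.star.mul y2).sub (y1.mul y1.star)|>.add (y0.mul y2.star)|>.add
      (y1.star.mul y1)|>.sub (y1.mul y1.star))).add
      ((hg.mul ((y0.star.mul y1).add (y0.mul y1.star))).const_smul (1 / 3 : ℂ))).sub
      ((hg₁.mul (y0.mul y0.star)).const_smul (1 / 3 : ℂ)) |>.add (hh.mul (y0.mul y0.star))
  have hint : ∀ u : C(AddCircle M, ℂ), Integrable u (haarAddCircle (T := M)) := fun u =>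
    u.continuous.integrable_of_hasCompactSupport (HasCompactSupport.of_compactSpace _)
  have key : ∫ x, (X + star X - Z) x ∂(haarAddCircle (T := M)) = 0 := by
    refine IsDeriv.integral_eq_zero (hd.congr_deriv ?_)
    rw [hX, hZ]
    simp only [star_mul', star_add, sf, sg, sh, star_star]
    ext x
    simp only [ContinuousMap.add_apply, ContinuousMap.sub_apply, ContinuousMap.mul_apply,
      ContinuousMap.smul_apply, smul_eq_mul]
    ring
  have h1 : ∫ x, (star X) x ∂(haarAddCircle (T := M))
      = starRingEnd ℂ (∫ x, X x ∂(haarAddCircle (T := M))) := by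
    rw [← integral_conj]; rfl
  have h2 : ∫ x, (X + star X - Z) x ∂(haarAddCircle (T := M))
      = (∫ x, X x ∂(haarAddCircle (T := M))) + (∫ x, (star X) x ∂(haarAddCircle (T := M)))
        - ∫ x, Z x ∂(haarAddCircle (T := M)) := by
    rw [← integral_add (hint _) (hint _)]
    exact integral_sub (hint (X + star X)) (hint Z)
  have h3 : ∫ x, Z x ∂(haarAddCircle (T := M))
      = inner ℂ (toL2 (Y 0)) (mulOp ((1 / 3 : ℂ) • g₂ - h₁) (toL2 (Y 0))) := by
    rw [mulOp_toL2, inner_toL2]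
  rw [h2, h1, h3] at key
  rw [inner_toL2]
  have h4 := congrArg Complex.re key
  simp only [Complex.sub_re, Complex.add_re, Complex.conj_re, Complex.zero_re] at h4
  have h5 : (inner ℂ (toL2 (Y 0)) (mulOp ((1 / 3 : ℂ) • g₂ - h₁) (toL2 (Y 0)))).re
      ≤ 2 * B * ‖toL2 (Y 0)‖ ^ 2 := by
    refine (Complex.re_le_norm _).trans ((norm_inner_le_norm _ _).trans ?_)
    have := norm_mulOp_apply_le hB (toL2 (Y 0))
    nlinarith [norm_nonneg (toL2 (Y 0))]
  linarith

/-- The coefficients of the equation at a fixed time, with their derivatives and bounds; `Ai` is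
the inverse of `A 0`. -/
structure CoeffAt (M : ℝ) (n : ℕ) (r : ℝ) (A B C D : ℕ → C(AddCircle M, ℂ))
    (Ai : C(AddCircle M, ℂ)) : Prop where
  chainA : IsChain (n + 3) A
  chainB : IsChain (n + 2) B
  chainC : IsChain n C
  chainD : IsChain n D
  realA : ∀ j, star (A j) = A j
  realB : ∀ j, star (B j) = B j
  realC : ∀ j, star (C j) = C j
  bdA : ∀ j ≤ n + 3, IsBd (A j) r
  bdB : ∀ j ≤ n, IsBd (B j) r
  bdC : ∀ j ≤ n, IsBd (C j) r
  bdD : ∀ j ≤ n, IsBd (D j) r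
  inv : A 0 * Ai = 1
  bdInv : IsBd Ai r
  four_le : 4 ≤ n
  le_r : (n : ℝ) ≤ r

/-- The logarithmic derivative of the weight at level `m`. -/
def weightLog (m : ℕ) (A B : ℕ → C(AddCircle M, ℂ)) (Ai : C(AddCircle M, ℂ)) :
    C(AddCircle M, ℂ) :=
  Ai * ((((2 * m / 3 - 1 : ℝ) : ℂ)) • A 1 + ((2 / 3 : ℝ) : ℂ) • B 0)

/-- The derivative of `weightLog`. -/
def weightLog' (m : ℕ) (A B : ℕ → C(AddCircle M, ℂ)) (Ai : C(AddCircle M, ℂ)) :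
    C(AddCircle M, ℂ) :=
  -(Ai * Ai * A 1) * ((((2 * m / 3 - 1 : ℝ) : ℂ)) • A 1 + ((2 / 3 : ℝ) : ℂ) • B 0)
    + Ai * ((((2 * m / 3 - 1 : ℝ) : ℂ)) • A 2 + ((2 / 3 : ℝ) : ℂ) • B 1)

/-- The second-order coefficient of the equation satisfied by `(1 + ∂ₓ)ᵐ u`. -/
def secondCoeff (m : ℕ) (A B : ℕ → C(AddCircle M, ℂ)) (j : ℕ) : C(AddCircle M, ℂ) :=
  (m : ℂ) • A (1 + j) + B j

/-- The first-order coefficient of the equation satisfied by `(1 + ∂ₓ)ᵐ u`. -/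
def firstCoeff (m : ℕ) (A B C : ℕ → C(AddCircle M, ℂ)) (j : ℕ) : C(AddCircle M, ℂ) :=
  C j + (m : ℂ) • B (1 + j) - (m : ℂ) • A (1 + j) + (m.choose 2 : ℂ) • A (2 + j)

/-- A weight `ρ` at level `m` with inverse `θ`. -/
structure WeightAt (m : ℕ) (W : ℝ) (A B : ℕ → C(AddCircle M, ℂ)) (Ai ρ θ : C(AddCircle M, ℂ)) :
    Prop where
  real : star ρ = ρ
  real' : star θ = θ
  deriv : IsDeriv ρ (ρ * weightLog m A B Ai)
  inv : ρ * θ = 1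
  bd : IsBd ρ W
  bd' : IsBd θ W

namespace CoeffAt

variable {n m : ℕ} {r W : ℝ} {A B C D : ℕ → C(AddCircle M, ℂ)} {Ai ρ θ : C(AddCircle M, ℂ)}

omit hM in
theorem one_le (h : CoeffAt M n r A B C D Ai) : 4 ≤ r :=
  le_trans (by exact_mod_cast h.four_le) h.le_r

omit hM in
theorem isDeriv_inv (h : CoeffAt M n r A B C D Ai) : IsDeriv Ai (-(Ai * Ai * A 1)) :=
  (h.chainA 0 (by omega)).inv h.inv

omit hM in
theorem isDeriv_weightLog (h : CoeffAt M n r A B C D Ai) :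
    IsDeriv (weightLog m A B Ai) (weightLog' m A B Ai) :=
  h.isDeriv_inv.mul (((h.chainA 1 (by omega)).const_smul _).add
    ((h.chainB 0 (by omega)).const_smul _))

omit hM in
theorem exists_isDeriv_weightLog' (h : CoeffAt M n r A B C D Ai) :
    ∃ q, IsDeriv (weightLog' m A B Ai) q :=
  ⟨_, ((((h.isDeriv_inv.mul h.isDeriv_inv).mul (h.chainA 1 (by omega))).neg.mul
    (((h.chainA 1 (by omega)).const_smul _).add ((h.chainB 0 (by omega)).const_smul _))).add
    (h.isDeriv_inv.mul (((h.chainA 2 (by omega)).const_smul _).add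
    ((h.chainB 1 (by omega)).const_smul _))))⟩

omit hM in
theorem norm_exponent_le (h : CoeffAt M n r A B C D Ai) (hm : m ≤ n) :
    ‖((2 * m / 3 - 1 : ℝ) : ℂ)‖ ≤ 2 * r := by
  have h1 := h.one_le
  have h2 : (m : ℝ) ≤ r := le_trans (by exact_mod_cast hm) h.le_r
  have h3 : (0 : ℝ) ≤ m := by positivity
  rw [Complex.norm_real, Real.norm_eq_abs, abs_le]
  constructor <;> linarith

omit hM in
theorem bd_weightLog (h : CoeffAt M n r A B C D Ai) (hm : m ≤ n) :
    IsBd (weightLog m A B Ai) (3 * r ^ 3) := by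
  have h1 := h.one_le
  have h23 : ‖((2 / 3 : ℝ) : ℂ)‖ ≤ 1 := by rw [Complex.norm_real]; norm_num
  refine (h.bdInv.mul (((h.bdA 1 (by omega)).smul (h.norm_exponent_le hm)).add
    ((h.bdB 0 (by omega)).smul h23))).mono ?_
  have : r ^ 2 ≤ r ^ 3 := pow_le_pow_right₀ (by linarith) (by norm_num)
  nlinarith

omit hM in
theorem bd_weightLog' (h : CoeffAt M n r A B C D Ai) (hm : m ≤ n) :
    IsBd (weightLog' m A B Ai) (6 * r ^ 5) := by
  have h1 := h.one_le
  have hn := h.four_le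
  have h23 : ‖((2 / 3 : ℝ) : ℂ)‖ ≤ 1 := by rw [Complex.norm_real]; norm_num
  refine (((h.bdInv.mul h.bdInv).mul (h.bdA 1 (by omega))).neg.mul
    (((h.bdA 1 (by omega)).smul (h.norm_exponent_le hm)).add ((h.bdB 0 (by omega)).smul h23))
    |>.add (h.bdInv.mul (((h.bdA 2 (by omega)).smul (h.norm_exponent_le hm)).add
    ((h.bdB 1 (by omega)).smul h23)))).mono ?_
  have p2 : r ^ 2 ≤ r ^ 5 := pow_le_pow_right₀ (by linarith) (by norm_num)
  have p3 : r ^ 3 ≤ r ^ 5 := pow_le_pow_right₀ (by linarith) (by norm_num)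
  have p4 : r ^ 4 ≤ r ^ 5 := pow_le_pow_right₀ (by linarith) (by norm_num)
  nlinarith

omit hM in
theorem bd_secondCoeff (h : CoeffAt M n r A B C D Ai) (hm : m ≤ n) {j : ℕ} (hj : j ≤ 2) :
    IsBd (secondCoeff m A B j) (2 * r ^ 2) := by
  have h1 := h.one_le
  have hn := h.four_le
  have h2 : ‖(m : ℂ)‖ ≤ r := by
    rw [Complex.norm_natCast]; exact le_trans (by exact_mod_cast hm) h.le_r
  refine (((h.bdA (1 + j) (by omega)).smul h2).add (h.bdB j (by omega))).mono ?_
  nlinarith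

omit hM in
theorem bd_firstCoeff (h : CoeffAt M n r A B C D Ai) (hm : m ≤ n) {j : ℕ} (hj : j ≤ 1) :
    IsBd (firstCoeff m A B C j) (4 * r ^ 3) := by
  have h1 := h.one_le
  have hn := h.four_le
  have hmr : (m : ℝ) ≤ r := le_trans (by exact_mod_cast hm) h.le_r
  have h2 : ‖(m : ℂ)‖ ≤ r := by rw [Complex.norm_natCast]; exact hmr
  have h3 : ‖(m.choose 2 : ℂ)‖ ≤ r ^ 2 := by
    rw [Complex.norm_natCast]
    calc (m.choose 2 : ℝ) ≤ (m : ℝ) ^ 2 := by exact_mod_cast Nat.choose_le_pow m 2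
      _ ≤ r ^ 2 := by gcongr
  refine ((((h.bdC j (by omega)).add ((h.bdB (1 + j) (by omega)).smul h2)).sub
    ((h.bdA (1 + j) (by omega)).smul h2)).add ((h.bdA (2 + j) (by omega)).smul h3)).mono ?_
  have p2 : r ^ 2 ≤ r ^ 3 := pow_le_pow_right₀ (by linarith) (by norm_num)
  have p1 : r ≤ r ^ 3 := le_self_pow₀ (by linarith) (by norm_num)
  nlinarith

omit hM in
theorem isDeriv_secondCoeff (h : CoeffAt M n r A B C D Ai) {j : ℕ} (hj : j ≤ 1) :
    IsDeriv (secondCoeff m A B j) (secondCoeff m A B (j + 1)) :=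
  ((h.chainA (1 + j) (by have := h.four_le; omega)).const_smul _).add
    (h.chainB j (by have := h.four_le; omega))

omit hM in
theorem isDeriv_firstCoeff (h : CoeffAt M n r A B C D Ai) :
    IsDeriv (firstCoeff m A B C 0) (firstCoeff m A B C 1) :=
  (((h.chainC 0 (by have := h.four_le; omega)).add
    ((h.chainB 1 (by have := h.four_le; omega)).const_smul _)).sub
    ((h.chainA 1 (by have := h.four_le; omega)).const_smul _)).add
    ((h.chainA 2 (by have := h.four_le; omega)).const_smul _)

omit hM in
theorem star_secondCoeff (h : CoeffAt M n r A B C D Ai) (j : ℕ) :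
    star (secondCoeff m A B j) = secondCoeff m A B j := by
  simp [secondCoeff, h.realA, h.realB]

omit hM in
theorem star_firstCoeff (h : CoeffAt M n r A B C D Ai) (j : ℕ) :
    star (firstCoeff m A B C j) = firstCoeff m A B C j := by
  simp [firstCoeff, h.realA, h.realB, h.realC]

/-- The weighted energy estimate at level `m`. -/
theorem re_inner_weight_le (h : CoeffAt M n r A B C D Ai) (hm : m ≤ n)
    (hρ : WeightAt m W A B Ai ρ θ) {Y : ℕ → C(AddCircle M, ℂ)} (hY : IsChain 3 Y) :
    (inner ℂ (mulOp ρ (toL2 (Y 0))) (toL2 (A 0 * Y 3 + secondCoeff m A B 0 * Y 2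
      + firstCoeff m A B C 0 * Y 1))).re ≤ 30 * W * r ^ 8 * ‖toL2 (Y 0)‖ ^ 2 := by
  have h1 := h.one_le
  set q := weightLog m A B Ai with hq
  set q' := weightLog' m A B Ai with hq'
  set b := secondCoeff m A B with hb
  set c := firstCoeff m A B C with hc
  have dq : IsDeriv q q' := h.isDeriv_weightLog
  have df := hρ.deriv.mul (h.chainA 0 (by omega))
  have dg := hρ.deriv.mul (h.isDeriv_secondCoeff (m := m) (j := 0) (by norm_num))
  have dg₁ : IsDeriv _ _ := ((hρ.deriv.mul dq).mul
      (h.isDeriv_secondCoeff (m := m) (j := 0) (by norm_num))).add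
      (hρ.deriv.mul (h.isDeriv_secondCoeff (m := m) (j := 1) (by norm_num)))
  have dh := hρ.deriv.mul (h.isDeriv_firstCoeff (m := m))
  -- This is the defining property of the weight: adding A₁ gives (ρA₀)' = (2/3) ρ (m A₁ + B₀), the
  -- relation between leading and second-order coefficients required by the integration by parts.
  have hAq : q * A 0 = ((2 * m / 3 - 1 : ℝ) : ℂ) • A 1 + ((2 / 3 : ℝ) : ℂ) • B 0 := by
    rw [hq, weightLog, mul_right_comm, mul_comm Ai, h.inv, one_mul]
  have key := re_inner_third_order_le (B := 30 * W * r ^ 8)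
    (df.congr_deriv (g' := (2 / 3 : ℂ) • (ρ * b 0)) (by
      rw [mul_assoc, hAq, hb, secondCoeff]
      ext x
      simp only [ContinuousMap.add_apply, ContinuousMap.mul_apply,
        ContinuousMap.smul_apply, smul_eq_mul, zero_add, add_zero]
      push_cast
      ring)) dg dg₁ dh
    (by rw [star_mul', hρ.real, h.realA]) (by rw [star_mul', hρ.real, h.star_secondCoeff])
    (by rw [star_mul', hρ.real, h.star_firstCoeff]) hY (by
      have bq : IsBd q (3 * r ^ 3) := h.bd_weightLog hm
      have bq' : IsBd q' (6 * r ^ 5) := h.bd_weightLog' hm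
      have b0 : IsBd (b 0) (2 * r ^ 2) := h.bd_secondCoeff hm (by norm_num)
      have b1 : IsBd (b 1) (2 * r ^ 2) := h.bd_secondCoeff hm (by norm_num)
      have b2 : IsBd (b 2) (2 * r ^ 2) := h.bd_secondCoeff hm (by norm_num)
      have c0 : IsBd (c 0) (4 * r ^ 3) := h.bd_firstCoeff hm (by norm_num)
      have c1 : IsBd (c 1) (4 * r ^ 3) := h.bd_firstCoeff hm (by norm_num)
      have bρ := hρ.bd
      have hW := bρ.nonneg
      have h13 : ‖(1 / 3 : ℂ)‖ ≤ 1 := by norm_num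
      refine (IsBd.sub (IsBd.smul (IsBd.add (IsBd.add (((bρ.mul bq).mul bq).add (bρ.mul bq') |>.mul b0)
        ((bρ.mul bq).mul b1)) (IsBd.add ((bρ.mul bq).mul b1) (bρ.mul b2))) h13)
        (IsBd.add ((bρ.mul bq).mul c0) (bρ.mul c1))).mono ?_
      -- As r ≥ 4, every lower power is absorbed into r⁸; the total stays below 60 r⁸, twice the
      -- constant 30 of the claim.
      have p2 : r ^ 2 ≤ r ^ 8 / 256 := by
        have : (4 : ℝ) ^ 6 ≤ r ^ 6 := by gcongr
        have : 0 ≤ r ^ 2 := by positivity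
        nlinarith
      have p3 : r ^ 3 ≤ r ^ 8 / 256 := by
        have : (4 : ℝ) ^ 5 ≤ r ^ 5 := by gcongr
        have : 0 ≤ r ^ 3 := by positivity
        nlinarith
      have p5 : r ^ 5 ≤ r ^ 8 / 64 := by
        have : (4 : ℝ) ^ 3 ≤ r ^ 3 := by gcongr
        have : 0 ≤ r ^ 5 := by positivity
        nlinarith
      have p6 : r ^ 6 ≤ r ^ 8 / 16 := by
        have : (4 : ℝ) ^ 2 ≤ r ^ 2 := by gcongr
        have : 0 ≤ r ^ 6 := by positivity
        nlinarith
      have p7 : r ^ 7 ≤ r ^ 8 / 4 := by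
        have : 0 ≤ r ^ 7 := by positivity
        nlinarith
      have e : 1 * ((W * (3 * r ^ 3) * (3 * r ^ 3) + W * (6 * r ^ 5)) * (2 * r ^ 2)
          + W * (3 * r ^ 3) * (2 * r ^ 2)
          + (W * (3 * r ^ 3) * (2 * r ^ 2) + W * (2 * r ^ 2)))
          + (W * (3 * r ^ 3) * (4 * r ^ 3) + W * (4 * r ^ 3))
          = W * (18 * r ^ 8 + 12 * r ^ 7 + 12 * r ^ 5 + 2 * r ^ 2 + 12 * r ^ 6 + 4 * r ^ 3) := by
        ring
      rw [e]
      calc _ ≤ W * (60 * r ^ 8) := by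
            gcongr
            have : 0 ≤ r ^ 8 := by positivity
            linarith
        _ = _ := by ring)
  rw [inner_mulOp, hρ.real, mulOp_toL2]
  refine le_of_eq_of_le ?_ key
  congr 4
  ring

end CoeffAt

end EnergyEstimate

/-! ### Conjugation of the equation by (1 + ∂ₓ)ⁿ and its bounded approximations -/

section GalerkinOperators

open AddCircle ENNReal

variable {M : ℝ} [hM : Fact (0 < M)]

/-- The operator `∂ₓ^j (1 + ∂ₓ)⁻ⁿ`, for `j ≤ n`. -/
def derivOp (M : ℝ) [Fact (0 < M)] (n j : ℕ) : CircleL2 M →L[ℂ] CircleL2 M :=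
  (1 - smoothOp M) ^ j * smoothOp M ^ (n - j)

theorem fc_one_sub_smoothOp_pow (j : ℕ) (w : CircleL2 M) (k : ℤ) :
    fc (((1 - smoothOp M) ^ j) w) k = (1 - (symb M k)⁻¹) ^ j * fc w k := by
  induction j with
  | zero => simp
  | succ j ih =>
    rw [pow_succ', mul_apply_eq_comp, _root_.sub_apply, one_apply_eq_self, fc_sub, fc_smoothOp, ih]
    ring

theorem fc_derivOp {n j : ℕ} (hj : j ≤ n) (w : CircleL2 M) (k : ℤ) :
    fc (derivOp M n j w) k = (symb M k - 1) ^ j * (symb M k)⁻¹ ^ n * fc w k := by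
  have h := symb_ne_zero (M := M) k
  have e : 1 - (symb M k)⁻¹ = (symb M k - 1) * (symb M k)⁻¹ := by field_simp
  obtain ⟨i, rfl⟩ := Nat.exists_eq_add_of_le hj
  rw [derivOp, mul_apply_eq_comp, fc_one_sub_smoothOp_pow, fc_smoothOp_pow, e, mul_pow,
    Nat.add_sub_cancel_left, pow_add]
  ring

theorem conjOp_derivOp {n j : ℕ} (hj : j ≤ n) (w : CircleL2 M) :
    conjOp (derivOp M n j w) = derivOp M n j (conjOp w) := by
  refine fc_ext fun k => ?_
  simp only [fc_conjOp, fc_derivOp hj, symb_neg, map_mul, map_pow, map_sub, map_inv₀, map_one,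
    Complex.conj_conj]

theorem fc_chain {J : ℕ} {Y : ℕ → C(AddCircle M, ℂ)} (hY : IsChain J Y) {j : ℕ} (hj : j ≤ J)
    (k : ℤ) : fc (toL2 (Y j)) k = (symb M k - 1) ^ j * fc (toL2 (Y 0)) k := by
  induction j with
  | zero => simp
  | succ j ih => rw [(hY j (by omega)).fc, ih (by omega)]; ring

theorem derivOp_chain {n J : ℕ} {Y : ℕ → C(AddCircle M, ℂ)} (hY : IsChain J Y) {j : ℕ}
    (hj : j ≤ J) (hn : j ≤ n) :
    derivOp M n j (toL2 (Y 0)) = (smoothOp M ^ n) (toL2 (Y j)) := by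
  refine fc_ext fun k => ?_
  rw [fc_derivOp hn, fc_smoothOp_pow, fc_chain hY hj]; ring

/-- The operator `(a ∂ₓ³ + b ∂ₓ² + c ∂ₓ + d)(1 + ∂ₓ)⁻ⁿ`. -/
def genOp (n : ℕ) (a b c d : C(AddCircle M, ℂ)) : CircleL2 M →L[ℂ] CircleL2 M :=
  mulOp a * derivOp M n 3 + mulOp b * derivOp M n 2 + mulOp c * derivOp M n 1
    + mulOp d * derivOp M n 0

theorem conjOp_genOp {n : ℕ} (hn : 4 ≤ n) {a b c d : C(AddCircle M, ℂ)} (ha : star a = a)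
    (hb : star b = b) (hc : star c = c) (hd : star d = d) (w : CircleL2 M) :
    conjOp (genOp n a b c d w) = genOp n a b c d (conjOp w) := by
  have h3 : 3 ≤ n := by omega
  have h2 : 2 ≤ n := by omega
  have h1 : 1 ≤ n := by omega
  simp only [genOp, _root_.add_apply, mul_apply_eq_comp, map_add, conjOp_mulOp ha,
    conjOp_mulOp hb, conjOp_mulOp hc, conjOp_mulOp hd, conjOp_derivOp h3, conjOp_derivOp h2,
    conjOp_derivOp h1, conjOp_derivOp (Nat.zero_le n)]

section Remainder

omit hM in
-- Linear bookkeeping for `exists_remainder`, isolated in an abstract module. Here p and q stand for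
-- n and C(n,2), the z's are products of coefficients with smoothed derivatives, and the y's are the
-- order-zero parts that end up in the remainder.
theorem third_order_collect {V : Type*} [AddCommGroup V] [Module ℂ V] {p q : ℂ}
    {lA lB lC l l1 l2 z3 z4 z5 x1 x2 x3 x4 x5 x6 x7 x8 x9 x10 x11 y1 y2 y3 : V}
    (eA : lA = x5 + p • z3 + q • z4 + x1) (eB : lB = x9 + p • z5 + x2) (eC : lC = x11 + x3)
    (e0 : l = x5 + l1 + l2) (e1 : l1 = p • x6 + x9)
    (e2 : l2 = x11 + p • x10 - p • x7 + q • x8) (e3 : z3 = x6 - x7 + y1) (e4 : z4 = x8 + y2)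
    (e5 : z5 = x10 - y3) :
    lA + lB + lC + x4 = l + (p • y1 + q • y2 + x1 - p • y3 + x2 + x3 + x4) := by
  subst e1 e2 e3 e4 e5
  subst e0 eA eB eC
  module

theorem smoothOp_chain_one (hY : IsChain 3 Y) :
    smoothOp M (toL2 (Y 1)) = toL2 (Y 0) - smoothOp M (toL2 (Y 0)) :=
  (hY 0 (by norm_num)).smoothOp_deriv

theorem smoothOp_chain_two (hY : IsChain 3 Y) :
    smoothOp M (toL2 (Y 2)) = toL2 (Y 1) - toL2 (Y 0) + smoothOp M (toL2 (Y 0)) := by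
  rw [(hY 1 (by norm_num)).smoothOp_deriv, smoothOp_chain_one hY]; abel

theorem smoothOp_chain_three (hY : IsChain 3 Y) :
    smoothOp M (toL2 (Y 3)) = toL2 (Y 2) - toL2 (Y 1) + toL2 (Y 0) - smoothOp M (toL2 (Y 0)) := by
  rw [(hY 2 (by norm_num)).smoothOp_deriv, smoothOp_chain_two hY]; abel

/-- Repeated use of S∂ₓ = 1 - S, where S = (1 + ∂ₓ)⁻¹: the vectors Sʲ∂ₓʲy = (1 - S)ʲy for j = 1, 2,
3 have order zero, and S²∂ₓ³ = ∂ₓ + (3S - 2 - S²). The order-zero vectors are kept anonymous, since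
only their norms matter afterwards. -/
theorem exists_smoothOp_chain (hY : IsChain 3 Y) : ∃ u1 u2 u3 u4 : CircleL2 M,
    ‖u1‖ ≤ 2 * ‖toL2 (Y 0)‖ ∧ ‖u2‖ ≤ 4 * ‖toL2 (Y 0)‖ ∧ ‖u3‖ ≤ 8 * ‖toL2 (Y 0)‖ ∧
    ‖u4‖ ≤ 6 * ‖toL2 (Y 0)‖ ∧ smoothOp M (toL2 (Y 1)) = u1 ∧
    smoothOp M (toL2 (Y 2)) = toL2 (Y 1) - u1 ∧ smoothOp M (toL2 (Y 1) - u1) = u2 ∧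
    smoothOp M (toL2 (Y 3)) = toL2 (Y 2) - toL2 (Y 1) + u1 ∧
    smoothOp M (toL2 (Y 2) - toL2 (Y 1) + u1) = toL2 (Y 1) + u4 ∧
    smoothOp M (toL2 (Y 1) + u4) = u3 := by
  have s1 := smoothOp_chain_one hY
  have s2 := smoothOp_chain_two hY
  have s3 := smoothOp_chain_three hY
  generalize toL2 (Y 0) = y at *
  generalize toL2 (Y 1) = y1 at *
  generalize toL2 (Y 2) = y2 at *
  generalize toL2 (Y 3) = y3 at *
  have hSn : ∀ w : CircleL2 M, ‖smoothOp M w‖ ≤ ‖w‖ := fun w => by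
    simpa using ContinuousLinearMap.le_of_opNorm_le _ (norm_smoothOp_le (M := M)) w
  generalize smoothOp M = S at *
  have hS1 := hSn y
  have hS2 := (hSn (S y)).trans hS1
  have hS3 := (hSn (S (S y))).trans hS2
  refine ⟨y - S y, S (S y) - (2 : ℂ) • S y + y, y - (3 : ℂ) • S y + (3 : ℂ) • S (S y) - S (S (S y)),
    (3 : ℂ) • S y - (2 : ℂ) • y - S (S y), ?_, ?_, ?_, ?_, s1, ?_, ?_, ?_, ?_, ?_⟩
  · exact (norm_sub_le _ _).trans (by linarith)
  · refine (norm_add_le _ _).trans ?_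
    have := norm_sub_le (S (S y)) ((2 : ℂ) • S y)
    rw [norm_smul] at this
    norm_num at this
    linarith
  · refine (norm_sub_le _ _).trans ?_
    have t1 := norm_add_le (y - (3 : ℂ) • S y) ((3 : ℂ) • S (S y))
    have t2 := norm_sub_le y ((3 : ℂ) • S y)
    rw [norm_smul] at t1 t2
    norm_num at t1 t2
    linarith
  · refine (norm_sub_le _ _).trans ?_
    have t1 := norm_sub_le ((3 : ℂ) • S y) ((2 : ℂ) • y)
    rw [norm_smul, norm_smul] at t1
    norm_num at t1
    linarith
  · rw [s2]; module
  · simp only [map_sub, s1]; module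
  · rw [s3]; module
  · simp only [map_sub, map_add, s1, s2]; module
  · simp only [map_sub, map_add, map_smul, s1]; module

theorem leibnizTail_of_one {n : ℕ} (hn : 1 ≤ n) {A : ℕ → C(AddCircle M, ℂ)} {v0 v1 : CircleL2 M}
    (h1 : smoothOp M v0 = v1) :
    leibnizTail n A 0 v0 = mulOp (A 0) v0 + leibnizTail n A 1 v1 := by
  rw [leibnizTail_zero_eq hn]
  simp only [Finset.sum_range_succ, Finset.sum_range_zero, zero_add, _root_.add_apply,
    mul_apply_eq_comp, pow_succ, pow_zero, one_apply_eq_self,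
    Nat.choose_zero_right, Nat.cast_one, one_smul, h1]

theorem leibnizTail_of_two {n : ℕ} (hn : 2 ≤ n) {A : ℕ → C(AddCircle M, ℂ)}
    {v0 v1 v2 : CircleL2 M} (h1 : smoothOp M v0 = v1) (h2 : smoothOp M v1 = v2) :
    leibnizTail n A 0 v0 = mulOp (A 0) v0 + (n : ℂ) • mulOp (A 1) v1 + leibnizTail n A 2 v2 := by
  rw [leibnizTail_zero_eq hn]
  simp only [Finset.sum_range_succ, Finset.sum_range_zero, zero_add, _root_.add_apply,
    _root_.smul_apply, mul_apply_eq_comp, pow_succ, pow_zero, one_apply_eq_self,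
    Nat.choose_zero_right, Nat.choose_one_right, Nat.cast_one, one_smul, h1, h2]

theorem leibnizTail_of_three {n : ℕ} (hn : 3 ≤ n) {A : ℕ → C(AddCircle M, ℂ)}
    {v0 v1 v2 v3 : CircleL2 M} (h1 : smoothOp M v0 = v1) (h2 : smoothOp M v1 = v2)
    (h3 : smoothOp M v2 = v3) :
    leibnizTail n A 0 v0 = mulOp (A 0) v0 + (n : ℂ) • mulOp (A 1) v1
      + (n.choose 2 : ℂ) • mulOp (A 2) v2 + leibnizTail n A 3 v3 := by
  rw [leibnizTail_zero_eq hn]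
  simp only [Finset.sum_range_succ, Finset.sum_range_zero, zero_add, _root_.add_apply,
    _root_.smul_apply, mul_apply_eq_comp, pow_succ, pow_zero, one_apply_eq_self,
    Nat.choose_zero_right, Nat.choose_one_right, Nat.cast_one, one_smul, h1, h2, h3]

end Remainder

namespace CoeffAt

variable {n : ℕ} {r W : ℝ} {A B C D : ℕ → C(AddCircle M, ℂ)} {Ai ρ θ : C(AddCircle M, ℂ)}

/-- Derivatives commute with (1 + ∂ₓ)⁻ⁿ, and the Leibniz rule moves (1 + ∂ₓ)⁻ⁿ to the left of each
coefficient, where `derivProjOp` can cancel it. -/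
theorem genOp_chain (h : CoeffAt M n r A B C D Ai) {Y : ℕ → C(AddCircle M, ℂ)}
    (hY : IsChain 3 Y) : genOp n (A 0) (B 0) (C 0) (D 0) (toL2 (Y 0))
      = (smoothOp M ^ n) (leibnizTail n A 0 (toL2 (Y 3)) + leibnizTail n B 0 (toL2 (Y 2))
        + leibnizTail n C 0 (toL2 (Y 1)) + leibnizTail n D 0 (toL2 (Y 0))) := by
  have hn := h.four_le
  have e : ∀ {F : ℕ → C(AddCircle M, ℂ)} (_ : IsChain n F) (w : CircleL2 M),
      mulOp (F 0) ((smoothOp M ^ n) w) = (smoothOp M ^ n) (leibnizTail n F 0 w) := fun hF w =>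
    DFunLike.congr_fun (mulOp_smoothOp_pow hF) w
  simp only [genOp, _root_.add_apply, mul_apply_eq_comp, map_add]
  rw [derivOp_chain hY le_rfl (by omega), derivOp_chain hY (by norm_num : 2 ≤ 3) (by omega),
    derivOp_chain hY (by norm_num : 1 ≤ 3) (by omega),
    derivOp_chain hY (by norm_num : 0 ≤ 3) (by omega),
    e (fun j hj => h.chainA j (by omega)), e (fun j hj => h.chainB j (by omega)), e h.chainC,
    e h.chainD]

/-- In each Leibniz expansion the j-th term carries j smoothing factors, so only the first three,
two and one terms of the A, B and C expansions contain derivatives of Y 0. These produce the shifted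
second- and first-order coefficients; everything else is bounded in L². -/
theorem exists_remainder (h : CoeffAt M n r A B C D Ai) {Y : ℕ → C(AddCircle M, ℂ)}
    (hY : IsChain 3 Y) : ∃ R : CircleL2 M, ‖R‖ ≤ 30 * 2 ^ n * r * ‖toL2 (Y 0)‖ ∧
      leibnizTail n A 0 (toL2 (Y 3)) + leibnizTail n B 0 (toL2 (Y 2))
        + leibnizTail n C 0 (toL2 (Y 1)) + leibnizTail n D 0 (toL2 (Y 0))
      = toL2 (A 0 * Y 3 + secondCoeff n A B 0 * Y 2 + firstCoeff n A B C 0 * Y 1) + R := by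
  have hn := h.four_le
  have hr := h.one_le
  obtain ⟨u1, u2, u3, u4, n1, n2, n3, n4, p1, p2, p3, p4, p5, p6⟩ := exists_smoothOp_chain hY
  have eA := leibnizTail_of_three (A := A) (show 3 ≤ n by omega) p4 p5 p6
  have eB := leibnizTail_of_two (A := B) (show 2 ≤ n by omega) p2 p3
  have eC := leibnizTail_of_one (A := C) (show 1 ≤ n by omega) p1
  refine ⟨(n : ℂ) • mulOp (A 1) u1 + (n.choose 2 : ℂ) • mulOp (A 2) u4 + leibnizTail n A 3 u3
    - (n : ℂ) • mulOp (B 1) u1 + leibnizTail n B 2 u2 + leibnizTail n C 1 u1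
    + leibnizTail n D 0 (toL2 (Y 0)), ?_, ?_⟩
  · have hn2 : (n : ℝ) ≤ 2 ^ n := by exact_mod_cast Nat.lt_two_pow_self.le
    have hc2 : (n.choose 2 : ℝ) ≤ 2 ^ n := by exact_mod_cast Nat.choose_le_two_pow n 2
    generalize toL2 (Y 0) = y at *
    have hy0 := norm_nonneg y
    have bd : ∀ {F : C(AddCircle M, ℂ)} {u : CircleL2 M} {c : ℕ} {K : ℝ}, IsBd F r →
        (c : ℝ) ≤ 2 ^ n → ‖u‖ ≤ K * ‖y‖ → ‖(c : ℂ) • mulOp F u‖ ≤ 2 ^ n * r * (K * ‖y‖) := by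
      intro F u c K hF hc hu
      rw [norm_smul, Complex.norm_natCast, mul_assoc]
      have := norm_mulOp_apply_le hF u
      gcongr
      exact this.trans (by gcongr)
    have bt : ∀ {F : ℕ → C(AddCircle M, ℂ)} {u : CircleL2 M} {i : ℕ} {K : ℝ},
        (∀ j ≤ n, IsBd (F j) r) → ‖u‖ ≤ K * ‖y‖ →
        ‖leibnizTail n F i u‖ ≤ 2 ^ n * r * (K * ‖y‖) := fun hF hu =>
      (norm_leibnizTail_apply_le hF _ _).trans (by gcongr)
    have a1 := bd (h.bdA 1 (by omega)) hn2 n1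
    have a2 := bd (h.bdA 2 (by omega)) hc2 n4
    have a3 := bt (F := A) (i := 3) (fun j hj => h.bdA j (by omega)) n3
    have a4 := bd (h.bdB 1 (by omega)) hn2 n1
    have a5 := bt (i := 2) h.bdB n2
    have a6 := bt (i := 1) h.bdC n1
    have a7 := bt (i := 0) h.bdD (K := 1) (u := y) (by linarith)
    refine (norm_add_le _ _).trans ((add_le_add ((norm_add_le _ _).trans (add_le_add
      ((norm_add_le _ _).trans (add_le_add ((norm_sub_le _ _).trans (add_le_add
      ((norm_add_le _ _).trans (add_le_add ((norm_add_le _ _).trans (add_le_add a1 a2)) a3)) a4))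
      a5)) a6)) a7).trans ?_)
    -- The seven contributions add up to 2 + 6 + 8 + 2 + 4 + 2 + 1 = 25 ≤ 30.
    have : 0 ≤ 2 ^ n * r * ‖y‖ := by positivity
    nlinarith
  · have e1 : toL2 (secondCoeff n A B 0 * Y 2)
        = (n : ℂ) • mulOp (A 1) (toL2 (Y 2)) + mulOp (B 0) (toL2 (Y 2)) := by
      rw [secondCoeff, add_mul, smul_mul_assoc, map_add, map_smul, mulOp_toL2, mulOp_toL2]
    have e2 : toL2 (firstCoeff n A B C 0 * Y 1) = mulOp (C 0) (toL2 (Y 1))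
        + (n : ℂ) • mulOp (B 1) (toL2 (Y 1)) - (n : ℂ) • mulOp (A 1) (toL2 (Y 1))
        + (n.choose 2 : ℂ) • mulOp (A 2) (toL2 (Y 1)) := by
      rw [firstCoeff, add_mul, sub_mul, add_mul, smul_mul_assoc, smul_mul_assoc, smul_mul_assoc,
        map_add, map_sub, map_add, map_smul, map_smul, map_smul, mulOp_toL2, mulOp_toL2,
        mulOp_toL2, mulOp_toL2]
    have e3 : mulOp (A 1) (toL2 (Y 2) - toL2 (Y 1) + u1) = mulOp (A 1) (toL2 (Y 2))
        - mulOp (A 1) (toL2 (Y 1)) + mulOp (A 1) u1 := by rw [map_add, map_sub]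
    have e4 : mulOp (A 2) (toL2 (Y 1) + u4) = mulOp (A 2) (toL2 (Y 1)) + mulOp (A 2) u4 :=
      map_add _ _ _
    have e5 : mulOp (B 1) (toL2 (Y 1) - u1) = mulOp (B 1) (toL2 (Y 1)) - mulOp (B 1) u1 :=
      map_sub _ _ _
    have e0 : toL2 (A 0 * Y 3 + secondCoeff n A B 0 * Y 2 + firstCoeff n A B C 0 * Y 1)
        = mulOp (A 0) (toL2 (Y 3)) + toL2 (secondCoeff n A B 0 * Y 2)
          + toL2 (firstCoeff n A B C 0 * Y 1) := by
      rw [map_add, map_add, mulOp_toL2]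
    exact third_order_collect eA eB eC e0 e1 e2 e3 e4 e5

/-- The bounded approximation of `(1 + ∂ₓ)ⁿ (a ∂ₓ³ + b ∂ₓ² + c ∂ₓ + d) (1 + ∂ₓ)⁻ⁿ`. -/
def _root_.PeriodicDispersion.approxOp (n N : ℕ) (a b c d ρ θ : C(AddCircle M, ℂ)) :
    CircleL2 M →L[ℂ] CircleL2 M :=
  derivProjOp M n N * genOp n a b c d * mulOp θ * projOp M N * mulOp ρ

/-- A trigonometric polynomial with its derivatives. -/
def _root_.PeriodicDispersion.trigPoly (w : CircleL2 M) (N : ℕ) (j : ℕ) : C(AddCircle M, ℂ) :=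
  ∑ k ∈ Finset.Icc (-(N : ℤ)) N, ((waveNumber M k * Complex.I : ℂ) ^ j * fc w k) • fourier k

theorem _root_.PeriodicDispersion.isDeriv_trigPoly (w : CircleL2 M) (N j : ℕ) :
    IsDeriv (trigPoly w N j) (trigPoly w N (j + 1)) := by
  refine (IsDeriv.sum fun k _ => (isDeriv_fourier k).const_smul _).congr_deriv ?_
  refine Finset.sum_congr rfl fun k _ => ?_
  rw [smul_smul]; congr 1; ring

theorem _root_.PeriodicDispersion.toL2_trigPoly (w : CircleL2 M) (N : ℕ) :
    toL2 (trigPoly w N 0) = projOp M N w := by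
  refine fc_ext fun k => ?_
  simp only [trigPoly, map_sum, map_smul, toL2_fourier, pow_zero, one_mul]
  rw [fc_projOp, fc_eq_inner, inner_sum]
  simp only [inner_smul_right, orthonormal_iff_ite.1 fourierBasis.orthonormal,
      mul_ite, mul_one, mul_zero, Finset.sum_ite_eq]
  congr 1
  rw [Finset.mem_Icc, eq_iff_iff]
  omega

omit hM in
/-- The product of a trigonometric polynomial and the inverse weight, with its derivatives. -/
theorem exists_chain (h : CoeffAt M n r A B C D Ai) {m : ℕ} (hρ : WeightAt m W A B Ai ρ θ)
    {p : ℕ → C(AddCircle M, ℂ)} (hp : ∀ j, IsDeriv (p j) (p (j + 1))) :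
    ∃ Y : ℕ → C(AddCircle M, ℂ), Y 0 = θ * p 0 ∧ IsChain 3 Y := by
  set q := weightLog m A B Ai
  have dq : IsDeriv q (weightLog' m A B Ai) := h.isDeriv_weightLog
  obtain ⟨q'', dq'⟩ := h.exists_isDeriv_weightLog' (m := m)
  have dθ : IsDeriv θ (-(θ * q)) := by
    refine (hρ.deriv.inv hρ.inv).congr_deriv ?_
    calc -(θ * θ * (ρ * q)) = -((ρ * θ) * (θ * q)) := by ring
      _ = _ := by rw [hρ.inv, one_mul]
  have d1 := dθ.mul (hp 0)
  have d2 := ((dθ.mul dq).neg.mul (hp 0)).add (dθ.mul (hp 1))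
  obtain ⟨Y2, hY2⟩ : ∃ Y2, IsDeriv (-(θ * q) * p 0 + θ * p 1) Y2 :=
    ⟨_, ((dθ.mul dq).neg.mul (hp 0)).add (dθ.mul (hp 1))⟩
  obtain ⟨Y3, hY3⟩ : ∃ Y3, IsDeriv (-(-(θ * q) * q + θ * weightLog' m A B Ai) * p 0
      + -(θ * q) * p 1 + (-(θ * q) * p 1 + θ * p 2)) Y3 :=
    ⟨_, ((((((dθ.mul dq).neg.mul dq).add (dθ.mul dq')).neg.mul (hp 0)).add
      ((dθ.mul dq).neg.mul (hp 1)))).add (((dθ.mul dq).neg.mul (hp 1)).add (dθ.mul (hp 2)))⟩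
  refine ⟨fun j => match j with
    | 0 => θ * p 0
    | 1 => -(θ * q) * p 0 + θ * p 1
    | 2 => -(-(θ * q) * q + θ * weightLog' m A B Ai) * p 0
      + -(θ * q) * p 1 + (-(θ * q) * p 1 + θ * p 2)
    -- Only the entry with index 3 matters here; a chain of length 3 imposes nothing on later
    -- entries.
    | _ => Y3, rfl, fun j hj => ?_⟩
  interval_cases j
  · exact d1
  · exact d2
  · exact hY3

/-- The truncation θ P_N ρ is self-adjoint for the weighted inner product. With Y = θ P_N ρ w, the
outer projection moves onto ρw and gives P_N ρ w = ρY, so the form becomes that of the untruncated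
operator at the smooth function Y. The estimate is thus uniform in N, with W⁴ coming from ‖Y‖ ≤
W²‖w‖. -/
theorem re_inner_approxOp_le (h : CoeffAt M n r A B C D Ai) (hρ : WeightAt n W A B Ai ρ θ)
    (N : ℕ) (w : CircleL2 M) :
    (inner ℂ (mulOp ρ w) (approxOp n N (A 0) (B 0) (C 0) (D 0) ρ θ w)).re
      ≤ (30 * W * r ^ 8 + 30 * W * 2 ^ n * r) * W ^ 4 * ‖w‖ ^ 2 := by
  set p := trigPoly (mulOp ρ w) N with hp
  have hp0 : toL2 (p 0) = projOp M N (mulOp ρ w) := toL2_trigPoly _ _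
  obtain ⟨Y, hY0, hY⟩ := h.exists_chain hρ (isDeriv_trigPoly (mulOp ρ w) N)
  obtain ⟨R, hR, hR'⟩ := h.exists_remainder hY
  have hW := hρ.bd.nonneg
  have hr : 0 ≤ r := by linarith [h.one_le]
  have e1 : mulOp θ (projOp M N (mulOp ρ w)) = toL2 (Y 0) := by
    rw [← hp0, mulOp_toL2, hY0]
  have e2 : approxOp n N (A 0) (B 0) (C 0) (D 0) ρ θ w = projOp M N
      (toL2 (A 0 * Y 3 + secondCoeff n A B 0 * Y 2 + firstCoeff n A B C 0 * Y 1) + R) := by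
    simp only [approxOp, mul_apply_eq_comp]
    rw [e1, h.genOp_chain hY, derivProjOp_smoothOp_pow, hR']
  have e3 : projOp M N (mulOp ρ w) = mulOp ρ (toL2 (Y 0)) := by
    rw [← e1, mulOp_mulOp, hρ.inv, mulOp_one]
  rw [e2, ← projOp_symm, e3, inner_add_right, Complex.add_re]
  have k1 := h.re_inner_weight_le le_rfl hρ hY
  have k2 : (inner ℂ (mulOp ρ (toL2 (Y 0))) R).re
      ≤ 30 * W * 2 ^ n * r * ‖toL2 (Y 0)‖ ^ 2 := by
    refine (Complex.re_le_norm _).trans ((norm_inner_le_norm _ _).trans ?_)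
    calc _ ≤ (W * ‖toL2 (Y 0)‖) * (30 * 2 ^ n * r * ‖toL2 (Y 0)‖) := by
          have := norm_mulOp_apply_le hρ.bd (toL2 (Y 0))
          gcongr
      _ = _ := by ring
  have k3 : ‖toL2 (Y 0)‖ ≤ W ^ 2 * ‖w‖ := by
    rw [← e1]
    calc _ ≤ W * ‖projOp M N (mulOp ρ w)‖ := norm_mulOp_apply_le hρ.bd' _
      _ ≤ W * ‖mulOp ρ w‖ := by
        gcongr
        simpa using ContinuousLinearMap.le_of_opNorm_le _ (norm_projOp_le (M := M) N) (mulOp ρ w)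
      _ ≤ W * (W * ‖w‖) := by
        gcongr
        exact norm_mulOp_apply_le hρ.bd _
      _ = _ := by ring
  calc _ ≤ (30 * W * r ^ 8 + 30 * W * 2 ^ n * r) * ‖toL2 (Y 0)‖ ^ 2 := by linarith
    _ ≤ (30 * W * r ^ 8 + 30 * W * 2 ^ n * r) * (W ^ 2 * ‖w‖) ^ 2 := by gcongr
    _ = _ := by ring

end CoeffAt

end GalerkinOperators

/-! ### Periodic functions as functions on the circle -/

section Lift

variable {M : ℝ}

open Classical in
/-- The function on the circle given by a continuous periodic function on the line (and zero if
`f` is not of this kind). -/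
def toC (M : ℝ) (f : ℝ → ℝ) : C(AddCircle M, ℂ) :=
  if h : Continuous f ∧ Function.Periodic f M then
    ⟨Function.Periodic.lift (f := fun x => (f x : ℂ)) (c := M) (fun x => by simp only [h.2 x]),
      continuous_coinduced_dom.2 (Complex.continuous_ofReal.comp h.1)⟩
  else 0

theorem toC_apply {f : ℝ → ℝ} (hf : Continuous f) (hp : Function.Periodic f M) (x : ℝ) :
    toC M f (x : AddCircle M) = f x := by
  rw [toC, dif_pos ⟨hf, hp⟩]; rfl

theorem toC_ext {g h : C(AddCircle M, ℂ)} (H : ∀ x : ℝ, g (x : AddCircle M) = h (x : AddCircle M)) :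
    g = h := ContinuousMap.ext fun y => by
  induction y using QuotientAddGroup.induction_on with | _ x => exact H x

theorem star_toC (f : ℝ → ℝ) : star (toC M f) = toC M f := by
  by_cases h : Continuous f ∧ Function.Periodic f M
  · refine toC_ext fun x => ?_
    rw [ContinuousMap.star_apply, toC_apply h.1 h.2, RCLike.star_def, Complex.conj_ofReal]
  · rw [toC, dif_neg h, star_zero]

theorem isBd_toC {f : ℝ → ℝ} {c : ℝ} (hc : ∀ x, |f x| ≤ c) : IsBd (toC M f) c := by
  intro y
  induction y using QuotientAddGroup.induction_on with | _ x => ?_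
  by_cases h : Continuous f ∧ Function.Periodic f M
  · have := toC_apply h.1 h.2 x
    exact (congrArg norm this).trans_le (by simpa using hc x)
  · rw [toC, dif_neg h]; simpa using (abs_nonneg _).trans (hc 0)

theorem isDeriv_toC {f f' : ℝ → ℝ} (hp : Function.Periodic f M) (hc' : Continuous f')
    (hp' : Function.Periodic f' M) (h : ∀ x, HasDerivAt f (f' x) x) :
    IsDeriv (toC M f) (toC M f') := by
  have hc : Continuous f := continuous_iff_continuousAt.2 fun x => (h x).continuousAt
  intro x
  rw [toC_apply hc' hp']
  simpa only [toC_apply hc hp] using (h x).ofReal_comp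

theorem norm_toC_sub_le [Fact (0 < M)] {f g : ℝ → ℝ} (hf : Continuous f) (hg : Continuous g)
    (hpf : Function.Periodic f M) (hpg : Function.Periodic g M) {ε : ℝ} (hε : 0 ≤ ε)
    (h : ∀ x, |f x - g x| ≤ ε) : ‖toC M f - toC M g‖ ≤ ε := by
  refine (ContinuousMap.norm_le _ hε).2 fun y => ?_
  induction y using QuotientAddGroup.induction_on with | _ x => ?_
  have e : (toC M f - toC M g) (x : AddCircle M) = ((f x - g x : ℝ) : ℂ) := by
    rw [ContinuousMap.sub_apply, toC_apply hf hpf, toC_apply hg hpg, Complex.ofReal_sub]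
  exact (congrArg norm e).trans_le ((Complex.norm_real _).trans_le (h x))

theorem periodic_iteratedDeriv {f : ℝ → ℝ} (hp : Function.Periodic f M) (j : ℕ) :
    Function.Periodic (iteratedDeriv j f) M := by
  intro x
  have := congrFun (iteratedDeriv_comp_add_const j f M) x
  rw [← this]
  congr 1
  exact funext hp

end Lift

/-! ### Bounds on the coefficients -/

section Bounds

variable {M T : ℝ} {n k : ℕ}

theorem MemCC.continuous {f : ℝ → ℝ → ℝ} (h : MemCC M T k f) {j : ℕ} (hj : j ≤ k) {t : ℝ}
    (ht : t ∈ Icc 0 T) : Continuous (iteratedDeriv j (f t)) :=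
  (h.contDiff t ht).continuous_iteratedDeriv j (by exact_mod_cast hj)

theorem MemCC.continuous_self {f : ℝ → ℝ → ℝ} (h : MemCC M T k f) {t : ℝ} (ht : t ∈ Icc 0 T) :
    Continuous (f t) := (h.contDiff t ht).continuous

theorem MemCC.hasDerivAt {f : ℝ → ℝ → ℝ} (h : MemCC M T k f) {j : ℕ} (hj : j < k) {t : ℝ}
    (ht : t ∈ Icc 0 T) (x : ℝ) :
    HasDerivAt (iteratedDeriv j (f t)) (iteratedDeriv (j + 1) (f t) x) x := by
  rw [iteratedDeriv_succ]
  exact ((h.contDiff t ht).differentiable_iteratedDeriv j (by exact_mod_cast hj) x).hasDerivAt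

/-- Periodicity bounds each time slice, uniform convergence extends the bound to nearby times, and
compactness of [0,T] makes it global. -/
theorem MemCC.exists_bound {f : ℝ → ℝ → ℝ} (hM : 0 < M) (h : MemCC M T k f) {j : ℕ}
    (hj : j ≤ k) : ∃ B, ∀ t ∈ Icc 0 T, ∀ x, |iteratedDeriv j (f t) x| ≤ B := by
  suffices H : ∃ B, ∀ t ∈ Icc 0 T ∩ Icc 0 T, ∀ x, |iteratedDeriv j (f t) x| ≤ B by
    simpa only [inter_self] using H
  refine isCompact_Icc.induction_on
    (p := fun s => ∃ B, ∀ t ∈ s ∩ Icc 0 T, ∀ x, |iteratedDeriv j (f t) x| ≤ B) ⟨0, by simp⟩ ?_ ?_ ?_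
  · rintro s t hst ⟨B, hB⟩
    exact ⟨B, fun τ hτ => hB τ ⟨hst hτ.1, hτ.2⟩⟩
  · rintro s t ⟨B, hB⟩ ⟨B', hB'⟩
    refine ⟨max B B', fun τ hτ x => ?_⟩
    rcases hτ with ⟨hτ | hτ, hτ'⟩
    · exact (hB τ ⟨hτ, hτ'⟩ x).trans (le_max_left _ _)
    · exact (hB' τ ⟨hτ, hτ'⟩ x).trans (le_max_right _ _)
  · intro t ht
    obtain ⟨B, hB⟩ := (isBounded_iff_forall_norm_le.1
      ((periodic_iteratedDeriv (h.periodic t ht) j).isBounded_of_continuous hM.ne'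
        (h.continuous hj ht)))
    refine ⟨{τ | ∀ x, dist (iteratedDeriv j (f t) x) (iteratedDeriv j (f τ) x) < 1},
      Metric.tendstoUniformly_iff.1 (h.tendsto j hj t ht) 1 one_pos, B + 1, fun τ hτ x => ?_⟩
    have h1 := hτ.1 x
    have h2 := hB _ (mem_range_self x)
    rw [Real.norm_eq_abs] at h2
    rw [Real.dist_eq, abs_lt] at h1
    rw [abs_le] at h2 ⊢
    constructor <;> linarith

theorem normW_nonneg (T : ℝ) (k : ℕ) (f : ℝ → ℝ → ℝ) : 0 ≤ normW T k f :=
  Real.iSup_nonneg fun _ => Finset.sum_nonneg fun _ _ => Real.iSup_nonneg fun _ => abs_nonneg _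

/-- A real supremum of an unbounded family is 0 by convention, so some a priori bounds are needed
before `normW` dominates anything. -/
theorem abs_le_normW {f : ℝ → ℝ → ℝ}
    (h : ∀ j ≤ k, ∃ B, ∀ t ∈ Icc 0 T, ∀ x, |iteratedDeriv j (f t) x| ≤ B) {j : ℕ} (hj : j ≤ k)
    {t : ℝ} (ht : t ∈ Icc 0 T) (x : ℝ) : |iteratedDeriv j (f t) x| ≤ normW T k f := by
  choose! B hB using h
  have hsup : ∀ i ≤ k, ∀ τ ∈ Icc 0 T, ⨆ y : ℝ, |iteratedDeriv i (f τ) y| ≤ B i :=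
    fun i hi τ hτ => ciSup_le fun y => hB i hi τ hτ y
  have hbdd : BddAbove (range fun τ : Icc (0 : ℝ) T =>
      ∑ i ∈ Finset.range (k + 1), ⨆ y : ℝ, |iteratedDeriv i (f τ) y|) := by
    refine ⟨∑ i ∈ Finset.range (k + 1), B i, ?_⟩
    rintro _ ⟨τ, rfl⟩
    exact Finset.sum_le_sum fun i hi => hsup i (Finset.mem_range_succ_iff.1 hi) τ τ.2
  calc |iteratedDeriv j (f t) x| ≤ ⨆ y : ℝ, |iteratedDeriv j (f t) y| :=
        le_ciSup (f := fun y => |iteratedDeriv j (f t) y|)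
          ⟨B j, by rintro _ ⟨y, rfl⟩; exact hB j hj t ht y⟩ x
    _ ≤ ∑ i ∈ Finset.range (k + 1), ⨆ y : ℝ, |iteratedDeriv i (f t) y| :=
        Finset.single_le_sum (f := fun i => ⨆ y : ℝ, |iteratedDeriv i (f t) y|)
          (fun i _ => Real.iSup_nonneg fun _ => abs_nonneg _) (Finset.mem_range_succ_iff.2 hj)
    _ ≤ normW T k f := le_ciSup hbdd ⟨t, ht⟩

theorem MemCC.abs_le {f : ℝ → ℝ → ℝ} (hM : 0 < M) (h : MemCC M T k f) {i j : ℕ} (hi : i ≤ k)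
    (hj : j ≤ i) {t : ℝ} (ht : t ∈ Icc 0 T) (x : ℝ) :
    |iteratedDeriv j (f t) x| ≤ normW T i f :=
  abs_le_normW (fun _ hj => h.exists_bound hM (hj.trans hi)) hj ht x

theorem TimeDerivMemCC.lipschitz {f : ℝ → ℝ → ℝ} (h : TimeDerivMemCC M T k f) {B : ℝ}
    (hB : ∀ t ∈ Icc 0 T, ∀ x, |timeDeriv T f t x| ≤ B) {s t : ℝ} (hs : s ∈ Icc 0 T)
    (ht : t ∈ Icc 0 T) (x : ℝ) : |f t x - f s x| ≤ B * |t - s| :=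
  (convex_Icc 0 T).norm_image_sub_le_of_norm_derivWithin_le (f := fun τ => f τ x)
    (fun τ hτ => h.differentiable τ hτ x) (fun τ hτ => hB τ hτ x) hs ht

/-- The bounds on the coefficients used in the estimates. -/
structure CoeffBounds (M T : ℝ) (n : ℕ) (r : ℝ) (a b c d : ℝ → ℝ → ℝ) : Prop where
  M_pos : 0 < M
  T_pos : 0 < T
  four_le : 4 ≤ n
  le_r : (n : ℝ) ≤ r
  M_le : M ≤ r
  T_le : T ≤ r
  a_mem : MemCC M T (n + 3) a
  b_mem : MemCC M T (n + 2) b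
  c_mem : MemCC M T n c
  d_mem : MemCC M T n d
  a_ne : ∀ t ∈ Icc 0 T, ∀ x, a t x ≠ 0
  a_le : ∀ j ≤ n + 3, ∀ t ∈ Icc 0 T, ∀ x, |iteratedDeriv j (a t) x| ≤ r
  b_le : ∀ j ≤ n, ∀ t ∈ Icc 0 T, ∀ x, |iteratedDeriv j (b t) x| ≤ r
  c_le : ∀ j ≤ n, ∀ t ∈ Icc 0 T, ∀ x, |iteratedDeriv j (c t) x| ≤ r
  d_le : ∀ j ≤ n, ∀ t ∈ Icc 0 T, ∀ x, |iteratedDeriv j (d t) x| ≤ r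
  inv_le : ∀ t ∈ Icc 0 T, ∀ x, |(a t x)⁻¹| ≤ r
  a_lip : ∀ s ∈ Icc 0 T, ∀ t ∈ Icc 0 T, ∀ x, |a t x - a s x| ≤ r * |t - s|
  b_lip : ∀ s ∈ Icc 0 T, ∀ t ∈ Icc 0 T, ∀ x, |b t x - b s x| ≤ r * |t - s|
  avg : ∀ t ∈ Icc 0 T, avgDiffusion M a b t = 0

/-- A single number controls all the data, so that every later constant is a function of it alone.
The time derivatives enter only as Lipschitz constants. -/
theorem Admissible.coeffBounds {a b c d e : ℝ → ℝ → ℝ} (hn : 4 ≤ n) (hM : 0 < M) (hT : 0 < T)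
    (h : Admissible M T n a b c d e) (havg : ∀ t ∈ Icc 0 T, avgDiffusion M a b t = 0) :
    CoeffBounds M T n (dataSize M T n a b c d e) a b c d := by
  have h1 := normW_nonneg T (n + 3) a
  have h2 := normW_nonneg T 1 (timeDeriv T a)
  have h3 := normW_nonneg T 0 (fun t x => (a t x)⁻¹)
  have h4 := normW_nonneg T n b
  have h5 := normW_nonneg T 0 (timeDeriv T b)
  have h6 := normW_nonneg T n c
  have h7 := normW_nonneg T n d
  have h8 : 0 ≤ normLinftyH M T n e := ENNReal.toReal_nonneg
  have h9 : (0 : ℝ) ≤ n := Nat.cast_nonneg n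
  obtain ⟨a₀, ha₀, hlow⟩ := h.nondegenerate
  have hinv : ∀ t ∈ Icc 0 T, ∀ x, |(a t x)⁻¹| ≤ a₀⁻¹ := fun t ht x => by
    rw [abs_inv]; exact inv_anti₀ ha₀ (hlow t ht x)
  refine ⟨hM, hT, hn, ?_, ?_, ?_, h.a_mem, h.b_mem, h.c_mem, h.d_mem, fun t ht x h0 => ?_,
    fun j hj t ht x => (h.a_mem.abs_le hM le_rfl hj ht x).trans ?_,
    fun j hj t ht x => (h.b_mem.abs_le hM (by omega) hj ht x).trans ?_,
    fun j hj t ht x => (h.c_mem.abs_le hM le_rfl hj ht x).trans ?_,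
    fun j hj t ht x => (h.d_mem.abs_le hM le_rfl hj ht x).trans ?_,
    fun t ht x => (abs_le_normW (f := fun t x => (a t x)⁻¹) (k := 0)
      (fun j hj => ⟨a₀⁻¹, by obtain rfl : j = 0 := (by omega); simpa using hinv⟩)
      le_rfl ht x).trans ?_,
    fun s hs t ht x => h.a_time.lipschitz (fun τ hτ y => ?_) hs ht x,
    fun s hs t ht x => h.b_time.lipschitz (fun τ hτ y => ?_) hs ht x, havg⟩
  any_goals (unfold dataSize; linarith)
  · have := hlow t ht x
    rw [h0, abs_zero] at this
    linarith
  · have := h.a_time.memCC.abs_le hM (i := 1) (j := 0) (by omega) (by omega) hτ y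
    rw [iteratedDeriv_zero] at this
    unfold dataSize; linarith
  · have := h.b_time.memCC.abs_le hM (i := 0) (j := 0) (by omega) (by omega) hτ y
    rw [iteratedDeriv_zero] at this
    unfold dataSize; linarith

end Bounds

/-! ### The weight -/

section Weight

variable {M T r : ℝ} {n : ℕ} {a b c d : ℝ → ℝ → ℝ}

/-- The derivatives of the function `f t` on the circle. -/
def jet (M : ℝ) (f : ℝ → ℝ → ℝ) (t : ℝ) (j : ℕ) : C(AddCircle M, ℂ) := toC M (iteratedDeriv j (f t))

/-- The logarithm of the weight at level `m`. -/
def logWeight (m : ℕ) (a b : ℝ → ℝ → ℝ) (t x : ℝ) : ℝ :=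
  (2 * m / 3 - 1) * Real.log (a t x) + 2 / 3 * ∫ y in (0 : ℝ)..x, b t y / a t y

/-- The bound for the weight and its inverse. -/
def weightBound (r : ℝ) : ℝ := Real.exp (2 * r ^ 3)

/-- The Lipschitz constant in time of the weight. -/
def weightLip (r : ℝ) : ℝ := weightBound r * (4 * r ^ 5)

/-- The weight at level `m`. -/
def weight (M : ℝ) (m : ℕ) (a b : ℝ → ℝ → ℝ) (t : ℝ) : C(AddCircle M, ℂ) :=
  toC M fun x => Real.exp (logWeight m a b t x)

/-- The inverse of the weight at level `m`. -/
def weightInv (M : ℝ) (m : ℕ) (a b : ℝ → ℝ → ℝ) (t : ℝ) : C(AddCircle M, ℂ) :=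
  toC M fun x => Real.exp (-logWeight m a b t x)

theorem MemCC.isChain_jet {k : ℕ} {f : ℝ → ℝ → ℝ} (h : MemCC M T k f) {t : ℝ} (ht : t ∈ Icc 0 T) :
    IsChain k (jet M f t) := fun _ hj =>
  isDeriv_toC (periodic_iteratedDeriv (h.periodic t ht) _) (h.continuous hj ht)
    (periodic_iteratedDeriv (h.periodic t ht) _) (h.hasDerivAt hj ht)

theorem MemCC.continuousOn_jet [Fact (0 < M)] {k : ℕ} {f : ℝ → ℝ → ℝ} (h : MemCC M T k f) {j : ℕ} (hj : j ≤ k) :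
    ContinuousOn (fun t => jet M f t j) (Icc 0 T) := by
  intro t ht
  refine Metric.tendsto_nhds.2 fun ε hε => ?_
  filter_upwards [Metric.tendstoUniformly_iff.1 (h.tendsto j hj t ht) (ε / 2) (half_pos hε),
    self_mem_nhdsWithin] with τ hτ hτ'
  rw [dist_eq_norm]
  refine (norm_toC_sub_le (h.continuous hj hτ') (h.continuous hj ht)
    (periodic_iteratedDeriv (h.periodic τ hτ') _) (periodic_iteratedDeriv (h.periodic t ht) _)
    (half_pos hε).le fun x => ?_).trans_lt (half_lt_self hε)
  have := (hτ x).le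
  rwa [dist_comm, Real.dist_eq] at this

namespace CoeffBounds

theorem pos_r (h : CoeffBounds M T n r a b c d) : 4 ≤ r :=
  le_trans (by exact_mod_cast h.four_le) h.le_r

theorem coeffAt (h : CoeffBounds M T n r a b c d) {t : ℝ} (ht : t ∈ Icc 0 T) :
    CoeffAt M n r (jet M a t) (jet M b t) (jet M c t) (jet M d t) (toC M fun x => (a t x)⁻¹) where
  chainA := h.a_mem.isChain_jet ht
  chainB := h.b_mem.isChain_jet ht
  chainC := h.c_mem.isChain_jet ht
  chainD := h.d_mem.isChain_jet ht
  realA _ := star_toC _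
  realB _ := star_toC _
  realC _ := star_toC _
  bdA j hj := isBd_toC (h.a_le j hj t ht)
  bdB j hj := isBd_toC (h.b_le j hj t ht)
  bdC j hj := isBd_toC (h.c_le j hj t ht)
  bdD j hj := isBd_toC (h.d_le j hj t ht)
  inv := by
    have hp := h.a_mem.periodic t ht
    have hc := h.a_mem.continuous_self ht
    refine toC_ext fun x => ?_
    rw [ContinuousMap.mul_apply, jet, iteratedDeriv_zero, toC_apply hc hp,
      toC_apply (f := fun x => (a t x)⁻¹) (hc.inv₀ (h.a_ne t ht)) (fun y => by simp only [hp y]), ContinuousMap.one_apply,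
      ← Complex.ofReal_mul, mul_inv_cancel₀ (h.a_ne t ht x), Complex.ofReal_one]
  bdInv := isBd_toC (h.inv_le t ht)
  four_le := h.four_le
  le_r := h.le_r

theorem abs_a_le (h : CoeffBounds M T n r a b c d) {t : ℝ} (ht : t ∈ Icc 0 T) (x : ℝ) :
    |a t x| ≤ r := by simpa using h.a_le 0 (by omega) t ht x

theorem abs_b_le (h : CoeffBounds M T n r a b c d) {t : ℝ} (ht : t ∈ Icc 0 T) (x : ℝ) :
    |b t x| ≤ r := by simpa using h.b_le 0 (by omega) t ht x

theorem continuous_quotient (h : CoeffBounds M T n r a b c d) {t : ℝ} (ht : t ∈ Icc 0 T) :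
    Continuous fun y => b t y / a t y :=
  (h.b_mem.continuous_self ht).div (h.a_mem.continuous_self ht) (h.a_ne t ht)

/-- A continuous function without zeros has constant sign, so b/a and b/|a| agree up to one global
sign. -/
theorem integral_quotient (h : CoeffBounds M T n r a b c d) {t : ℝ} (ht : t ∈ Icc 0 T) :
    ∫ y in (0 : ℝ)..M, b t y / a t y = 0 := by
  have h0 : ∫ y in (0 : ℝ)..M, b t y / |a t y| = 0 := by
    have := h.avg t ht
    rw [avgDiffusion, mul_eq_zero] at this
    exact this.resolve_left (one_div_ne_zero h.M_pos.ne')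
  have hc := h.a_mem.continuous_self ht
  have hs : (∀ y, 0 < a t y) ∨ ∀ y, a t y < 0 := by
    by_contra! hcon
    obtain ⟨⟨y, hy⟩, z, hz⟩ := hcon
    obtain ⟨w, hw⟩ := mem_range_of_exists_le_of_exists_ge hc ⟨y, hy⟩ ⟨z, hz⟩
    exact h.a_ne t ht w hw
  rcases hs with hs | hs
  · simpa only [abs_of_pos (hs _)] using h0
  · simp only [abs_of_neg (hs _), div_neg, intervalIntegral.integral_neg, neg_eq_zero] at h0
    exact h0

/-- Here the vanishing of the average modified diffusion is decisive: over one period the primitive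
of b/a grows by exactly its integral, which is zero. -/
theorem periodic_logWeight (h : CoeffBounds M T n r a b c d) (m : ℕ) {t : ℝ} (ht : t ∈ Icc 0 T) :
    Function.Periodic (logWeight m a b t) M := by
  intro x
  have hp : Function.Periodic (fun y => b t y / a t y) M := fun y => by
    simp only [h.b_mem.periodic t ht y, h.a_mem.periodic t ht y]
  have hi := h.continuous_quotient ht
  rw [logWeight, logWeight, h.a_mem.periodic t ht x,
    ← intervalIntegral.integral_add_adjacent_intervals (hi.intervalIntegrable 0 x)
      (hi.intervalIntegrable x (x + M)), hp.intervalIntegral_add_eq x 0, zero_add,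
    h.integral_quotient ht, add_zero]

theorem hasDerivAt_logWeight (h : CoeffBounds M T n r a b c d) (m : ℕ) {t : ℝ}
    (ht : t ∈ Icc 0 T) (x : ℝ) : HasDerivAt (logWeight m a b t)
      ((2 * m / 3 - 1) * (deriv (a t) x / a t x) + 2 / 3 * (b t x / a t x)) x := by
  have h1 : HasDerivAt (a t) (deriv (a t) x) x := by
    simpa using h.a_mem.hasDerivAt (j := 0) (by omega) ht x
  exact ((h1.log (h.a_ne t ht x)).const_mul _).add
    (((h.continuous_quotient ht).integral_hasStrictDerivAt 0 x).hasDerivAt.const_mul _)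

theorem continuous_logWeight (h : CoeffBounds M T n r a b c d) (m : ℕ) {t : ℝ}
    (ht : t ∈ Icc 0 T) : Continuous (logWeight m a b t) :=
  continuous_iff_continuousAt.2 fun x => (h.hasDerivAt_logWeight m ht x).continuousAt

theorem abs_exponent_le (h : CoeffBounds M T n r a b c d) {m : ℕ} (hm : m ≤ n) :
    |(2 * m / 3 - 1 : ℝ)| ≤ r := by
  have h1 := h.pos_r
  have h2 : (m : ℝ) ≤ r := le_trans (by exact_mod_cast hm) h.le_r
  have h3 : (0 : ℝ) ≤ m := by positivity
  rw [abs_le]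
  constructor <;> linarith

theorem abs_quotient_le (h : CoeffBounds M T n r a b c d) {t : ℝ} (ht : t ∈ Icc 0 T) (x : ℝ) :
    |b t x / a t x| ≤ r ^ 2 := by
  have := h.pos_r
  rw [div_eq_mul_inv, abs_mul, pow_two]
  exact mul_le_mul (h.abs_b_le ht x) (h.inv_le t ht x) (abs_nonneg _) (by linarith)

theorem abs_logWeight_le (h : CoeffBounds M T n r a b c d) {m : ℕ} (hm : m ≤ n) {t : ℝ}
    (ht : t ∈ Icc 0 T) (x : ℝ) : |logWeight m a b t x| ≤ 2 * r ^ 3 := by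
  have hr := h.pos_r
  obtain ⟨y, hy, e⟩ := (h.periodic_logWeight m ht).exists_mem_Ico₀ h.M_pos x
  rw [e, logWeight]
  have ha := abs_pos.2 (h.a_ne t ht y)
  -- `Real.log` ignores the sign of its argument, so the logarithm is that of |a|. Both bounds come
  -- from log z ≤ z - 1, applied to |a| and to its inverse.
  have k1 : |Real.log (a t y)| ≤ r := by
    have u1 : Real.log |a t y| ≤ |a t y| - 1 := Real.log_le_sub_one_of_pos ha
    have u2 : Real.log |a t y|⁻¹ ≤ |a t y|⁻¹ - 1 := Real.log_le_sub_one_of_pos (inv_pos.2 ha)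
    have u3 := h.inv_le t ht y
    have u4 := h.abs_a_le ht y
    rw [abs_inv] at u3
    rw [Real.log_inv] at u2
    rw [Real.log_abs] at u1 u2
    rw [abs_le]
    constructor <;> linarith
  have k2 : |∫ z in (0 : ℝ)..y, b t z / a t z| ≤ r ^ 2 * r := by
    refine (intervalIntegral.norm_integral_le_of_norm_le_const
      (f := fun z => b t z / a t z) (fun z _ => h.abs_quotient_le ht z)).trans ?_
    rw [sub_zero, abs_of_nonneg hy.1]
    have := h.M_le
    have := hy.2
    gcongr
    linarith
  calc _ ≤ |(2 * m / 3 - 1 : ℝ)| * |Real.log (a t y)|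
        + 2 / 3 * |∫ z in (0 : ℝ)..y, b t z / a t z| := by
        refine (abs_add_le _ _).trans ?_
        rw [abs_mul, abs_mul, abs_of_pos (show (0 : ℝ) < 2 / 3 by norm_num)]
    _ ≤ r * r + 2 / 3 * (r ^ 2 * r) := by
        have := h.abs_exponent_le hm
        gcongr
    _ ≤ _ := by nlinarith [pow_pos (show 0 < r by linarith) 2]

/-- The time regularity of a and b is passed on to the weight, as `IsWeight` demands. Periodicity
reduces to x in [0,M), where the integral runs over a length of at most r. -/
theorem logWeight_lipschitz (h : CoeffBounds M T n r a b c d) {m : ℕ} (hm : m ≤ n) {s t : ℝ}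
    (hs : s ∈ Icc 0 T) (ht : t ∈ Icc 0 T) (x : ℝ) :
    |logWeight m a b t x - logWeight m a b s x| ≤ 4 * r ^ 5 * |t - s| := by
  have hr := h.pos_r
  obtain ⟨y, hy, e⟩ := ((h.periodic_logWeight m ht).sub
    (h.periodic_logWeight m hs)).exists_mem_Ico₀ h.M_pos x
  simp only [Pi.sub_apply] at e
  rw [e, logWeight, logWeight]
  have hlog : ∀ {p q : ℝ}, p ∈ Icc 0 T → q ∈ Icc 0 T →
      Real.log (a p y) - Real.log (a q y) ≤ r ^ 2 * |p - q| := by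
    intro p q hp hq
    have hap := abs_pos.2 (h.a_ne p hp y)
    have haq := abs_pos.2 (h.a_ne q hq y)
    rw [← Real.log_abs, ← Real.log_abs (a q y), ← Real.log_div hap.ne' haq.ne']
    refine (Real.log_le_sub_one_of_pos (div_pos hap haq)).trans ?_
    have e1 : |a p y| / |a q y| - 1 = (|a p y| - |a q y|) * |a q y|⁻¹ := by
      field_simp
    have e2 := abs_sub_abs_le_abs_sub (a p y) (a q y)
    have e3 := h.a_lip q hq p hp y
    have e4 := h.inv_le q hq y
    rw [abs_inv] at e4
    rw [e1]
    calc _ ≤ (r * |p - q|) * |a q y|⁻¹ := by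
          gcongr
          exact e2.trans e3
      _ ≤ (r * |p - q|) * r := by gcongr
      _ = _ := by ring
  have k1 : |Real.log (a t y) - Real.log (a s y)| ≤ r ^ 2 * |t - s| := by
    rw [abs_sub_le_iff]
    refine ⟨hlog ht hs, ?_⟩
    rw [abs_sub_comm]
    exact hlog hs ht
  have hq : ∀ z, |b t z / a t z - b s z / a s z| ≤ (r ^ 2 + r ^ 4) * |t - s| := by
    intro z
    have ne1 := h.a_ne t ht z
    have ne2 := h.a_ne s hs z
    have e1 : b t z / a t z - b s z / a s z = (b t z - b s z) * (a t z)⁻¹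
        - b s z * (a t z - a s z) * ((a t z)⁻¹ * (a s z)⁻¹) := by
      field_simp; ring
    rw [e1]
    refine (abs_sub _ _).trans ?_
    rw [abs_mul, abs_mul, abs_mul, abs_mul]
    have u1 := h.a_lip s hs t ht z
    have u2 := h.b_lip s hs t ht z
    have u3 := h.inv_le t ht z
    have u4 := h.inv_le s hs z
    have u5 := h.abs_b_le hs z
    calc _ ≤ r * |t - s| * r + r * (r * |t - s|) * (r * r) := by gcongr
      _ = _ := by ring
  have k2 : |(∫ z in (0 : ℝ)..y, b t z / a t z) - ∫ z in (0 : ℝ)..y, b s z / a s z|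
      ≤ (r ^ 2 + r ^ 4) * |t - s| * r := by
    rw [← intervalIntegral.integral_sub ((h.continuous_quotient ht).intervalIntegrable _ _)
      ((h.continuous_quotient hs).intervalIntegrable _ _)]
    refine (intervalIntegral.norm_integral_le_of_norm_le_const
      (f := fun z => b t z / a t z - b s z / a s z) (fun z _ => hq z)).trans ?_
    rw [sub_zero, abs_of_nonneg hy.1]
    have := h.M_le
    have := hy.2
    gcongr
    linarith
  have e1 : (2 * m / 3 - 1) * Real.log (a t y) + 2 / 3 * (∫ z in (0 : ℝ)..y, b t z / a t z)
      - ((2 * m / 3 - 1) * Real.log (a s y) + 2 / 3 * ∫ z in (0 : ℝ)..y, b s z / a s z)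
      = (2 * m / 3 - 1) * (Real.log (a t y) - Real.log (a s y)) + 2 / 3 *
        ((∫ z in (0 : ℝ)..y, b t z / a t z) - ∫ z in (0 : ℝ)..y, b s z / a s z) := by ring
  rw [e1]
  calc _ ≤ |(2 * m / 3 - 1 : ℝ)| * |Real.log (a t y) - Real.log (a s y)| + 2 / 3 *
        |(∫ z in (0 : ℝ)..y, b t z / a t z) - ∫ z in (0 : ℝ)..y, b s z / a s z| := by
        refine (abs_add_le _ _).trans ?_
        rw [abs_mul, abs_mul, abs_of_pos (show (0 : ℝ) < 2 / 3 by norm_num)]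
    _ ≤ r * (r ^ 2 * |t - s|) + 2 / 3 * ((r ^ 2 + r ^ 4) * |t - s| * r) := by
        have := h.abs_exponent_le hm
        gcongr
    _ = (r ^ 3 + 2 / 3 * (r ^ 3 + r ^ 5)) * |t - s| := by ring
    _ ≤ _ := by
        have : r ^ 3 ≤ r ^ 5 := pow_le_pow_right₀ (by linarith) (by norm_num)
        have : 0 ≤ r ^ 5 := by positivity
        gcongr
        linarith

end CoeffBounds

theorem weightBound_pos (r : ℝ) : 0 < weightBound r := Real.exp_pos _

theorem abs_exp_sub_exp_le {p q B : ℝ} (hp : p ≤ B) (hq : q ≤ B) :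
    |Real.exp p - Real.exp q| ≤ Real.exp B * |p - q| := by
  have key : ∀ {p q : ℝ}, p ≤ B → Real.exp p - Real.exp q ≤ Real.exp B * |p - q| := by
    intro p q hp
    have h1 := Real.add_one_le_exp (q - p)
    have h2 : Real.exp q = Real.exp p * Real.exp (q - p) := by rw [← Real.exp_add]; ring_nf
    have h3 : Real.exp p ≤ Real.exp B := Real.exp_le_exp.2 hp
    have h4 := le_abs_self (p - q)
    have h5 := Real.exp_pos p
    calc Real.exp p - Real.exp q = Real.exp p * (1 - Real.exp (q - p)) := by rw [h2]; ring
      _ ≤ Real.exp p * |p - q| := by gcongr; linarith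
      _ ≤ _ := by gcongr
  rw [abs_sub_le_iff]
  refine ⟨key hp, ?_⟩
  rw [abs_sub_comm]
  exact key hq

namespace CoeffBounds

variable (h : CoeffBounds M T n r a b c d) {m : ℕ} (hm : m ≤ n) {s t : ℝ}
include h

theorem weight_apply (ht : t ∈ Icc 0 T) (x : ℝ) :
    weight M m a b t (x : AddCircle M) = Real.exp (logWeight m a b t x) :=
  toC_apply (Real.continuous_exp.comp (h.continuous_logWeight m ht))
    ((h.periodic_logWeight m ht).comp Real.exp) x

theorem weightInv_apply (ht : t ∈ Icc 0 T) (x : ℝ) :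
    weightInv M m a b t (x : AddCircle M) = Real.exp (-logWeight m a b t x) :=
  toC_apply (Real.continuous_exp.comp (h.continuous_logWeight m ht).neg)
    ((h.periodic_logWeight m ht).comp (fun z => Real.exp (-z))) x

include hm

theorem weightAt (ht : t ∈ Icc 0 T) :
    WeightAt m (weightBound r) (jet M a t) (jet M b t) (toC M fun x => (a t x)⁻¹)
      (weight M m a b t) (weightInv M m a b t) where
  real := star_toC _
  real' := star_toC _
  deriv := by
    intro x
    have h1 := (h.hasDerivAt_logWeight m ht x).exp.ofReal_comp
    simp only [h.weight_apply ht]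
    refine h1.congr_deriv ?_
    have hpa := h.a_mem.periodic t ht
    have hca := h.a_mem.continuous_self ht
    rw [ContinuousMap.mul_apply, h.weight_apply ht, weightLog, ContinuousMap.mul_apply,
      ContinuousMap.add_apply, ContinuousMap.smul_apply, ContinuousMap.smul_apply, jet, jet,
      toC_apply (f := fun x => (a t x)⁻¹) (hca.inv₀ (h.a_ne t ht)) (fun y => by simp only [hpa y]),
      toC_apply (h.a_mem.continuous (by omega) ht) (periodic_iteratedDeriv hpa 1),
      toC_apply (h.b_mem.continuous (by omega) ht)
        (periodic_iteratedDeriv (h.b_mem.periodic t ht) 0), iteratedDeriv_zero, iteratedDeriv_one]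
    rw [smul_eq_mul, smul_eq_mul]
    push_cast
    ring
  inv := by
    refine toC_ext fun x => ?_
    rw [ContinuousMap.mul_apply, h.weight_apply ht, h.weightInv_apply ht,
      ContinuousMap.one_apply, ← Complex.ofReal_mul, ← Real.exp_add, add_neg_cancel,
      Real.exp_zero, Complex.ofReal_one]
  bd := isBd_toC fun x => by
    rw [abs_of_pos (Real.exp_pos _)]
    exact Real.exp_le_exp.2 ((le_abs_self _).trans (h.abs_logWeight_le hm ht x))
  bd' := isBd_toC fun x => by
    rw [abs_of_pos (Real.exp_pos _)]
    exact Real.exp_le_exp.2 ((neg_le_abs _).trans (h.abs_logWeight_le hm ht x))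

theorem weight_lipschitz [Fact (0 < M)] (hs : s ∈ Icc 0 T) (ht : t ∈ Icc 0 T) :
    ‖weight M m a b t - weight M m a b s‖ ≤ weightLip r * |t - s| := by
  have hr := h.pos_r
  have hW := weightBound_pos r
  refine norm_toC_sub_le (Real.continuous_exp.comp (h.continuous_logWeight m ht))
    (Real.continuous_exp.comp (h.continuous_logWeight m hs))
    ((h.periodic_logWeight m ht).comp Real.exp)
    ((h.periodic_logWeight m hs).comp Real.exp) (by unfold weightLip; positivity)
    fun x => ?_
  refine (abs_exp_sub_exp_le ((le_abs_self _).trans (h.abs_logWeight_le hm ht x))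
    ((le_abs_self _).trans (h.abs_logWeight_le hm hs x))).trans ?_
  have := h.logWeight_lipschitz hm hs ht x
  rw [weightLip, mul_assoc]
  exact mul_le_mul_of_nonneg_left this (weightBound_pos r).le

theorem weightInv_lipschitz [Fact (0 < M)] (hs : s ∈ Icc 0 T) (ht : t ∈ Icc 0 T) :
    ‖weightInv M m a b t - weightInv M m a b s‖ ≤ weightLip r * |t - s| := by
  have hr := h.pos_r
  have hW := weightBound_pos r
  refine norm_toC_sub_le (Real.continuous_exp.comp (h.continuous_logWeight m ht).neg)
    (Real.continuous_exp.comp (h.continuous_logWeight m hs).neg)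
    ((h.periodic_logWeight m ht).comp (fun z => Real.exp (-z)))
    ((h.periodic_logWeight m hs).comp (fun z => Real.exp (-z))) (by unfold weightLip; positivity)
    fun x => ?_
  refine (abs_exp_sub_exp_le ((neg_le_abs _).trans (h.abs_logWeight_le hm ht x))
    ((neg_le_abs _).trans (h.abs_logWeight_le hm hs x))).trans ?_
  have := h.logWeight_lipschitz hm hs ht x
  rw [weightLip, mul_assoc, neg_sub_neg, abs_sub_comm]
  exact mul_le_mul_of_nonneg_left this (weightBound_pos r).le

theorem weight_ge (ht : t ∈ Icc 0 T) (y : AddCircle M) :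
    (weightBound r)⁻¹ ≤ (weight M m a b t y).re := by
  induction y using QuotientAddGroup.induction_on with | _ x => ?_
  refine le_of_le_of_eq ?_ (congrArg Complex.re (h.weight_apply ht x)).symm
  rw [Complex.ofReal_re, weightBound, ← Real.exp_neg]
  exact Real.exp_le_exp.2 (neg_le_of_abs_le (h.abs_logWeight_le hm ht x))

omit hm h in
theorem continuousOn_of_lipschitz {E : Type*} [NormedAddCommGroup E] {f : ℝ → E} {L : ℝ}
    (hf : ∀ s ∈ Icc 0 T, ∀ t ∈ Icc 0 T, ‖f t - f s‖ ≤ L * |t - s|) :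
    ContinuousOn f (Icc 0 T) := by
  refine (LipschitzOnWith.of_dist_le_mul (K := L.toNNReal) fun x hx y hy => ?_).continuousOn
  rw [dist_eq_norm, Real.dist_eq]
  exact (hf y hy x hx).trans (by gcongr; exact Real.le_coe_toNNReal L)

theorem isWeight [hM : Fact (0 < M)] : IsWeight T (weightLip r) (weightBound r)⁻¹ (weightBound r)
    (fun t => mulOp (weight M m a b t)) where
  m_pos := inv_pos.2 (weightBound_pos r)
  D_nonneg := (weightBound_pos r).le
  L_nonneg := by
    have := h.pos_r
    have := weightBound_pos r
    unfold weightLip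
    positivity
  lipschitz s hs t ht := by
    rw [← map_sub]
    exact norm_mulOp_le ((norm_nonneg _).trans (h.weight_lipschitz hm hs ht)) fun x =>
      (ContinuousMap.norm_coe_le_norm _ x).trans (h.weight_lipschitz hm hs ht)
  symm t ht x y := by rw [inner_mulOp, (h.weightAt hm ht).real]
  coercive t ht x := re_inner_mulOp_self_ge (h.weight_ge hm ht) x
  bounded t ht := norm_mulOp_le (weightBound_pos r).le (h.weightAt hm ht).bd

end CoeffBounds

end Weight

/-! ### Existence for the equation satisfied by `(1 + ∂ₓ)ⁿ u` -/

section Existence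

variable {M T r : ℝ} {n : ℕ} {a b c d : ℝ → ℝ → ℝ} [hM : Fact (0 < M)]

/-- The operator `(a ∂ₓ³ + b ∂ₓ² + c ∂ₓ + d)(1 + ∂ₓ)⁻ⁿ` at time `t`. -/
def genAt (M : ℝ) [Fact (0 < M)] (n : ℕ) (a b c d : ℝ → ℝ → ℝ) (t : ℝ) :
    CircleL2 M →L[ℂ] CircleL2 M :=
  genOp n (jet M a t 0) (jet M b t 0) (jet M c t 0) (jet M d t 0)

/-- The approximation of `(1 + ∂ₓ)ⁿ (a ∂ₓ³ + b ∂ₓ² + c ∂ₓ + d) (1 + ∂ₓ)⁻ⁿ` at time `t`. -/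
def approxAt (M : ℝ) [Fact (0 < M)] (n N : ℕ) (a b c d : ℝ → ℝ → ℝ) (t : ℝ) :
    CircleL2 M →L[ℂ] CircleL2 M :=
  approxOp n N (jet M a t 0) (jet M b t 0) (jet M c t 0) (jet M d t 0) (weight M n a b t)
    (weightInv M n a b t)

/-- The constant in the energy inequality. -/
def energyConst (r : ℝ) : ℝ :=
  (30 * weightBound r * r ^ 8 + 30 * weightBound r * Real.exp r * r) * weightBound r ^ 4

/-- The exponential rate in the energy inequality. -/
def energyRate (r : ℝ) : ℝ :=
  (weightLip r + 2 * energyConst r + weightBound r) / (weightBound r)⁻¹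

theorem conj_approxOp {n N : ℕ} (hn : 4 ≤ n) {a b c d ρ θ : C(AddCircle M, ℂ)} (ha : star a = a)
    (hb : star b = b) (hc : star c = c) (hd : star d = d) (hρ : star ρ = ρ) (hθ : star θ = θ)
    (w : CircleL2 M) :
    conjOp (approxOp n N a b c d ρ θ w) = approxOp n N a b c d ρ θ (conjOp w) := by
  simp only [approxOp, mul_apply_eq_comp]
  rw [conjOp_derivProjOp, conjOp_genOp hn ha hb hc hd, conjOp_mulOp hθ, conjOp_projOp,
    conjOp_mulOp hρ]

/-- Multiplication by a real function and the Fourier projection are self-adjoint, and the adjoint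
of the truncated (1 + ∂ₓ)ⁿ merely multiplies a single mode by a scalar. This avoids the unbounded
operator (1 + ∂ₓ)ⁿ in the limit. -/
theorem adjoint_approxOp {n N : ℕ} {a b c d ρ θ : C(AddCircle M, ℂ)} (hρ : star ρ = ρ)
    (hθ : star θ = θ) (k : ℤ) :
    ContinuousLinearMap.adjoint (approxOp n N a b c d ρ θ) (fourierBasis k)
      = mulOp ρ (projOp M N (mulOp θ (ContinuousLinearMap.adjoint (genOp n a b c d)
        ((if k.natAbs ≤ N then starRingEnd ℂ (symb M k ^ n) else 0) • fourierBasis k)))) := by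
  refine ext_inner_right ℂ fun v => ?_
  rw [ContinuousLinearMap.adjoint_inner_left, inner_mulOp, hρ, projOp_symm, inner_mulOp, hθ,
    ContinuousLinearMap.adjoint_inner_left, inner_smul_left, ← fc_eq_inner, ← fc_eq_inner]
  simp only [approxOp, mul_apply_eq_comp, fc_derivProjOp]
  split_ifs <;> simp

namespace CoeffBounds

omit hM in
theorem energyConst_nonneg (h : CoeffBounds M T n r a b c d) : 0 ≤ energyConst r := by
  have := h.pos_r
  have := weightBound_pos r
  unfold energyConst
  positivity

theorem continuousOn_genAt (h : CoeffBounds M T n r a b c d) :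
    ContinuousOn (genAt M n a b c d) (Icc 0 T) := by
  have hmul : ∀ {f : ℝ → C(AddCircle M, ℂ)}, ContinuousOn f (Icc 0 T) →
      ContinuousOn (fun t => mulOp (f t)) (Icc 0 T) := fun hf =>
    (mulOp (M := M)).continuous.comp_continuousOn hf
  unfold genAt genOp
  exact ((((hmul (h.a_mem.continuousOn_jet (Nat.zero_le _))).mul continuousOn_const).add
    ((hmul (h.b_mem.continuousOn_jet (Nat.zero_le _))).mul continuousOn_const)).add
    ((hmul (h.c_mem.continuousOn_jet (Nat.zero_le _))).mul continuousOn_const)).add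
    ((hmul (h.d_mem.continuousOn_jet (Nat.zero_le _))).mul continuousOn_const)

theorem continuousOn_approxAt (h : CoeffBounds M T n r a b c d) (N : ℕ) :
    ContinuousOn (approxAt M n N a b c d) (Icc 0 T) := by
  have hmul : ∀ {f : ℝ → C(AddCircle M, ℂ)}, ContinuousOn f (Icc 0 T) →
      ContinuousOn (fun t => mulOp (f t)) (Icc 0 T) := fun hf =>
    (mulOp (M := M)).continuous.comp_continuousOn hf
  have h1 := hmul (continuousOn_of_lipschitz fun s hs t ht => h.weight_lipschitz le_rfl hs ht)
  have h2 := hmul (continuousOn_of_lipschitz fun s hs t ht => h.weightInv_lipschitz le_rfl hs ht)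
  unfold approxAt approxOp
  exact (((continuousOn_const.mul h.continuousOn_genAt).mul h2).mul continuousOn_const).mul h1

theorem re_inner_approxAt_le (h : CoeffBounds M T n r a b c d) (N : ℕ) {t : ℝ} (ht : t ∈ Icc 0 T)
    (w : CircleL2 M) :
    (inner ℂ (mulOp (weight M n a b t) w) (approxAt M n N a b c d t w)).re
      ≤ energyConst r * ‖w‖ ^ 2 := by
  refine ((h.coeffAt ht).re_inner_approxOp_le (h.weightAt le_rfl ht) N w).trans ?_
  -- The factor 2ⁿ from the remainder is replaced by a function of r, using n ≤ r.
  have h1 : (2 : ℝ) ^ n ≤ Real.exp r := by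
    calc (2 : ℝ) ^ n ≤ Real.exp 1 ^ n := by
          gcongr
          linarith [Real.add_one_le_exp 1]
      _ = Real.exp n := by rw [← Real.exp_nat_mul, mul_one]
      _ ≤ Real.exp r := Real.exp_le_exp.2 h.le_r
  have := h.pos_r
  have := weightBound_pos r
  unfold energyConst
  gcongr

/-- Once N ≥ |k|, the outer truncation no longer affects the mode, and only ρ P_N θ depends on N; it
converges strongly to ρθ = 1. -/
theorem tendsto_adjoint_approxAt (h : CoeffBounds M T n r a b c d) (k : ℤ) {t : ℝ}
    (ht : t ∈ Icc 0 T) :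
    Tendsto (fun N => ContinuousLinearMap.adjoint (approxAt M n N a b c d t) (fourierBasis k)) atTop
      (𝓝 (ContinuousLinearMap.adjoint (genAt M n a b c d t)
        (starRingEnd ℂ (symb M k ^ n) • fourierBasis k))) := by
  have hw := h.weightAt le_rfl ht
  set v := ContinuousLinearMap.adjoint (genAt M n a b c d t)
        (starRingEnd ℂ (symb M k ^ n) • fourierBasis k) with hv
  have e : v = mulOp (weight M n a b t) (mulOp (weightInv M n a b t) v) := by
    rw [mulOp_mulOp, hw.inv, mulOp_one]
  nth_rewrite 1 [e]
  refine (((mulOp (weight M n a b t)).continuous.tendsto _).comp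
    (tendsto_projOp (mulOp (weightInv M n a b t) v))).congr' ?_
  filter_upwards [eventually_ge_atTop k.natAbs] with N hN
  rw [Function.comp_apply, approxAt, adjoint_approxOp hw.real hw.real', if_pos hN]
  rfl

/-- The bound may grow with k but not with N or t. This makes the coefficients of the approximations
equi-Lipschitz in time. -/
theorem norm_adjoint_approxAt_le (h : CoeffBounds M T n r a b c d) : ∃ G : ℝ, ∀ N k, ∀ t ∈ Icc 0 T,
    ‖ContinuousLinearMap.adjoint (approxAt M n N a b c d t) (fourierBasis k)‖
      ≤ weightBound r * (weightBound r * (G * ‖symb M k ^ n‖)) := by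
  obtain ⟨G, hG⟩ := isCompact_Icc.exists_bound_of_continuousOn h.continuousOn_genAt
  refine ⟨G, fun N k t ht => ?_⟩
  have hW := weightBound_pos r
  have hw := h.weightAt le_rfl ht
  rw [approxAt, adjoint_approxOp hw.real hw.real']
  refine (norm_mulOp_apply_le hw.bd _).trans (mul_le_mul_of_nonneg_left ?_ hW.le)
  refine (ContinuousLinearMap.le_of_opNorm_le _ (norm_projOp_le N) _).trans ?_
  rw [one_mul]
  refine (norm_mulOp_apply_le hw.bd' _).trans (mul_le_mul_of_nonneg_left ?_ hW.le)
  have hG0 : 0 ≤ G := (norm_nonneg _).trans (hG t ht)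
  have e1 : ‖ContinuousLinearMap.adjoint (genOp n (jet M a t 0) (jet M b t 0) (jet M c t 0)
      (jet M d t 0))‖ ≤ G := by
    rw [LinearIsometryEquiv.norm_map]; exact hG t ht
  refine (ContinuousLinearMap.le_of_opNorm_le _ e1 _).trans (mul_le_mul_of_nonneg_left ?_ hG0)
  rw [norm_smul, fourierBasis.orthonormal.norm_eq_one, mul_one]
  split_ifs
  · rw [RCLike.norm_conj]
  · rw [norm_zero]; exact norm_nonneg _

theorem exists_evolution (h : CoeffBounds M T n r a b c d) {E : ℝ} {f : ℝ → CircleL2 M}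
    (hf : AEStronglyMeasurable f (volume.restrict (Icc 0 T)))
    (hfE : ∀ᵐ t ∂volume.restrict (Icc 0 T), ‖f t‖ ≤ E)
    (hJf : ∀ᵐ t ∂volume.restrict (Icc 0 T), conjOp (f t) = f t) (w₀ : CircleL2 M)
    (hJw : conjOp w₀ = w₀) :
    ∃ w : ℝ → CircleL2 M, w 0 = w₀ ∧ (∀ t ∈ Icc 0 T, conjOp (w t) = w t) ∧
      (∀ k, ∀ t ∈ Icc 0 T, fc (w t) k = fc w₀ k
        + ∫ s in (0 : ℝ)..t, (symb M k ^ n * fc (genAt M n a b c d s (w s)) k + fc (f s) k)) ∧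
      (∀ k, ∃ A, ∀ s ∈ Icc 0 T, ∀ t ∈ Icc 0 T, ‖fc (w t) k - fc (w s) k‖ ≤ A * |t - s|) ∧
      ∀ t ∈ Icc 0 T, (inner ℂ (mulOp (weight M n a b t) (w t)) (w t)).re
        ≤ Real.exp (energyRate r * t)
          * ((inner ℂ (mulOp (weight M n a b 0) w₀) w₀).re + weightBound r * E ^ 2 * t) := by
  obtain ⟨G, hG⟩ := h.norm_adjoint_approxAt_le
  obtain ⟨w, h0, h1, h2, h3, h4⟩ := exists_galerkin_limit (fourierBasis (T := M)) h.T_pos.le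
    (h.isWeight le_rfl) h.energyConst_nonneg (P := projOp M) norm_projOp_le tendsto_projOp
    (Q := fun N => approxAt M n N a b c d) h.continuousOn_approxAt
    (fun N t ht w => h.re_inner_approxAt_le N ht w)
    (fun k t ht => h.tendsto_adjoint_approxAt k ht) hG hf hfE w₀ (J := conjOp)
    (fun w k => ((fc_eq_inner _ k).symm.trans (fc_conjOp w k)).trans
      (congrArg _ (fc_eq_inner _ _))) conjOp_projOp
    (fun N t ht w => conj_approxOp h.four_le (star_toC _) (star_toC _) (star_toC _) (star_toC _)
      (star_toC _) (star_toC _) w) hJf hJw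
  refine ⟨w, h0, h1, fun k t ht => ?_, by simpa only [fc_eq_inner] using h3, h4⟩
  simpa only [ContinuousLinearMap.adjoint_inner_left, inner_smul_left, Complex.conj_conj,
    ← fc_eq_inner] using h2 k t ht

end CoeffBounds

end Existence

/-! ### Sobolev functions as elements of `L²` -/

section Sobolev

open AddCircle ENNReal

variable {M : ℝ}

theorem sobolevTerm_natCast (n : ℕ) (f : ℝ → ℝ) (k : ℤ) :
    sobolevTerm M n f k = M * ‖symb M k ^ n * coeff M f k‖ ^ 2 := by
  have : ‖symb M k ^ n‖ ^ 2 = (1 + waveNumber M k ^ 2) ^ n := by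
    rw [norm_pow, ← pow_mul, mul_comm, pow_mul, norm_symb_sq]
  rw [sobolevTerm, Real.rpow_natCast, norm_mul, mul_pow, this, waveNumber]

variable [hM : Fact (0 < M)]

theorem summable_sobolevTerm_iff {n : ℕ} {f : ℝ → ℝ} :
    Summable (sobolevTerm M n f) ↔ Summable fun k => ‖symb M k ^ n * coeff M f k‖ ^ 2 := by
  rw [show sobolevTerm M n f = fun k => M * ‖symb M k ^ n * coeff M f k‖ ^ 2 from
    funext (sobolevTerm_natCast n f)]
  exact summable_mul_left_iff hM.out.ne'

open Classical in
/-- The element `(1 + ∂ₓ)ⁿ f` of `L²`, for `f` in `Hⁿ`. -/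
def sob (M : ℝ) [Fact (0 < M)] (n : ℕ) (f : ℝ → ℝ) : CircleL2 M :=
  if h : Summable fun k => ‖symb M k ^ n * coeff M f k‖ ^ 2 then ofCoeff _ h else 0

theorem fc_sob {n : ℕ} {f : ℝ → ℝ} (hf : Summable (sobolevTerm M n f)) (k : ℤ) :
    fc (sob M n f) k = symb M k ^ n * coeff M f k := by
  rw [sob, dif_pos (summable_sobolevTerm_iff.1 hf), fc_ofCoeff]

/-- The factor √M appears because `CircleL2` carries the Haar measure of total mass 1, while the
Sobolev norm carries the factor M. -/
theorem normH_eq {n : ℕ} {f : ℝ → ℝ} (hf : Summable (sobolevTerm M n f)) :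
    normH M n f = Real.sqrt M * ‖sob M n f‖ := by
  have h : ∑' k, sobolevTerm M n f k = M * ‖sob M n f‖ ^ 2 := by
    rw [← (hasSum_fc_sq (sob M n f)).tsum_eq, ← tsum_mul_left]
    exact tsum_congr fun k => by rw [sobolevTerm_natCast, fc_sob hf]
  rw [normH, h, Real.sqrt_mul hM.out.le, Real.sqrt_sq (norm_nonneg _)]

theorem coeff_eq_fourierCoeff {f : ℝ → ℝ} {g : C(AddCircle M, ℂ)}
    (h : ∀ x : ℝ, (f x : ℂ) = g (x : AddCircle M)) (k : ℤ) : coeff M f k = fc (toL2 g) k := by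
  rw [fc_toL2, fourierCoeff_eq_intervalIntegral _ _ 0, zero_add, coeff, Complex.real_smul]
  congr 1
  · push_cast; rw [one_div]
  · refine intervalIntegral.integral_congr fun x _ => ?_
    simp only [h x, smul_eq_mul, fourier_coe_apply]
    rw [mul_comm]
    congr 2
    push_cast
    ring

theorem toL2_star (g : C(AddCircle M, ℂ)) : toL2 (star g) = conjOp (toL2 g) := by
  refine Lp.ext ?_
  filter_upwards [coeFn_toL2 (star g), coeFn_conjOp (toL2 g), coeFn_toL2 g] with x h1 h2 h3
  rw [h1, h2, h3]; rfl

/-- The continuous function `∂ₓ^j (1 + ∂ₓ)⁻ⁿ v`, for `j < n`. -/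
def jetOp (M : ℝ) [Fact (0 < M)] (n j : ℕ) : CircleL2 M →L[ℂ] C(AddCircle M, ℂ) :=
  embed.comp (derivOp M (n - 1) j)

/-- One of the n smoothing factors is spent on `embed` to obtain a continuous function, so `derivOp`
is taken with n - 1 and j must stay below n. -/
theorem toL2_jetOp {n j : ℕ} (hj : j < n) (v : CircleL2 M) :
    toL2 (jetOp M n j v) = derivOp M n j v := by
  refine fc_ext fun k => ?_
  rw [jetOp, ContinuousLinearMap.comp_apply, toL2_embed, fc_smoothOp, fc_derivOp (by omega),
    fc_derivOp hj.le]
  obtain ⟨m, rfl⟩ : ∃ m, n = m + 1 := ⟨n - 1, by omega⟩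
  rw [Nat.add_sub_cancel, pow_succ]
  ring

theorem fc_jetOp_zero {n : ℕ} (hn : 0 < n) (v : CircleL2 M) (k : ℤ) :
    fc (toL2 (jetOp M n 0 v)) k = (symb M k)⁻¹ ^ n * fc v k := by
  rw [toL2_jetOp hn, fc_derivOp (Nat.zero_le n), pow_zero, one_mul]

theorem isDeriv_jetOp {n j : ℕ} (hj : j + 1 < n) (v : CircleL2 M) :
    IsDeriv (jetOp M n j v) (jetOp M n (j + 1) v) := by
  obtain ⟨u, hu⟩ : ∃ u, u = ((1 - smoothOp M) ^ j * smoothOp M ^ (n - 1 - j - 1)) v := ⟨_, rfl⟩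
  have hfu : ∀ k, fc u k = (1 - (symb M k)⁻¹) ^ j * ((symb M k)⁻¹ ^ (n - 1 - j - 1) * fc v k) :=
    fun k => by rw [hu, mul_apply_eq_comp, fc_one_sub_smoothOp_pow, fc_smoothOp_pow]
  obtain ⟨i, rfl⟩ : ∃ i, n = i + j + 2 := ⟨n - j - 2, by omega⟩
  have e1 : derivOp M (i + j + 2 - 1) j v = smoothOp M u := by
    refine fc_ext fun k => ?_
    rw [derivOp, mul_apply_eq_comp, fc_one_sub_smoothOp_pow, fc_smoothOp_pow, fc_smoothOp, hfu,
      show i + j + 2 - 1 - j = i + 1 by omega, show i + 1 - 1 = i by omega]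
    ring
  have e2 : derivOp M (i + j + 2 - 1) (j + 1) v = u - smoothOp M u := by
    refine fc_ext fun k => ?_
    rw [derivOp, mul_apply_eq_comp, fc_one_sub_smoothOp_pow, fc_smoothOp_pow, fc_sub, fc_smoothOp,
      hfu, show i + j + 2 - 1 - (j + 1) = i by omega, show i + j + 2 - 1 - j - 1 = i by omega]
    ring
  rw [jetOp, jetOp, ContinuousLinearMap.comp_apply, ContinuousLinearMap.comp_apply, e1, e2]
  exact isDeriv_embed u

theorem star_jetOp {n j : ℕ} (hj : j < n) {v : CircleL2 M} (hv : conjOp v = v) :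
    star (jetOp M n j v) = jetOp M n j v := by
  refine toL2_injective ?_
  rw [toL2_star, toL2_jetOp hj, conjOp_derivOp hj.le, hv]

/-- The function `(1 + ∂ₓ)⁻ⁿ v` on the line, for real `v` in `L²`. -/
def profile (n : ℕ) (v : CircleL2 M) (x : ℝ) : ℝ := (jetOp M n 0 v (x : AddCircle M)).re

theorem ofReal_re_jetOp {n j : ℕ} (hj : j < n) {v : CircleL2 M} (hv : conjOp v = v)
    (x : AddCircle M) : ((jetOp M n j v x).re : ℂ) = jetOp M n j v x := by
  have := DFunLike.congr_fun (star_jetOp hj hv) x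
  exact Complex.conj_eq_iff_re.1 this

theorem iteratedDeriv_profile {n j : ℕ} (hj : j < n) (v : CircleL2 M) (x : ℝ) :
    iteratedDeriv j (profile n v) x = (jetOp M n j v (x : AddCircle M)).re := by
  induction j generalizing x with
  | zero => rw [iteratedDeriv_zero]; rfl
  | succ j ih =>
    rw [iteratedDeriv_succ, funext (ih (by omega))]
    exact (Complex.reCLM.hasFDerivAt.comp_hasDerivAt x (isDeriv_jetOp hj v x)).deriv

theorem continuous_profile (n : ℕ) (v : CircleL2 M) : Continuous (profile n v) :=
  Complex.continuous_re.comp ((jetOp M n 0 v).continuous.comp (AddCircle.continuous_mk' M))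

theorem periodic_profile (n : ℕ) (v : CircleL2 M) : Function.Periodic (profile n v) M := by
  intro x; simp only [profile, AddCircle.coe_add_period]

theorem coeff_profile {n : ℕ} (hn : 0 < n) {v : CircleL2 M} (hv : conjOp v = v) (k : ℤ) :
    coeff M (profile n v) k = (symb M k)⁻¹ ^ n * fc v k := by
  rw [coeff_eq_fourierCoeff (f := profile n v) (fun x => ofReal_re_jetOp hn hv x),
    fc_jetOp_zero hn]

theorem symb_mul_coeff_profile {n : ℕ} (hn : 0 < n) {v : CircleL2 M} (hv : conjOp v = v) (k : ℤ) :
    symb M k ^ n * coeff M (profile n v) k = fc v k := by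
  rw [coeff_profile hn hv, ← mul_assoc, ← mul_pow, mul_inv_cancel₀ (symb_ne_zero k), one_pow,
    one_mul]

theorem memLp_of_continuous_periodic {f : ℝ → ℝ} (hc : Continuous f)
    (hp : Function.Periodic f M) : MemLp f 2 (volume.restrict (Ioc 0 M)) := by
  obtain ⟨B, hB⟩ := isBounded_iff_forall_norm_le.1 (hp.isBounded_of_continuous hM.out.ne' hc)
  exact MemLp.of_bound hc.aestronglyMeasurable B
    (Eventually.of_forall fun x => hB _ (mem_range_self x))

theorem memH_profile {n : ℕ} (hn : 0 < n) {v : CircleL2 M} (hv : conjOp v = v) :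
    MemH M n (profile n v) where
  periodic := periodic_profile n v
  memLp := memLp_of_continuous_periodic (continuous_profile n v) (periodic_profile n v)
  summable := by
    rw [summable_sobolevTerm_iff]
    simpa only [symb_mul_coeff_profile hn hv] using (hasSum_fc_sq v).summable
  continuous _ := continuous_profile n v

theorem sob_profile {n : ℕ} (hn : 0 < n) {v : CircleL2 M} (hv : conjOp v = v) :
    sob M n (profile n v) = v := fc_ext fun k => by
  rw [fc_sob (memH_profile hn hv).summable, symb_mul_coeff_profile hn hv]

theorem normH_profile {n : ℕ} (hn : 0 < n) {v : CircleL2 M} (hv : conjOp v = v) :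
    normH M n (profile n v) = Real.sqrt M * ‖v‖ := by
  rw [normH_eq (memH_profile hn hv).summable, sob_profile hn hv]

omit hM in
theorem coeff_neg_index (f : ℝ → ℝ) (k : ℤ) : coeff M f (-k) = starRingEnd ℂ (coeff M f k) := by
  rw [coeff, coeff, map_mul, map_inv₀, Complex.conj_ofReal]
  congr 1
  rw [intervalIntegral, intervalIntegral, map_sub, ← integral_conj, ← integral_conj]
  have e : ∀ x : ℝ, (f x : ℂ) * Complex.exp (-(2 * Real.pi * (-k : ℤ) * x / M : ℝ) * Complex.I)
      = starRingEnd ℂ ((f x : ℂ) * Complex.exp (-(2 * Real.pi * k * x / M : ℝ) * Complex.I)) := by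
    intro x
    rw [map_mul, Complex.conj_ofReal, ← Complex.exp_conj, map_mul, Complex.conj_I, map_neg,
      Complex.conj_ofReal]
    congr 2
    push_cast
    ring
  simp only [e]

theorem conjOp_sob (n : ℕ) (f : ℝ → ℝ) : conjOp (sob M n f) = sob M n f := by
  by_cases h : Summable (sobolevTerm M n f)
  · refine fc_ext fun k => ?_
    rw [fc_conjOp, fc_sob h, fc_sob h, symb_neg, coeff_neg_index, map_mul, map_pow,
      Complex.conj_conj, Complex.conj_conj]
  · rw [sob, dif_neg (mt summable_sobolevTerm_iff.2 h), map_zero]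

/-- The identity holds at every point, not just almost everywhere, because membership in Hⁿ includes
being the continuous representative. -/
theorem ofReal_eq_jetOp_sob {n : ℕ} (hn : 0 < n) {f : ℝ → ℝ} (hf : MemH M n f) (x : ℝ) :
    (f x : ℂ) = jetOp M n 0 (sob M n f) (x : AddCircle M) := by
  have hc : Continuous f := hf.continuous (by
    have : (1 : ℝ) ≤ n := by exact_mod_cast hn
    linarith)
  have e : toC M f = jetOp M n 0 (sob M n f) := toL2_injective (fc_ext fun k => by
    rw [fc_jetOp_zero hn, fc_sob hf.summable, ← mul_assoc, ← mul_pow,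
      inv_mul_cancel₀ (symb_ne_zero k), one_pow, one_mul,
      coeff_eq_fourierCoeff fun x => (toC_apply hc hf.periodic x).symm])
  rw [← e, toC_apply hc hf.periodic]

theorem profile_sob {n : ℕ} (hn : 0 < n) {f : ℝ → ℝ} (hf : MemH M n f) :
    profile n (sob M n f) = f := funext fun x => by
  rw [profile, ← ofReal_eq_jetOp_sob hn hf, Complex.ofReal_re]

theorem sub_profile (n : ℕ) (v w : CircleL2 M) (x : ℝ) :
    profile n v x - profile n w x = profile n (v - w) x := by
  simp only [profile, map_sub, ContinuousMap.sub_apply, Complex.sub_re]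

theorem normH_sub {n : ℕ} (hn : 0 < n) {f g : ℝ → ℝ} (hf : MemH M n f) (hg : MemH M n g) :
    normH M n (fun x => f x - g x) = Real.sqrt M * ‖sob M n f - sob M n g‖ := by
  have hc : conjOp (sob M n f - sob M n g) = sob M n f - sob M n g := by
    rw [map_sub, conjOp_sob, conjOp_sob]
  rw [← normH_profile hn hc]
  congr 1
  funext x
  rw [← sub_profile, profile_sob hn hf, profile_sob hn hg]

theorem MemH.sub {n : ℕ} (hn : 0 < n) {f g : ℝ → ℝ} (hf : MemH M n f) (hg : MemH M n g) :
    MemH M n (fun x => f x - g x) := by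
  have hc : conjOp (sob M n f - sob M n g) = sob M n f - sob M n g := by
    rw [map_sub, conjOp_sob, conjOp_sob]
  have := memH_profile hn hc
  rwa [show profile n (sob M n f - sob M n g) = fun x => f x - g x from funext fun x => by
    rw [← sub_profile, profile_sob hn hf, profile_sob hn hg]] at this

theorem sobolevTerm_le {s : ℝ} {n : ℕ} (hs : s ≤ n) (f : ℝ → ℝ) (k : ℤ) :
    sobolevTerm M s f k ≤ sobolevTerm M n f k := by
  have := hM.out.le
  unfold sobolevTerm
  gcongr
  exact le_add_of_nonneg_right (sq_nonneg _)

theorem sobolevTerm_nonneg (s : ℝ) (f : ℝ → ℝ) (k : ℤ) : 0 ≤ sobolevTerm M s f k := by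
  have := hM.out.le
  unfold sobolevTerm
  positivity

theorem normH_mono {s : ℝ} {n : ℕ} (hs : s ≤ n) {f : ℝ → ℝ}
    (hf : Summable (sobolevTerm M n f)) : normH M s f ≤ normH M n f :=
  Real.sqrt_le_sqrt (Summable.tsum_le_tsum (sobolevTerm_le hs f)
    (Summable.of_nonneg_of_le (sobolevTerm_nonneg s f) (sobolevTerm_le hs f) hf) hf)

theorem MemH.mono {s : ℝ} {n : ℕ} (hn : 0 < n) (hs : s ≤ n) {f : ℝ → ℝ} (hf : MemH M n f) :
    MemH M s f where
  periodic := hf.periodic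
  memLp := hf.memLp
  summable := Summable.of_nonneg_of_le (sobolevTerm_nonneg s f) (sobolevTerm_le hs f) hf.summable
  continuous _ := hf.continuous (by
    have : (1 : ℝ) ≤ n := by exact_mod_cast hn
    linarith)

/-- The Fourier projections are finite sums of measurable coefficients times fixed vectors and
converge pointwise to `f`. -/
theorem aestronglyMeasurable_of_fc {α : Type*} [MeasurableSpace α] {μ : Measure α}
    {f : α → CircleL2 M} (h : ∀ k, AEMeasurable (fun t => fc (f t) k) μ) :
    AEStronglyMeasurable f μ := by
  refine aestronglyMeasurable_of_tendsto_ae atTop (f := fun N t => projOp M N (f t)) (fun N => ?_)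
    (Eventually.of_forall fun t => tendsto_projOp (f t))
  have e : (fun t => projOp M N (f t))
      = fun t => ∑ k ∈ Finset.Icc (-(N : ℤ)) N, fc (f t) k • fourierBasis k := by
    funext t
    rw [← toL2_trigPoly]
    simp only [trigPoly, map_sum, map_smul, toL2_fourier, pow_zero, one_mul]
  rw [e]
  exact Finset.aestronglyMeasurable_fun_sum _ fun k _ =>
    (h k).aestronglyMeasurable.smul_const _

end Sobolev

/-! ### The equation in `L²` -/

section Evolution

variable {M T r : ℝ} {n : ℕ} {a b c d : ℝ → ℝ → ℝ} [hM : Fact (0 < M)]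

theorem aestronglyMeasurable_clm_apply {α E F : Type*} [MeasurableSpace α] {μ : Measure α}
    [NormedAddCommGroup E] [NormedSpace ℂ E] [NormedAddCommGroup F] [NormedSpace ℂ F]
    {Q : α → E →L[ℂ] F} {w : α → E} (hQ : AEStronglyMeasurable Q μ)
    (hw : AEStronglyMeasurable w μ) : AEStronglyMeasurable (fun s => Q s (w s)) μ :=
  (ContinuousLinearMap.id ℂ (E →L[ℂ] F)).aestronglyMeasurable_comp₂ hQ hw

/-- The continuous function `(a ∂ₓ³ + b ∂ₓ² + c ∂ₓ + d)(1 + ∂ₓ)⁻ⁿ v` at time `t`. -/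
def fieldOp (M : ℝ) [Fact (0 < M)] (n : ℕ) (a b c d : ℝ → ℝ → ℝ) (t : ℝ) :
    CircleL2 M →L[ℂ] C(AddCircle M, ℂ) :=
  (ContinuousLinearMap.mul ℂ _ (jet M a t 0)).comp (jetOp M n 3)
    + (ContinuousLinearMap.mul ℂ _ (jet M b t 0)).comp (jetOp M n 2)
    + (ContinuousLinearMap.mul ℂ _ (jet M c t 0)).comp (jetOp M n 1)
    + (ContinuousLinearMap.mul ℂ _ (jet M d t 0)).comp (jetOp M n 0)

theorem fieldOp_apply (t : ℝ) (v : CircleL2 M) : fieldOp M n a b c d t v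
    = jet M a t 0 * jetOp M n 3 v + jet M b t 0 * jetOp M n 2 v + jet M c t 0 * jetOp M n 1 v
      + jet M d t 0 * jetOp M n 0 v := rfl

theorem toL2_fieldOp (hn : 4 ≤ n) (t : ℝ) (v : CircleL2 M) :
    toL2 (fieldOp M n a b c d t v) = genAt M n a b c d t v := by
  rw [fieldOp_apply, map_add, map_add, map_add, ← mulOp_toL2, ← mulOp_toL2, ← mulOp_toL2,
    ← mulOp_toL2, toL2_jetOp (by omega), toL2_jetOp (by omega), toL2_jetOp (by omega),
    toL2_jetOp (by omega)]
  rfl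

/-- `w` is a solution of the equation for `(1 + ∂ₓ)ⁿ u` with the source `f`. -/
structure IsEvolution (M T : ℝ) [Fact (0 < M)] (n : ℕ) (a b c d : ℝ → ℝ → ℝ)
    (f w : ℝ → CircleL2 M) : Prop where
  real : ∀ t ∈ Icc 0 T, conjOp (w t) = w t
  bounded : ∃ B, ∀ t ∈ Icc 0 T, ‖w t‖ ≤ B
  continuous : ∀ k, ContinuousOn (fun t => fc (w t) k) (Icc 0 T)
  eq : ∀ t ∈ Icc 0 T, jetOp M n 0 (w t) = jetOp M n 0 (w 0)
    + ∫ s in (0 : ℝ)..t, (fieldOp M n a b c d s (w s) + jetOp M n 0 (f s))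

/-- The constant in the bound for solutions. -/
def growthConst (r : ℝ) : ℝ :=
  Real.sqrt (weightBound r * (Real.exp (energyRate r * r) * (weightBound r * (1 + r))))

theorem IsEvolution.aestronglyMeasurable {f w : ℝ → CircleL2 M}
    (hw : IsEvolution M T n a b c d f w) :
    AEStronglyMeasurable w (volume.restrict (Icc 0 T)) :=
  aestronglyMeasurable_of_fc fun k => (hw.continuous k).aemeasurable measurableSet_Icc

namespace CoeffBounds

theorem continuousOn_fieldOp (h : CoeffBounds M T n r a b c d) :
    ContinuousOn (fieldOp M n a b c d) (Icc 0 T) := by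
  have hmul : ∀ {f : ℝ → C(AddCircle M, ℂ)} (j : ℕ), ContinuousOn f (Icc 0 T) →
      ContinuousOn (fun t => (ContinuousLinearMap.mul ℂ _ (f t)).comp (jetOp M n j)) (Icc 0 T) :=
    fun j hf => ((ContinuousLinearMap.mul ℂ _).continuous.comp_continuousOn hf).clm_comp
      continuousOn_const
  unfold fieldOp
  exact (((hmul 3 (h.a_mem.continuousOn_jet (Nat.zero_le _))).add
    (hmul 2 (h.b_mem.continuousOn_jet (Nat.zero_le _)))).add
    (hmul 1 (h.c_mem.continuousOn_jet (Nat.zero_le _)))).add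
    (hmul 0 (h.d_mem.continuousOn_jet (Nat.zero_le _)))

theorem aestronglyMeasurable_fieldOp (h : CoeffBounds M T n r a b c d) {w : ℝ → CircleL2 M}
    (hw : AEStronglyMeasurable w (volume.restrict (Icc 0 T))) :
    AEStronglyMeasurable (fun s => fieldOp M n a b c d s (w s)) (volume.restrict (Icc 0 T)) :=
  aestronglyMeasurable_clm_apply
    (h.continuousOn_fieldOp.aestronglyMeasurable measurableSet_Icc) hw

theorem exists_norm_fieldOp_le (h : CoeffBounds M T n r a b c d) : ∃ G : ℝ, 0 ≤ G ∧
    ∀ t ∈ Icc 0 T, ∀ v, ‖fieldOp M n a b c d t v‖ ≤ G * ‖v‖ := by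
  obtain ⟨G, hG⟩ := isCompact_Icc.exists_bound_of_continuousOn h.continuousOn_fieldOp
  exact ⟨G, (norm_nonneg _).trans (hG 0 ⟨le_rfl, h.T_pos.le⟩), fun t ht v =>
    ContinuousLinearMap.le_of_opNorm_le _ (hG t ht) v⟩

theorem exists_bound_fieldOp (h : CoeffBounds M T n r a b c d) {w : ℝ → CircleL2 M} {B : ℝ}
    (hB : ∀ᵐ s ∂volume.restrict (Icc 0 T), ‖w s‖ ≤ B) :
    ∃ B', ∀ᵐ s ∂volume.restrict (Icc 0 T), ‖fieldOp M n a b c d s (w s)‖ ≤ B' := by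
  obtain ⟨G, hG0, hG⟩ := h.exists_norm_fieldOp_le
  refine ⟨G * B, ?_⟩
  filter_upwards [hB, ae_restrict_mem measurableSet_Icc] with s h1 h2
  exact (hG s h2 _).trans (by gcongr)

theorem intervalIntegrable_fieldOp (h : CoeffBounds M T n r a b c d) {w : ℝ → CircleL2 M} {B : ℝ}
    (hw : AEStronglyMeasurable w (volume.restrict (Icc 0 T)))
    (hB : ∀ᵐ s ∂volume.restrict (Icc 0 T), ‖w s‖ ≤ B) :
    IntervalIntegrable (fun s => fieldOp M n a b c d s (w s)) volume 0 T := by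
  obtain ⟨B', hB'⟩ := h.exists_bound_fieldOp hB
  exact intervalIntegrable_of_bound h.T_pos.le (h.aestronglyMeasurable_fieldOp hw) hB'

theorem intervalIntegrable_jetOp (h : CoeffBounds M T n r a b c d) {f : ℝ → CircleL2 M} {E : ℝ}
    (hf : AEStronglyMeasurable f (volume.restrict (Icc 0 T)))
    (hE : ∀ᵐ s ∂volume.restrict (Icc 0 T), ‖f s‖ ≤ E) :
    IntervalIntegrable (fun s => jetOp M n 0 (f s)) volume 0 T := by
  refine intervalIntegrable_of_bound (B := ‖jetOp M n 0‖ * E) h.T_pos.le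
    ((jetOp M n 0).continuous.comp_aestronglyMeasurable hf) ?_
  filter_upwards [hE] with s hs
  exact ((jetOp M n 0).le_opNorm _).trans (by gcongr)

/-- Uniqueness, for functions which are only bounded and measurable in time. -/
theorem integral_fieldOp_eq_zero (h : CoeffBounds M T n r a b c d) {z : ℝ → CircleL2 M} {B : ℝ}
    (hz : AEStronglyMeasurable z (volume.restrict (Icc 0 T)))
    (hB : ∀ᵐ s ∂volume.restrict (Icc 0 T), ‖z s‖ ≤ B)
    (heq : ∀ᵐ t ∂volume.restrict (Icc 0 T),
      jetOp M n 0 (z t) = ∫ s in (0 : ℝ)..t, fieldOp M n a b c d s (z s)) {t : ℝ}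
    (ht : t ∈ Icc 0 T) : ∫ s in (0 : ℝ)..t, fieldOp M n a b c d s (z s) = 0 := by
  have hn := h.four_le
  have hr := h.pos_r
  have hWpos := weightBound_pos r
  have hint := h.intervalIntegrable_fieldOp hz hB
  obtain ⟨G, hG⟩ := isCompact_Icc.exists_bound_of_continuousOn h.continuousOn_genAt
  -- `y` is the unknown itself rather than its image under (1 + ∂ₓ)ⁿ. It is Lipschitz in time with
  -- values in L², so the energy argument applies at level 0, although `z` is only measurable.
  set y : ℝ → CircleL2 M := fun t => toL2 (∫ s in (0 : ℝ)..t, fieldOp M n a b c d s (z s)) with hy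
  have hy' : ∀ t ∈ Icc 0 T, y t = 0 + ∫ s in (0 : ℝ)..t, (genAt M n a b c d s (z s) + 0) := by
    intro t ht
    simp only [hy, zero_add, add_zero]
    rw [← toL2.intervalIntegral_comp_comm (intervalIntegrable_of_mem ht hint)]
    simp only [toL2_fieldOp hn]
  have hmeas : AEStronglyMeasurable (fun s => genAt M n a b c d s (z s) + 0)
      (volume.restrict (Icc 0 T)) := by
    simpa only [add_zero, toL2_fieldOp hn] using
      toL2.continuous.comp_aestronglyMeasurable (h.aestronglyMeasurable_fieldOp hz)
  have hbd : ∀ᵐ s ∂volume.restrict (Icc 0 T),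
      ‖genAt M n a b c d s (z s) + 0‖ ≤ G * B := by
    filter_upwards [hB, ae_restrict_mem measurableSet_Icc] with s hs hsI
    rw [add_zero]
    have hG0 := (norm_nonneg _).trans (hG s hsI)
    exact (ContinuousLinearMap.le_of_opNorm_le _ (hG s hsI) _).trans (by gcongr)
  have hq : ∀ᵐ s ∂volume.restrict (Icc 0 T),
      (inner ℂ (mulOp (weight M 0 a b s) (y s)) (genAt M n a b c d s (z s))).re
        ≤ (30 * weightBound r * r ^ 8 + weightBound r * r) * ‖y s‖ ^ 2 := by
    -- At almost every time `y` agrees with (1 + ∂ₓ)⁻ⁿ`z`, which has enough derivatives for the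
    -- weighted estimate; the Gronwall argument needs no more than almost every time.
    filter_upwards [heq, ae_restrict_mem measurableSet_Icc] with s hs hsI
    have hc := h.coeffAt hsI
    have hw := h.weightAt (Nat.zero_le n) hsI
    have hY : IsChain 3 (fun j => jetOp M n j (z s)) := fun j hj => isDeriv_jetOp (by omega) _
    have e : y s = toL2 (jetOp M n 0 (z s)) := by rw [hs]
    have k1 := hc.re_inner_weight_le (Nat.zero_le n) hw hY
    have k2 : (inner ℂ (mulOp (weight M 0 a b s) (y s)) (mulOp (jet M d s 0) (y s))).re
        ≤ weightBound r * r * ‖y s‖ ^ 2 := by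
      refine (Complex.re_le_norm _).trans ((norm_inner_le_norm _ _).trans ?_)
      calc _ ≤ (weightBound r * ‖y s‖) * (r * ‖y s‖) :=
            mul_le_mul (norm_mulOp_apply_le hw.bd _)
              (norm_mulOp_apply_le (hc.bdD 0 (Nat.zero_le n)) _) (norm_nonneg _) (by positivity)
        _ = _ := by ring
    have e2 : genAt M n a b c d s (z s)
        = toL2 (jet M a s 0 * jetOp M n 3 (z s)
          + secondCoeff 0 (jet M a s) (jet M b s) 0 * jetOp M n 2 (z s)
          + firstCoeff 0 (jet M a s) (jet M b s) (jet M c s) 0 * jetOp M n 1 (z s))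
          + mulOp (jet M d s 0) (y s) := by
      rw [e, mulOp_toL2, ← map_add, ← toL2_fieldOp hn, fieldOp_apply]
      simp only [secondCoeff, firstCoeff, Nat.cast_zero, zero_smul, zero_add, add_zero, sub_zero,
        Nat.choose_zero_succ]
    rw [e2, inner_add_right, Complex.add_re]
    rw [← e] at k1
    linarith
  have key := (h.isWeight (Nat.zero_le n)).energy_le h.T_pos.le (E := 0) (f := fun _ => 0)
    (by positivity) hmeas hbd hq (Eventually.of_forall fun _ => by simp) hy' ht
  have hle : (inner ℂ (mulOp (weight M 0 a b t) (y t)) (y t)).re ≤ 0 := by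
    refine key.trans (le_of_eq ?_)
    have hy0 : y 0 = 0 := by simp only [hy, intervalIntegral.integral_same, map_zero]
    simp only [hy0, inner_zero_right, Complex.zero_re]
    ring
  have h0 := (h.isWeight (Nat.zero_le n)).norm_sq_le ht hle
  rw [zero_div, Real.sqrt_zero] at h0
  refine toL2_injective ?_
  rw [map_zero]
  exact norm_le_zero_iff.1 h0

theorem eq_of_isEvolution (h : CoeffBounds M T n r a b c d) {f v w : ℝ → CircleL2 M} {E : ℝ}
    (hf : AEStronglyMeasurable f (volume.restrict (Icc 0 T)))
    (hE : ∀ᵐ s ∂volume.restrict (Icc 0 T), ‖f s‖ ≤ E)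
    (hv : IsEvolution M T n a b c d f v) (hw : IsEvolution M T n a b c d f w)
    (h0 : v 0 = w 0) {t : ℝ} (ht : t ∈ Icc 0 T) : v t = w t := by
  obtain ⟨B, hB⟩ := hv.bounded
  obtain ⟨B', hB'⟩ := hw.bounded
  have aeB : ∀ᵐ s ∂volume.restrict (Icc 0 T), ‖v s‖ ≤ B :=
    (ae_restrict_iff' measurableSet_Icc).2 (Eventually.of_forall hB)
  have aeB' : ∀ᵐ s ∂volume.restrict (Icc 0 T), ‖w s‖ ≤ B' :=
    (ae_restrict_iff' measurableSet_Icc).2 (Eventually.of_forall hB')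
  have hf' := h.intervalIntegrable_jetOp hf hE
  have hv' := h.intervalIntegrable_fieldOp hv.aestronglyMeasurable aeB
  have hw' := h.intervalIntegrable_fieldOp hw.aestronglyMeasurable aeB'
  have heq : ∀ t ∈ Icc 0 T, jetOp M n 0 (v t - w t)
      = ∫ s in (0 : ℝ)..t, fieldOp M n a b c d s (v s - w s) := by
    intro t ht
    simp only [map_sub]
    rw [hv.eq t ht, hw.eq t ht, h0, add_sub_add_left_eq_sub,
      ← intervalIntegral.integral_sub (intervalIntegrable_of_mem ht (hv'.add hf'))
        (intervalIntegrable_of_mem ht (hw'.add hf'))]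
    simp only [add_sub_add_right_eq_sub]
  have h1 := h.integral_fieldOp_eq_zero (z := fun s => v s - w s) (B := B + B')
    (hv.aestronglyMeasurable.sub hw.aestronglyMeasurable)
    (by
      filter_upwards [aeB, aeB'] with s hs hs'
      exact (norm_sub_le _ _).trans (add_le_add hs hs'))
    ((ae_restrict_iff' measurableSet_Icc).2 (Eventually.of_forall heq)) ht
  rw [← heq t ht] at h1
  have h2 : ∀ k, fc (v t - w t) k = 0 := fun k => by
    have := fc_jetOp_zero (show 0 < n by linarith [h.four_le]) (v t - w t) k
    rw [h1, map_zero, fc_eq_inner, inner_zero_right] at this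
    exact (mul_eq_zero.1 this.symm).resolve_left
      (pow_ne_zero _ (inv_ne_zero (symb_ne_zero k)))
  refine sub_eq_zero.1 (fc_ext fun k => ?_)
  rw [h2, fc_eq_inner, inner_zero_right]

omit hM in
theorem energyRate_nonneg (h : CoeffBounds M T n r a b c d) : 0 ≤ energyRate r := by
  have := h.pos_r
  have := h.energyConst_nonneg
  have := weightBound_pos r
  unfold energyRate weightLip
  positivity

/-- The mode-by-mode equation of the Galerkin limit becomes an integral equation in the continuous
functions, where the generator after (1 + ∂ₓ)⁻ⁿ is bounded. The energy bound yields both the growth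
estimate and strong continuity at the initial time. -/
theorem exists_isEvolution (h : CoeffBounds M T n r a b c d) {E : ℝ} (hE0 : 0 ≤ E)
    {f : ℝ → CircleL2 M}
    (hf : AEStronglyMeasurable f (volume.restrict (Icc 0 T)))
    (hfE : ∀ᵐ t ∂volume.restrict (Icc 0 T), ‖f t‖ ≤ E)
    (hJf : ∀ᵐ t ∂volume.restrict (Icc 0 T), conjOp (f t) = f t) (w₀ : CircleL2 M)
    (hJw : conjOp w₀ = w₀) :
    ∃ w : ℝ → CircleL2 M, w 0 = w₀ ∧ IsEvolution M T n a b c d f w ∧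
      (∀ t ∈ Icc 0 T, ‖w t‖ ≤ growthConst r * (‖w₀‖ + E)) ∧
      Tendsto w (𝓝[Icc 0 T] 0) (𝓝 w₀) := by
  have hn := h.four_le
  have hr := h.pos_r
  have hW := weightBound_pos r
  have h00 : (0 : ℝ) ∈ Icc 0 T := ⟨le_rfl, h.T_pos.le⟩
  have hR := h.isWeight (le_refl n)
  obtain ⟨w, h0, hJ, hc, hL, hen⟩ := h.exists_evolution hf hfE hJf w₀ hJw
  have hbd : ∀ t ∈ Icc 0 T, ‖w t‖ ≤ growthConst r * (‖w₀‖ + E) := by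
    intro t ht
    have e1 : (inner ℂ (mulOp (weight M n a b t) (w t)) (w t)).re
        ≤ Real.exp (energyRate r * r) * (weightBound r * (1 + r)) * (‖w₀‖ + E) ^ 2 := by
      refine (hen t ht).trans ?_
      have e2 := hR.inner_le h00 w₀
      have e3 : t ≤ r := ht.2.trans h.T_le
      have e4 := h.energyRate_nonneg
      have e5 := norm_nonneg w₀
      -- This is the excess of W(1 + r)(‖w₀‖ + E)² over W‖w₀‖² + W E² r, with W = `weightBound r`.
      have e6 : 0 ≤ weightBound r * (r * ‖w₀‖ ^ 2 + 2 * (1 + r) * ‖w₀‖ * E + E ^ 2) := by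
        positivity
      have e7 : weightBound r * E ^ 2 * t ≤ weightBound r * E ^ 2 * r := by gcongr
      calc _ ≤ Real.exp (energyRate r * t)
            * (weightBound r * (1 + r) * (‖w₀‖ + E) ^ 2) := by
            gcongr
            nlinarith
        _ ≤ Real.exp (energyRate r * r) * (weightBound r * (1 + r) * (‖w₀‖ + E) ^ 2) := by
            gcongr
        _ = _ := by ring
    refine (hR.norm_sq_le ht e1).trans (le_of_eq ?_)
    rw [growthConst, ← Real.sqrt_sq (show 0 ≤ ‖w₀‖ + E by positivity), ← Real.sqrt_mul (by positivity),
      Real.sqrt_sq (show 0 ≤ ‖w₀‖ + E by positivity)]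
    congr 1
    field_simp
  have hcont : ∀ k, ContinuousOn (fun t => fc (w t) k) (Icc 0 T) := fun k =>
    continuousOn_of_lipschitz (hL k).choose_spec
  have hmeas : AEStronglyMeasurable w (volume.restrict (Icc 0 T)) :=
    aestronglyMeasurable_of_fc fun k => (hcont k).aemeasurable measurableSet_Icc
  have aeB := (ae_restrict_iff' (μ := volume) measurableSet_Icc).2 (Eventually.of_forall hbd)
  have hint := (h.intervalIntegrable_fieldOp hmeas aeB).add (h.intervalIntegrable_jetOp hf hfE)
  refine ⟨w, h0, ⟨hJ, ⟨_, hbd⟩, hcont, fun t ht => ?_⟩, hbd, ?_⟩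
  -- Fourier coefficients determine a continuous function, and the equation for mode k is the
  -- Galerkin one divided by the n-th power of the symbol.
  · refine toL2_injective (fc_ext fun k => ?_)
    have hL2 := ((innerSL ℂ (fourierBasis (T := M) k)).comp toL2).intervalIntegral_comp_comm
      (intervalIntegrable_of_mem ht hint)
    simp only [ContinuousLinearMap.comp_apply, innerSL_apply_apply, ← fc_eq_inner] at hL2
    rw [map_add, fc_add, ← hL2, fc_jetOp_zero (by omega), fc_jetOp_zero (by omega), hc k t ht, h0,
      mul_add, ← intervalIntegral.integral_const_mul]
    congr 1
    refine intervalIntegral.integral_congr fun s _ => ?_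
    simp only [map_add, fc_add, toL2_fieldOp hn, fc_jetOp_zero (show 0 < n by omega)]
    rw [mul_add, ← mul_assoc, ← mul_pow, inv_mul_cancel₀ (symb_ne_zero k), one_pow, one_mul]
  -- Continuity and boundedness of the coefficients give weak convergence to w₀. With the weight
  -- frozen at time 0, the energy bound, up to an error of size t, gives limsup ⟨R₀w, w⟩ ≤ ⟨R₀w₀,
  -- w₀⟩. Expanding ⟨R₀(w - w₀), w - w₀⟩ and using coercivity then gives strong convergence.
  · set R := fun t => mulOp (weight M n a b t) with hRdef
    set B := growthConst r * (‖w₀‖ + E) with hBdef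
    have hmem : ∀ᶠ t in 𝓝[Icc 0 T] (0 : ℝ), t ∈ Icc 0 T := self_mem_nhdsWithin
    have hweak : ∀ v : CircleL2 M, Tendsto (fun t => inner ℂ v (w t)) (𝓝[Icc 0 T] 0)
        (𝓝 (inner ℂ v w₀)) := fun v =>
      tendsto_inner_of_coeff fourierBasis (B := B) (hmem.mono fun t ht => hbd t ht)
        (fun k => by
          have := (hcont k 0 h00).tendsto
          simpa only [← fc_eq_inner, h0] using this) tendsto_const_nhds
    have hid : ∀ t, (inner ℂ (R 0 (w t - w₀)) (w t - w₀)).re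
        = (inner ℂ (R 0 (w t)) (w t)).re - 2 * (inner ℂ (R 0 w₀) (w t)).re
          + (inner ℂ (R 0 w₀) w₀).re := by
      intro t
      have e1 : (inner ℂ (R 0 (w t)) w₀).re = (inner ℂ (R 0 w₀) (w t)).re := by
        rw [hR.symm 0 h00, ← inner_conj_symm, Complex.conj_re]
      rw [map_sub, inner_sub_left, inner_sub_right, inner_sub_right]
      simp only [Complex.sub_re, e1]
      ring
    have hup : ∀ t ∈ Icc 0 T, (inner ℂ (R 0 (w t)) (w t)).re
        ≤ Real.exp (energyRate r * t) * ((inner ℂ (R 0 w₀) w₀).re + weightBound r * E ^ 2 * t)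
          + weightLip r * |t - 0| * B * B := by
      intro t ht
      have e1 : (inner ℂ (R 0 (w t)) (w t)).re
          = (inner ℂ (R t (w t)) (w t)).re - (inner ℂ ((R t - R 0) (w t)) (w t)).re := by
        rw [_root_.sub_apply, inner_sub_left, Complex.sub_re]; ring
      have e2 : |(inner ℂ ((R t - R 0) (w t)) (w t)).re| ≤ weightLip r * |t - 0| * B * B := by
        refine (Complex.abs_re_le_norm _).trans ((norm_inner_le_norm _ _).trans ?_)
        have k1 := ContinuousLinearMap.le_of_opNorm_le _ (hR.lipschitz 0 h00 t ht) (w t)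
        have k2 := hbd t ht
        have k3 := hR.L_nonneg
        have k4 : 0 ≤ B := (norm_nonneg _).trans k2
        calc _ ≤ (weightLip r * |t - 0| * ‖w t‖) * ‖w t‖ := by gcongr
          _ ≤ _ := by gcongr
      have := hen t ht
      have := neg_abs_le (inner ℂ ((R t - R 0) (w t)) (w t)).re
      linarith
    have hlim : Tendsto (fun t => (Real.exp (energyRate r * t)
        * ((inner ℂ (R 0 w₀) w₀).re + weightBound r * E ^ 2 * t)
          + weightLip r * |t - 0| * B * B) - 2 * (inner ℂ (R 0 w₀) (w t)).re
          + (inner ℂ (R 0 w₀) w₀).re) (𝓝[Icc 0 T] 0) (𝓝 0) := by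
      have c1 : Tendsto (fun t : ℝ => Real.exp (energyRate r * t)
          * ((inner ℂ (R 0 w₀) w₀).re + weightBound r * E ^ 2 * t)
          + weightLip r * |t - 0| * B * B) (𝓝[Icc 0 T] 0) (𝓝 (inner ℂ (R 0 w₀) w₀).re) := by
        have : Continuous fun t : ℝ => Real.exp (energyRate r * t)
          * ((inner ℂ (R 0 w₀) w₀).re + weightBound r * E ^ 2 * t)
          + weightLip r * |t - 0| * B * B := by fun_prop
        exact (this.tendsto' 0 _ (by simp)).mono_left nhdsWithin_le_nhds
      have c2 : Tendsto (fun t => 2 * (inner ℂ (R 0 w₀) (w t)).re) (𝓝[Icc 0 T] 0)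
          (𝓝 (2 * (inner ℂ (R 0 w₀) w₀).re)) := ((Complex.continuous_re.tendsto _).comp (hweak (R 0 w₀))).const_mul 2
      have := (c1.sub c2).add_const (inner ℂ (R 0 w₀) w₀).re
      rwa [show (inner ℂ (R 0 w₀) w₀).re - 2 * (inner ℂ (R 0 w₀) w₀).re
        + (inner ℂ (R 0 w₀) w₀).re = 0 by ring] at this
    have hsq : Tendsto (fun t => ‖w t - w₀‖ ^ 2) (𝓝[Icc 0 T] 0) (𝓝 0) := by
      have hlim' := hlim.const_mul (weightBound r)
      rw [mul_zero] at hlim'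
      refine squeeze_zero' (Eventually.of_forall fun t => sq_nonneg _) ?_ hlim'
      filter_upwards [hmem] with t ht
      have e1 := hR.coercive 0 h00 (w t - w₀)
      have e2 := hup t ht
      rw [hid t, inv_mul_le_iff₀ hW] at e1
      refine e1.trans ?_
      gcongr
    rw [tendsto_iff_norm_sub_tendsto_zero]
    have := hsq.sqrt
    simpa only [Real.sqrt_sq (norm_nonneg _), Real.sqrt_zero] using this

end CoeffBounds

end Evolution

/-! ### Solutions as functions and as elements of `L²` -/

section Correspondence

variable {M T r : ℝ} {n : ℕ} {a b c d e : ℝ → ℝ → ℝ} [hM : Fact (0 < M)]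

theorem MemLinftyH.aestronglyMeasurable_sob {u : ℝ → ℝ → ℝ} (hu : MemLinftyH M T n u) :
    AEStronglyMeasurable (fun t => sob M n (u t)) (volume.restrict (Icc 0 T)) := by
  refine aestronglyMeasurable_of_fc fun k => ((hu.aemeasurable k).const_mul (symb M k ^ n)).congr ?_
  filter_upwards [hu.ae_mem] with t ht
  exact (fc_sob ht.summable k).symm

omit hM in
theorem normH_nonneg (M s : ℝ) (f : ℝ → ℝ) : 0 ≤ normH M s f := Real.sqrt_nonneg _

omit hM in
theorem MemLinftyH.normH_le {s : ℝ} {u : ℝ → ℝ → ℝ} (hu : MemLinftyH M T s u) :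
    ∀ᵐ t ∂volume.restrict (Icc 0 T), normH M s (u t) ≤ normLinftyH M T s u := by
  have h := ae_le_eLpNormEssSup (μ := volume.restrict (Icc 0 T)) (f := fun t => normH M s (u t))
  filter_upwards [h] with t ht
  rw [← eLpNorm_exponent_top] at ht
  have h1 := ENNReal.toReal_mono hu.bounded.ne ht
  rw [toReal_enorm, Real.norm_of_nonneg (normH_nonneg _ _ _)] at h1
  exact h1

omit hM in
theorem normLinftyH_le {s B : ℝ} (hT : 0 < T) {u : ℝ → ℝ → ℝ}
    (h : ∀ t ∈ Icc 0 T, normH M s (u t) ≤ B) :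
    eLpNorm (fun t => normH M s (u t)) ⊤ (volume.restrict (Icc 0 T)) < ⊤
      ∧ normLinftyH M T s u ≤ B := by
  have hB : 0 ≤ B := (Real.sqrt_nonneg _).trans (h 0 ⟨le_rfl, hT.le⟩)
  have hae : ∀ᵐ t ∂volume.restrict (Icc 0 T), ‖normH M s (u t)‖ ≤ B := by
    filter_upwards [ae_restrict_mem measurableSet_Icc] with t ht
    rw [Real.norm_of_nonneg (normH_nonneg _ _ _)]
    exact h t ht
  rw [normLinftyH, eLpNorm_exponent_top]
  exact ⟨eLpNormEssSup_lt_top_of_ae_bound hae,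
    ENNReal.toReal_le_of_le_ofReal hB (eLpNormEssSup_le_of_ae_bound hae)⟩

theorem MemLinftyH.norm_sob_le {u : ℝ → ℝ → ℝ} (hu : MemLinftyH M T n u) :
    ∀ᵐ t ∂volume.restrict (Icc 0 T), ‖sob M n (u t)‖ ≤ normLinftyH M T n u / Real.sqrt M := by
  filter_upwards [hu.normH_le, hu.ae_mem] with t h1 h2
  rw [normH_eq h2.summable] at h1
  rwa [le_div_iff₀' (Real.sqrt_pos.2 hM.out)]

omit hM in
theorem jet_apply {k : ℕ} {f : ℝ → ℝ → ℝ} (hf : MemCC M T k f) {t : ℝ} (ht : t ∈ Icc 0 T) (x : ℝ) :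
    jet M f t 0 (x : AddCircle M) = f t x := by
  rw [jet, iteratedDeriv_zero, toC_apply (hf.continuous_self ht) (hf.periodic t ht)]

theorem CoeffBounds.rhs_eq (h : CoeffBounds M T n r a b c d) {u : ℝ → ℝ → ℝ} {t : ℝ}
    (ht : t ∈ Icc 0 T) (hu : MemH M n (u t)) (he : MemH M n (e t)) (x : ℝ) :
    (rhs a b c d e u t x : ℂ) = (fieldOp M n a b c d t (sob M n (u t))
      + jetOp M n 0 (sob M n (e t))) (x : AddCircle M) := by
  have hn := h.four_le
  have hv := conjOp_sob (M := M) n (u t)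
  obtain ⟨v, hv'⟩ : ∃ v, v = sob M n (u t) := ⟨_, rfl⟩
  have hp : u t = profile n v := by rw [hv', profile_sob (by omega) hu]
  rw [← hv'] at hv ⊢
  have hj : ∀ j < n, ((iteratedDeriv j (u t) x : ℝ) : ℂ) = jetOp M n j v (x : AddCircle M) := by
    intro j hj
    rw [hp, iteratedDeriv_profile hj, ofReal_re_jetOp hj hv]
  rw [ContinuousMap.add_apply, ← ofReal_eq_jetOp_sob (by omega) he, fieldOp_apply,
    ContinuousMap.add_apply, ContinuousMap.add_apply, ContinuousMap.add_apply,
    ContinuousMap.mul_apply, ContinuousMap.mul_apply, ContinuousMap.mul_apply,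
    ContinuousMap.mul_apply, jet_apply h.a_mem ht, jet_apply h.b_mem ht, jet_apply h.c_mem ht,
    jet_apply h.d_mem ht, ← hj 3 (by omega), ← hj 2 (by omega), ← hj 1 (by omega),
    ← hj 0 (by omega), iteratedDeriv_one, iteratedDeriv_zero, rhs]
  push_cast
  ring

theorem CoeffBounds.intervalIntegrable_field (h : CoeffBounds M T n r a b c d)
    (he : MemLinftyH M T n e) {v : ℝ → CircleL2 M} {B : ℝ}
    (hv : AEStronglyMeasurable v (volume.restrict (Icc 0 T)))
    (hB : ∀ᵐ s ∂volume.restrict (Icc 0 T), ‖v s‖ ≤ B) :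
    IntervalIntegrable (fun s => fieldOp M n a b c d s (v s) + jetOp M n 0 (sob M n (e s)))
      volume 0 T :=
  (h.intervalIntegrable_fieldOp hv hB).add
    (h.intervalIntegrable_jetOp he.aestronglyMeasurable_sob he.norm_sob_le)

omit hM in
theorem ae_uIoc_of_ae {p : ℝ → Prop} (h : ∀ᵐ s ∂volume.restrict (Icc 0 T), p s) {t : ℝ}
    (ht : t ∈ Icc 0 T) : ∀ᵐ s ∂volume.restrict (uIoc 0 t), p s := by
  refine ae_mono (Measure.restrict_mono_set _ ?_) h
  rw [uIoc_of_le ht.1]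
  exact fun s hs => ⟨hs.1.le, hs.2.trans ht.2⟩

theorem ofReal_integral_rhs (h : CoeffBounds M T n r a b c d) (he : MemLinftyH M T n e)
    {u : ℝ → ℝ → ℝ} (hu : MemLinftyH M T n u) {t : ℝ} (ht : t ∈ Icc 0 T) (x : ℝ) :
    ((∫ s in (0 : ℝ)..t, rhs a b c d e u s x : ℝ) : ℂ)
      = (∫ s in (0 : ℝ)..t, (fieldOp M n a b c d s (sob M n (u s))
        + jetOp M n 0 (sob M n (e s)))) (x : AddCircle M) := by
  have hint := h.intervalIntegrable_field he hu.aestronglyMeasurable_sob hu.norm_sob_le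
  have hcomm := (ContinuousMap.evalCLM ℂ (x : AddCircle M)).intervalIntegral_comp_comm
    (intervalIntegrable_of_mem ht hint)
  rw [← intervalIntegral.integral_ofReal]
  refine Eq.trans (intervalIntegral.integral_congr_ae_restrict ?_) hcomm
  filter_upwards [ae_uIoc_of_ae hu.ae_mem ht, ae_uIoc_of_ae he.ae_mem ht,
    ae_uIoc_of_ae (ae_restrict_mem measurableSet_Icc) ht] with s h1 h2 h3
  exact h.rhs_eq h3 h1 h2 x

omit hM in
theorem intervalIntegrable_clm {𝕜 E F : Type*} [NontriviallyNormedField 𝕜] [NormedAddCommGroup E]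
    [NormedSpace 𝕜 E] [NormedAddCommGroup F] [NormedSpace 𝕜 F] (L : E →L[𝕜] F) {f : ℝ → E} {s t : ℝ}
    (hf : IntervalIntegrable f volume s t) : IntervalIntegrable (fun x => L (f x)) volume s t :=
  ⟨L.integrable_comp hf.1, L.integrable_comp hf.2⟩

theorem intervalIntegrable_rhs (h : CoeffBounds M T n r a b c d) (he : MemLinftyH M T n e)
    {u : ℝ → ℝ → ℝ} (hu : MemLinftyH M T n u) (x : ℝ) :
    IntervalIntegrable (fun s => rhs a b c d e u s x) volume 0 T := by
  have hint := h.intervalIntegrable_field he hu.aestronglyMeasurable_sob hu.norm_sob_le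
  have hT : T ∈ Icc 0 T := ⟨h.T_pos.le, le_rfl⟩
  have h1 : IntervalIntegrable (fun s => Complex.reCLM
      ((ContinuousMap.evalCLM ℂ (x : AddCircle M)) (fieldOp M n a b c d s (sob M n (u s))
        + jetOp M n 0 (sob M n (e s))))) volume 0 T := by
    have h2 : IntervalIntegrable (fun s =>
      (ContinuousMap.evalCLM ℂ (x : AddCircle M)) (fieldOp M n a b c d s (sob M n (u s))
        + jetOp M n 0 (sob M n (e s)))) volume 0 T :=
      intervalIntegrable_clm (ContinuousMap.evalCLM ℂ (x : AddCircle M)) hint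
    exact intervalIntegrable_clm Complex.reCLM h2
  refine h1.congr_ae ?_
  filter_upwards [ae_uIoc_of_ae hu.ae_mem hT, ae_uIoc_of_ae he.ae_mem hT,
    ae_uIoc_of_ae (ae_restrict_mem measurableSet_Icc) hT] with s k1 k2 k3
  have := congrArg Complex.re (h.rhs_eq (e := e) k3 k1 k2 x)
  rw [Complex.ofReal_re] at this
  exact this.symm

theorem IsEvolution.isSolution (h : CoeffBounds M T n r a b c d) (he : MemLinftyH M T n e)
    {w : ℝ → CircleL2 M} (hw : IsEvolution M T n a b c d (fun s => sob M n (e s)) w) :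
    IsSolution M T n a b c d e (fun t => profile n (w t)) := by
  have hn : 0 < n := by linarith [h.four_le]
  have h00 : (0 : ℝ) ∈ Icc 0 T := ⟨le_rfl, h.T_pos.le⟩
  obtain ⟨B, hB⟩ := hw.bounded
  have hmem : MemLinftyH M T n (fun t => profile n (w t)) := by
    refine ⟨fun k => ?_, ?_, ?_⟩
    · refine (((hw.continuous k).aemeasurable measurableSet_Icc).const_mul
        ((symb M k)⁻¹ ^ n)).congr ?_
      filter_upwards [ae_restrict_mem measurableSet_Icc] with t ht
      exact (coeff_profile hn (hw.real t ht) k).symm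
    · filter_upwards [ae_restrict_mem measurableSet_Icc] with t ht
      exact memH_profile hn (hw.real t ht)
    · refine (normLinftyH_le (B := Real.sqrt M * B) h.T_pos fun t ht => ?_).1
      rw [normH_profile hn (hw.real t ht)]
      have := hB t ht
      gcongr
  refine ⟨hmem, intervalIntegrable_rhs h he hmem, fun t ht x => ?_⟩
  have e1 := DFunLike.congr_fun (hw.eq t ht) (x : AddCircle M)
  have e2 := ofReal_integral_rhs h he hmem ht x
  have e3 : ∫ s in (0 : ℝ)..t, (fieldOp M n a b c d s (sob M n (profile n (w s)))
        + jetOp M n 0 (sob M n (e s)))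
      = ∫ s in (0 : ℝ)..t, (fieldOp M n a b c d s (w s) + jetOp M n 0 (sob M n (e s))) := by
    refine intervalIntegral.integral_congr fun s hs => ?_
    rw [uIcc_of_le ht.1] at hs
    simp only [sob_profile hn (hw.real s ⟨hs.1, hs.2.trans ht.2⟩)]
  rw [e3] at e2
  rw [ContinuousMap.add_apply, ← e2] at e1
  have e4 := congrArg Complex.re e1
  rwa [Complex.add_re, Complex.ofReal_re] at e4

/-- A solution is known to lie in Hⁿ only for almost every time. The difference from `profile n (w
t)` is nevertheless, at every time, the integral of the generator applied to an almost everywhere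
defined element of L², and uniqueness makes that integral vanish for all t. -/
theorem IsSolution.eq_profile (h : CoeffBounds M T n r a b c d) (he : MemLinftyH M T n e)
    {v : ℝ → ℝ → ℝ} (hv : IsSolution M T n a b c d e v) {w : ℝ → CircleL2 M}
    (hw : IsEvolution M T n a b c d (fun s => sob M n (e s)) w)
    (h0 : ∀ x, v 0 x = profile n (w 0) x) {t : ℝ} (ht : t ∈ Icc 0 T) (x : ℝ) :
    v t x = profile n (w t) x := by
  have hn : 0 < n := by linarith [h.four_le]
  have h00 : (0 : ℝ) ∈ Icc 0 T := ⟨le_rfl, h.T_pos.le⟩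
  obtain ⟨B, hB⟩ := hw.bounded
  have aeB : ∀ᵐ s ∂volume.restrict (Icc 0 T), ‖w s‖ ≤ B :=
    (ae_restrict_iff' measurableSet_Icc).2 (Eventually.of_forall hB)
  have i1 := h.intervalIntegrable_field he hv.mem.aestronglyMeasurable_sob hv.mem.norm_sob_le
  have i2 := h.intervalIntegrable_field he hw.aestronglyMeasurable aeB
  have key : ∀ t ∈ Icc 0 T, ∀ x : ℝ, (v t x : ℂ) - jetOp M n 0 (w t) (x : AddCircle M)
      = (∫ s in (0 : ℝ)..t, fieldOp M n a b c d s (sob M n (v s) - w s)) (x : AddCircle M) := by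
    intro t ht x
    have e1 := congrArg (fun y : ℝ => (y : ℂ)) (hv.eq t ht x)
    simp only [Complex.ofReal_add] at e1
    have e2 : ∫ s in (0 : ℝ)..t, fieldOp M n a b c d s (sob M n (v s) - w s)
        = (∫ s in (0 : ℝ)..t, (fieldOp M n a b c d s (sob M n (v s))
          + jetOp M n 0 (sob M n (e s))))
          - ∫ s in (0 : ℝ)..t, (fieldOp M n a b c d s (w s) + jetOp M n 0 (sob M n (e s))) := by
      rw [← intervalIntegral.integral_sub (intervalIntegrable_of_mem ht i1)
        (intervalIntegrable_of_mem ht i2)]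
      simp only [add_sub_add_right_eq_sub, map_sub]
    have e3 : (v 0 x : ℂ) = jetOp M n 0 (w 0) (x : AddCircle M) := by
      rw [h0, profile, ofReal_re_jetOp hn (hw.real 0 h00)]
    rw [e1, ofReal_integral_rhs h he hv.mem ht, e2, hw.eq t ht, ContinuousMap.sub_apply,
      ContinuousMap.add_apply, e3]
    ring
  have hz := h.integral_fieldOp_eq_zero (z := fun s => sob M n (v s) - w s)
    (B := normLinftyH M T n v / Real.sqrt M + B)
    (hv.mem.aestronglyMeasurable_sob.sub hw.aestronglyMeasurable)
    (by
      filter_upwards [hv.mem.norm_sob_le, aeB] with s hs hs'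
      exact (norm_sub_le _ _).trans (add_le_add hs hs'))
    (by
      filter_upwards [hv.mem.ae_mem, ae_restrict_mem measurableSet_Icc] with s hs hs'
      refine toC_ext fun y => ?_
      rw [← key s hs' y, map_sub, ContinuousMap.sub_apply, ofReal_eq_jetOp_sob hn hs]) ht
  have e1 := key t ht x
  rw [hz, ContinuousMap.zero_apply, sub_eq_zero] at e1
  have e2 := congrArg Complex.re e1
  rwa [Complex.ofReal_re] at e2

/-- Existence, with the bounds and the continuity at the initial time. -/
theorem CoeffBounds.exists_solution (h : CoeffBounds M T n r a b c d) (he : MemLinftyH M T n e)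
    {u₀ : ℝ → ℝ} (hu : MemH M n u₀) :
    ∃ w : ℝ → CircleL2 M, w 0 = sob M n u₀ ∧
      IsEvolution M T n a b c d (fun s => sob M n (e s)) w ∧
      (∀ t ∈ Icc 0 T, normH M n (profile n (w t))
        ≤ growthConst r * (normH M n u₀ + normLinftyH M T n e)) ∧
      Tendsto w (𝓝[Icc 0 T] 0) (𝓝 (w 0)) := by
  have hn : 0 < n := by linarith [h.four_le]
  have hsM := Real.sqrt_pos.2 hM.out
  obtain ⟨w, h0, hw, hb, hl⟩ := h.exists_isEvolution
    (div_nonneg ENNReal.toReal_nonneg (Real.sqrt_nonneg M))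
    he.aestronglyMeasurable_sob he.norm_sob_le (Eventually.of_forall fun t => conjOp_sob n (e t))
    (sob M n u₀) (conjOp_sob n u₀)
  refine ⟨w, h0, hw, fun t ht => ?_, by rwa [h0]⟩
  rw [normH_profile hn (hw.real t ht), normH_eq hu.summable]
  calc _ ≤ Real.sqrt M * (growthConst r * (‖sob M n u₀‖
        + normLinftyH M T n e / Real.sqrt M)) := mul_le_mul_of_nonneg_left (hb t ht) hsM.le
    _ = _ := by
      rw [normLinftyH]
      field_simp

/-- By linearity, w plus the source-free evolution of v₀ - w₀ solves the equation of v, so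
uniqueness identifies it with v; the growth bound with E = 0 applies to the difference. -/
theorem CoeffBounds.norm_sub_le (h : CoeffBounds M T n r a b c d) (he : MemLinftyH M T n e)
    {v w : ℝ → CircleL2 M} (hv : IsEvolution M T n a b c d (fun s => sob M n (e s)) v)
    (hw : IsEvolution M T n a b c d (fun s => sob M n (e s)) w) {t : ℝ} (ht : t ∈ Icc 0 T) :
    ‖v t - w t‖ ≤ growthConst r * ‖v 0 - w 0‖ := by
  have h00 : (0 : ℝ) ∈ Icc 0 T := ⟨le_rfl, h.T_pos.le⟩
  obtain ⟨y, h0, hy, hb, -⟩ := h.exists_isEvolution (E := 0) le_rfl (f := fun _ => 0)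
    aestronglyMeasurable_const (by simp) (by simp) (v 0 - w 0)
    (by rw [map_sub, hv.real 0 h00, hw.real 0 h00])
  obtain ⟨B, hB⟩ := hy.bounded
  obtain ⟨B', hB'⟩ := hw.bounded
  have aeB : ∀ᵐ s ∂volume.restrict (Icc 0 T), ‖y s‖ ≤ B :=
    (ae_restrict_iff' measurableSet_Icc).2 (Eventually.of_forall hB)
  have aeB' : ∀ᵐ s ∂volume.restrict (Icc 0 T), ‖w s‖ ≤ B' :=
    (ae_restrict_iff' measurableSet_Icc).2 (Eventually.of_forall hB')
  have i1 := h.intervalIntegrable_fieldOp hy.aestronglyMeasurable aeB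
  have i2 := h.intervalIntegrable_field he hw.aestronglyMeasurable aeB'
  have hsum : IsEvolution M T n a b c d (fun s => sob M n (e s)) (fun t => w t + y t) := by
    refine ⟨fun t ht => by rw [map_add, hw.real t ht, hy.real t ht],
      ⟨B' + B, fun t ht => (norm_add_le _ _).trans (add_le_add (hB' t ht) (hB t ht))⟩,
      fun k => ?_, fun t ht => ?_⟩
    · simp only [fc_add]
      exact (hw.continuous k).add (hy.continuous k)
    · have e1 := hy.eq t ht
      simp only [map_zero, add_zero] at e1
      have e2 : ∫ s in (0 : ℝ)..t, (fieldOp M n a b c d s (w s + y s)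
          + jetOp M n 0 (sob M n (e s)))
          = (∫ s in (0 : ℝ)..t, (fieldOp M n a b c d s (w s) + jetOp M n 0 (sob M n (e s))))
            + ∫ s in (0 : ℝ)..t, fieldOp M n a b c d s (y s) := by
        rw [← intervalIntegral.integral_add (intervalIntegrable_of_mem ht i2)
          (intervalIntegrable_of_mem ht i1)]
        simp only [map_add, add_right_comm]
      rw [e2, map_add, map_add, hw.eq t ht, e1]
      abel
  have key := h.eq_of_isEvolution he.aestronglyMeasurable_sob he.norm_sob_le hv hsum
    (by simp only [h0, add_sub_cancel]) ht
  rw [key, add_sub_cancel_left]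
  simpa using hb t ht

end Correspondence

/-! ### Reflection in space and time -/

section Reflection

variable {M T t₀ : ℝ} {n k : ℕ} {a b c d e f u : ℝ → ℝ → ℝ}

theorem reflect_reflect (M t₀ : ℝ) (f : ℝ → ℝ → ℝ) : reflect M t₀ (reflect M t₀ f) = f := by
  funext t x; simp only [reflect, sub_sub_cancel]

theorem reflect_neg (M t₀ : ℝ) (f : ℝ → ℝ → ℝ) : reflect M t₀ (-f) = -reflect M t₀ f := rfl

theorem iteratedDeriv_reflect (j : ℕ) (f : ℝ → ℝ → ℝ) (t x : ℝ) :
    iteratedDeriv j (reflect M t₀ f t) x = (-1) ^ j * iteratedDeriv j (f (t₀ - t)) (M - x) :=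
  congrFun (iteratedDeriv_comp_const_sub j (f (t₀ - t)) M) x

/-- A space derivative of order j acquires (-1)ʲ. The signs put on b, d and e make all terms change
sign together, and this compensates the reversal of time. -/
theorem rhs_reflect (t x : ℝ) :
    rhs (reflect M t₀ a) (-reflect M t₀ b) (reflect M t₀ c) (-reflect M t₀ d) (-reflect M t₀ e)
      (reflect M t₀ u) t x = -rhs a b c d e u (t₀ - t) (M - x) := by
  simp only [rhs, ← iteratedDeriv_one, iteratedDeriv_reflect, Pi.neg_apply]
  simp only [reflect]
  ring

theorem sub_mem_Icc {t : ℝ} (ht : t ∈ Icc 0 t₀) : t₀ - t ∈ Icc 0 t₀ :=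
  ⟨by linarith [ht.2], by linarith [ht.1]⟩

theorem tendsto_sub_nhdsWithin {p q p' q' t : ℝ} (h1 : p' ≤ t₀ - q) (h2 : t₀ - p ≤ q') :
    Tendsto (fun τ => t₀ - τ) (𝓝[Icc p q] t) (𝓝[Icc p' q'] (t₀ - t)) :=
  tendsto_nhdsWithin_of_tendsto_nhds_of_eventually_within _
    ((continuous_const.sub continuous_id).tendsto t |>.mono_left nhdsWithin_le_nhds)
    (eventually_mem_nhdsWithin.mono fun τ hτ =>
      ⟨by linarith [hτ.2], by linarith [hτ.1]⟩)

theorem MemCC.congr {g : ℝ → ℝ → ℝ} (h : MemCC M T k f) (hfg : ∀ t ∈ Icc 0 T, f t = g t) :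
    MemCC M T k g where
  periodic t ht := hfg t ht ▸ h.periodic t ht
  contDiff t ht := hfg t ht ▸ h.contDiff t ht
  tendsto j hj t ht := by
    rw [← hfg t ht]
    intro v hv
    filter_upwards [h.tendsto j hj t ht v hv, self_mem_nhdsWithin] with τ h1 h2
    rwa [← hfg τ h2]

theorem MemCC.neg (h : MemCC M T k f) : MemCC M T k (-f) where
  periodic t ht x := by simp only [Pi.neg_apply, h.periodic t ht x]
  contDiff t ht := (h.contDiff t ht).neg
  tendsto j hj t ht := by
    have e : ∀ τ x, iteratedDeriv j ((-f) τ) x = -iteratedDeriv j (f τ) x := fun τ x =>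
      iteratedDeriv_neg j (f τ) x
    rw [Metric.tendstoUniformly_iff]
    simpa only [e, dist_neg_neg] using Metric.tendstoUniformly_iff.1 (h.tendsto j hj t ht)

theorem MemCC.reflect (h : MemCC M T k f) (hT : t₀ ≤ T) : MemCC M t₀ k (reflect M t₀ f) := by
  have hI : ∀ {t}, t ∈ Icc 0 t₀ → t₀ - t ∈ Icc 0 T := fun ht =>
    Icc_subset_Icc_right hT (sub_mem_Icc ht)
  refine ⟨fun t ht x => ?_, fun t ht => ?_, fun j hj t ht => ?_⟩
  · have := h.periodic _ (hI ht) (M - (x + M))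
    simp only [PeriodicDispersion.reflect]
    rw [← this]
    congr 1
    ring
  · exact (h.contDiff _ (hI ht)).comp (contDiff_const.sub contDiff_id)
  · rw [Metric.tendstoUniformly_iff]
    intro ε hε
    filter_upwards [(tendsto_sub_nhdsWithin (p' := 0) (q' := T) (by simp) (by simpa)).eventually
      (Metric.tendstoUniformly_iff.1 (h.tendsto j hj _ (hI ht)) ε hε)] with τ hτ x
    have := hτ (M - x)
    rw [iteratedDeriv_reflect, iteratedDeriv_reflect, Real.dist_eq, ← mul_sub, abs_mul, abs_pow,
      abs_neg, abs_one, one_pow, one_mul]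
    rwa [Real.dist_eq] at this

theorem TimeDerivMemCC.hasDerivWithinAt_reflect (h : TimeDerivMemCC M T k f) (hT : t₀ ≤ T) {t : ℝ}
    (ht : t ∈ Icc 0 t₀) (x : ℝ) : HasDerivWithinAt (fun τ => reflect M t₀ f τ x)
      (-timeDeriv T f (t₀ - t) (M - x)) (Icc 0 t₀) t := by
  have h1 := (h.differentiable (t₀ - t) (Icc_subset_Icc_right hT (sub_mem_Icc ht))
    (M - x)).hasDerivWithinAt
  have h2 : HasDerivWithinAt (fun τ : ℝ => t₀ - τ) (-1) (Icc 0 t₀) t := by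
    simpa using ((hasDerivAt_id t).const_sub t₀).hasDerivWithinAt
  have h3 := HasDerivWithinAt.comp t h1 h2
    (fun τ hτ => Icc_subset_Icc_right hT (sub_mem_Icc hτ))
  exact h3.congr_deriv (mul_neg_one _)

theorem TimeDerivMemCC.reflect (h : TimeDerivMemCC M T k f) (h0 : 0 < t₀) (hT : t₀ ≤ T) :
    TimeDerivMemCC M t₀ k (reflect M t₀ f) where
  differentiable _ ht x := (h.hasDerivWithinAt_reflect hT ht x).differentiableWithinAt
  memCC := (h.memCC.reflect hT).neg.congr fun t ht => funext fun x =>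
    ((h.hasDerivWithinAt_reflect hT ht x).derivWithin (uniqueDiffOn_Icc h0 t ht)).symm

theorem TimeDerivMemCC.neg (h : TimeDerivMemCC M T k f) (hT : 0 < T) :
    TimeDerivMemCC M T k (-f) where
  differentiable t ht x := (h.differentiable t ht x).neg
  memCC := h.memCC.neg.congr fun t ht => funext fun x =>
    ((h.differentiable t ht x).hasDerivWithinAt.neg.derivWithin (uniqueDiffOn_Icc hT t ht)).symm

theorem coeff_neg (f : ℝ → ℝ) (k : ℤ) : coeff M (-f) k = -coeff M f k := by
  simp only [coeff, Pi.neg_apply, Complex.ofReal_neg, neg_mul, intervalIntegral.integral_neg,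
    mul_neg]

theorem coeff_reflect (hM : 0 < M) (f : ℝ → ℝ) (k : ℤ) :
    coeff M (fun x => f (M - x)) k = coeff M f (-k) := by
  rw [coeff, coeff]
  congr 1
  have h := intervalIntegral.integral_comp_sub_left (a := 0) (b := M) (fun x => (f x : ℂ)
    * Complex.exp (-(2 * Real.pi * (-k : ℤ) * x / M : ℝ) * Complex.I)) M
  rw [sub_self, sub_zero] at h
  rw [← h]
  refine intervalIntegral.integral_congr fun x _ => ?_
  congr 1
  have hM' : (M : ℂ) ≠ 0 := Complex.ofReal_ne_zero.2 hM.ne'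
  -- Replacing x by M - x shifts the phase by k full turns.
  refine Complex.exp_eq_exp_iff_exists_int.2 ⟨-k, ?_⟩
  push_cast
  field_simp
  ring

theorem sobolevTerm_reflect (hM : 0 < M) (s : ℝ) (f : ℝ → ℝ) (k : ℤ) :
    sobolevTerm M s (fun x => f (M - x)) k = sobolevTerm M s f (Equiv.neg ℤ k) := by
  rw [sobolevTerm, sobolevTerm, coeff_reflect hM, Equiv.neg_apply]
  congr 4
  push_cast
  ring

theorem normH_reflect (hM : 0 < M) (s : ℝ) (f : ℝ → ℝ) :
    normH M s (fun x => f (M - x)) = normH M s f := by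
  simp only [normH, sobolevTerm_reflect hM]
  rw [(Equiv.neg ℤ).tsum_eq]

theorem sobolevTerm_neg (s : ℝ) (f : ℝ → ℝ) : sobolevTerm M s (-f) = sobolevTerm M s f := by
  funext k; rw [sobolevTerm, sobolevTerm, coeff_neg, norm_neg]

theorem measurePreserving_sub_left_restrict {p q : ℝ} :
    MeasurePreserving (fun x => p + q - x) (volume.restrict (Icc p q))
      (volume.restrict (Icc p q)) := by
  have h := (Measure.measurePreserving_sub_left (volume : Measure ℝ) (p + q)).restrict_preimage
    (measurableSet_Icc (a := p) (b := q))
  rwa [preimage_const_sub_Icc, add_sub_cancel_right, add_sub_cancel_left] at h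

theorem MemH.reflect (hM : 0 < M) {s : ℝ} {f : ℝ → ℝ} (h : MemH M s f) :
    MemH M s (fun x => f (M - x)) where
  periodic x := by
    have := h.periodic (M - (x + M))
    simp only
    rw [← this]
    congr 1
    ring
  memLp := by
    have e : (volume : Measure ℝ).restrict (Ioc 0 M) = volume.restrict (Icc 0 M) :=
      Measure.restrict_congr_set Ioc_ae_eq_Icc
    have h1 := h.memLp
    rw [e] at h1 ⊢
    have := h1.comp_measurePreserving (measurePreserving_sub_left_restrict (p := 0) (q := M))
    simp only [zero_add] at this
    exact this
  summable := by
    simp only [funext (sobolevTerm_reflect hM s f)]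
    exact (Equiv.neg ℤ).summable_iff.2 h.summable
  continuous hs := (h.continuous hs).comp (continuous_const.sub continuous_id)

theorem MemH.neg {s : ℝ} {f : ℝ → ℝ} (h : MemH M s f) : MemH M s (-f) where
  periodic x := by simp only [Pi.neg_apply, h.periodic x]
  memLp := h.memLp.neg
  summable := by rw [sobolevTerm_neg]; exact h.summable
  continuous hs := (h.continuous hs).neg

theorem MemLinftyH.neg {s : ℝ} (h : MemLinftyH M T s f) : MemLinftyH M T s (-f) where
  aemeasurable k := by
    simp only [Pi.neg_apply, coeff_neg]
    exact (h.aemeasurable k).neg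
  ae_mem := by filter_upwards [h.ae_mem] with t ht using ht.neg
  bounded := by
    simp only [normH, Pi.neg_apply, sobolevTerm_neg]
    exact h.bounded

theorem ae_reflect {p : ℝ → Prop} (hT : t₀ ≤ T) (h : ∀ᵐ t ∂volume.restrict (Icc 0 T), p t) :
    ∀ᵐ t ∂volume.restrict (Icc 0 t₀), p (t₀ - t) := by
  have h1 : ∀ᵐ t ∂volume.restrict (Icc 0 t₀), p t :=
    ae_mono (Measure.restrict_mono_set _ (Icc_subset_Icc_right hT)) h
  have := (measurePreserving_sub_left_restrict (p := 0) (q := t₀)).quasiMeasurePreserving.ae h1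
  simpa only [zero_add] using this

theorem MemLinftyH.reflect (hM : 0 < M) {s : ℝ} (h : MemLinftyH M T s f) (hT : t₀ ≤ T) :
    MemLinftyH M t₀ s (reflect M t₀ f) where
  aemeasurable k := by
    have h1 := (h.aemeasurable (-k)).mono_measure
      (Measure.restrict_mono_set volume (Icc_subset_Icc_right hT : Icc 0 t₀ ⊆ Icc 0 T))
    have h2 := h1.comp_quasiMeasurePreserving
      (measurePreserving_sub_left_restrict (p := 0) (q := t₀)).quasiMeasurePreserving
    refine h2.congr (Eventually.of_forall fun t => ?_)
    simp only [Function.comp_apply, zero_add]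
    exact (coeff_reflect hM _ k).symm
  ae_mem := by
    filter_upwards [ae_reflect hT h.ae_mem] with t ht using ht.reflect hM
  bounded := by
    rw [eLpNorm_exponent_top]
    refine eLpNormEssSup_lt_top_of_ae_bound (C := normLinftyH M T s f) ?_
    filter_upwards [ae_reflect hT h.normH_le] with t ht
    rw [Real.norm_of_nonneg (normH_nonneg _ _ _)]
    exact (normH_reflect hM s _).trans_le ht

theorem Admissible.reflect (hM : 0 < M) (h0 : 0 < t₀) (hT : t₀ ≤ T)
    (h : Admissible M T n a b c d e) :
    Admissible M t₀ n (reflect M t₀ a) (-reflect M t₀ b) (reflect M t₀ c) (-reflect M t₀ d)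
      (-reflect M t₀ e) where
  a_mem := h.a_mem.reflect hT
  a_time := h.a_time.reflect h0 hT
  b_mem := (h.b_mem.reflect hT).neg
  b_time := (h.b_time.reflect h0 hT).neg h0
  c_mem := h.c_mem.reflect hT
  d_mem := (h.d_mem.reflect hT).neg
  e_mem := (h.e_mem.reflect hM hT).neg
  nondegenerate := by
    obtain ⟨a₀, ha, hlow⟩ := h.nondegenerate
    exact ⟨a₀, ha, fun t ht x => hlow _ (Icc_subset_Icc_right hT (sub_mem_Icc ht)) _⟩

theorem avgDiffusion_reflect (t : ℝ) :
    avgDiffusion M (reflect M t₀ a) (-reflect M t₀ b) t = -avgDiffusion M a b (t₀ - t) := by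
  have h := intervalIntegral.integral_comp_sub_left (a := 0) (b := M)
    (fun y => b (t₀ - t) y / |a (t₀ - t) y|) M
  rw [sub_self, sub_zero] at h
  simp only [avgDiffusion, Pi.neg_apply, reflect, neg_div, intervalIntegral.integral_neg, h,
    mul_neg]

theorem avgDiffusion_reflect_eq_zero (hT : t₀ ≤ T)
    (h : ∀ t ∈ Icc 0 T, avgDiffusion M a b t = 0) :
    ∀ t ∈ Icc 0 t₀, avgDiffusion M (reflect M t₀ a) (-reflect M t₀ b) t = 0 := fun t ht => by
  rw [avgDiffusion_reflect, h _ (Icc_subset_Icc_right hT (sub_mem_Icc ht)), neg_zero]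

theorem IsSolution.restrict (h0 : 0 < t₀) (hT : t₀ ≤ T) (h : IsSolution M T n a b c d e u) :
    IsSolution M t₀ n a b c d e u where
  mem := by
    have hle := Measure.restrict_mono_set (volume : Measure ℝ) (Icc_subset_Icc_right hT : Icc 0 t₀ ⊆ Icc 0 T)
    exact ⟨fun k => (h.mem.aemeasurable k).mono_measure hle, ae_mono hle h.mem.ae_mem,
      (eLpNorm_mono_measure _ hle).trans_lt h.mem.bounded⟩
  integrable x := intervalIntegrable_of_mem ⟨h0.le, hT⟩ (h.integrable x)
  eq t ht x := h.eq t (Icc_subset_Icc_right hT ht) x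

theorem IsSolution.reflect (hM : 0 < M) (h0 : 0 < t₀) (h : IsSolution M t₀ n a b c d e u) :
    IsSolution M t₀ n (reflect M t₀ a) (-reflect M t₀ b) (reflect M t₀ c) (-reflect M t₀ d)
      (-reflect M t₀ e) (reflect M t₀ u) where
  mem := h.mem.reflect hM le_rfl
  integrable x := by
    simp only [rhs_reflect]
    have := ((h.integrable (M - x)).comp_sub_left t₀).symm.neg
    simp only [sub_zero, sub_self] at this
    exact this
  eq t ht x := by
    simp only [rhs_reflect]
    have e1 := h.eq (t₀ - t) (sub_mem_Icc ht) (M - x)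
    have e2 := h.eq t₀ ⟨h0.le, le_rfl⟩ (M - x)
    have e3 := intervalIntegral.integral_comp_sub_left (a := 0) (b := t)
      (fun s => rhs a b c d e u s (M - x)) t₀
    have i1 := intervalIntegrable_of_mem (sub_mem_Icc ht) (h.integrable (M - x))
    have e4 := intervalIntegral.integral_interval_sub_left (h.integrable (M - x)) i1
    rw [sub_zero] at e3
    rw [intervalIntegral.integral_neg, e3, ← e4, PeriodicDispersion.reflect,
      PeriodicDispersion.reflect, sub_zero, e1, e2]
    ring

theorem isSolution_reflect_iff (hM : 0 < M) (h0 : 0 < t₀) :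
    IsSolution M t₀ n a b c d e u ↔
      IsSolution M t₀ n (reflect M t₀ a) (-reflect M t₀ b) (reflect M t₀ c) (-reflect M t₀ d)
        (-reflect M t₀ e) (reflect M t₀ u) := by
  refine ⟨fun h => h.reflect hM h0, fun h => ?_⟩
  have := h.reflect hM h0
  simpa only [reflect_neg, reflect_reflect, neg_neg] using this

end Reflection

/-! ### Continuity in time -/

section Continuity

variable {M T : ℝ} {n : ℕ} {a b c d e u : ℝ → ℝ → ℝ}

/-- By uniqueness the given solution coincides with the one constructed from its initial value,
which is strongly continuous at time 0. -/
theorem IsSolution.tendsto_zero (hn : 4 ≤ n) (hM : 0 < M) (hT : 0 < T)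
    (h : Admissible M T n a b c d e) (havg : ∀ t ∈ Icc 0 T, avgDiffusion M a b t = 0)
    (hu : IsSolution M T n a b c d e u) (hu0 : MemH M n (u 0)) :
    Tendsto (fun τ => normH M n (fun x => u τ x - u 0 x)) (𝓝[Icc 0 T] 0) (𝓝 0) := by
  have : Fact (0 < M) := ⟨hM⟩
  have H := h.coeffBounds hn hM hT havg
  have hn0 : 0 < n := by omega
  have h00 : (0 : ℝ) ∈ Icc 0 T := ⟨le_rfl, hT.le⟩
  obtain ⟨w, h0, hw, -, hl⟩ := H.exists_solution h.e_mem hu0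
  have key : ∀ t ∈ Icc 0 T, u t = profile n (w t) := fun t ht => funext fun x =>
    hu.eq_profile H h.e_mem hw (fun y => by rw [h0, profile_sob hn0 hu0]) ht x
  have h1 := ((hl.sub_const (w 0)).norm).const_mul (Real.sqrt M)
  rw [sub_self, norm_zero, mul_zero] at h1
  refine h1.congr' ?_
  filter_upwards [self_mem_nhdsWithin] with t ht
  rw [key t ht, key 0 h00]
  simp only [sub_profile]
  exact (normH_profile hn0 (by rw [map_sub, hw.real t ht, hw.real 0 h00])).symm

/-- Reflection at time t turns u into a solution of an admissible equation with initial value in Hⁿ,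
and the approach from the left becomes the approach to time 0 from the right. -/
theorem IsSolution.tendsto_left (hn : 4 ≤ n) (hM : 0 < M)
    (h : Admissible M T n a b c d e) (havg : ∀ t ∈ Icc 0 T, avgDiffusion M a b t = 0)
    (hu : IsSolution M T n a b c d e u) {t : ℝ} (h0 : 0 < t) (hT : t ≤ T) (hut : MemH M n (u t)) :
    Tendsto (fun τ => normH M n (fun x => u τ x - u t x)) (𝓝[Icc 0 t] t) (𝓝 0) := by
  have h1 := ((hu.restrict h0 hT).reflect hM h0).tendsto_zero hn hM h0 (h.reflect hM h0 hT)
    (avgDiffusion_reflect_eq_zero hT havg) (by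
      have := hut.reflect hM
      rwa [show (fun x => u t (M - x)) = PeriodicDispersion.reflect M t u 0 from
        funext fun x => by simp only [PeriodicDispersion.reflect, sub_zero]] at this)
  have h2 := tendsto_sub_nhdsWithin (t₀ := t) (p := 0) (q := t) (p' := 0) (q' := t) (t := t)
    (by simp) (by simp)
  rw [sub_self] at h2
  refine (h1.comp h2).congr fun τ => ?_
  simp only [Function.comp_apply, PeriodicDispersion.reflect, sub_sub_cancel, sub_zero]
  exact normH_reflect hM n (fun x => u τ x - u t x)

/-- Reflection at the final time T exchanges left and right, which reduces the claim to continuity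
from the left at T - t > 0. -/
theorem IsSolution.tendsto_right (hn : 4 ≤ n) (hM : 0 < M) (hT : 0 < T)
    (h : Admissible M T n a b c d e) (havg : ∀ t ∈ Icc 0 T, avgDiffusion M a b t = 0)
    (hu : IsSolution M T n a b c d e u) {t : ℝ} (h0 : 0 ≤ t) (ht : t < T) (hut : MemH M n (u t)) :
    Tendsto (fun τ => normH M n (fun x => u τ x - u t x)) (𝓝[Icc t T] t) (𝓝 0) := by
  have h1 := (hu.reflect hM hT).tendsto_left hn hM (h.reflect hM hT le_rfl)
    (avgDiffusion_reflect_eq_zero le_rfl havg) (t := T - t) (by linarith) (by linarith) (by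
      have := hut.reflect hM
      rwa [show (fun x => u t (M - x)) = PeriodicDispersion.reflect M T u (T - t) from
        funext fun x => by simp only [PeriodicDispersion.reflect, sub_sub_cancel]] at this)
  have h2 := tendsto_sub_nhdsWithin (t₀ := T) (p := t) (q := T) (p' := 0) (q' := T - t) (t := t)
    (by simp) (by simp)
  refine (h1.comp h2).congr fun τ => ?_
  simp only [Function.comp_apply, PeriodicDispersion.reflect, sub_sub_cancel]
  exact normH_reflect hM n (fun x => u τ x - u t x)

theorem IsSolution.memCH (hn : 4 ≤ n) (hM : 0 < M) (hT : 0 < T)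
    (h : Admissible M T n a b c d e) (havg : ∀ t ∈ Icc 0 T, avgDiffusion M a b t = 0)
    (hu : IsSolution M T n a b c d e u) (hmem : ∀ t ∈ Icc 0 T, MemH M n (u t)) :
    MemCH M T n u where
  mem := hmem
  tendsto t ht := by
    rcases ht.1.eq_or_lt with h0 | h0
    · subst h0
      exact hu.tendsto_zero hn hM hT h havg (hmem _ ht)
    rcases ht.2.eq_or_lt with h1 | h1
    · subst h1
      exact hu.tendsto_left hn hM h havg h0 le_rfl (hmem _ ht)
    · rw [← Icc_union_Icc_eq_Icc ht.1 ht.2, nhdsWithin_union]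
      exact (hu.tendsto_left hn hM h havg h0 ht.2 (hmem _ ht)).sup
        (hu.tendsto_right hn hM hT h havg ht.1 h1 (hmem _ ht))

theorem MemCH.mono (hM : 0 < M) (hn : 0 < n) {s : ℝ} (hs : s ≤ n) (h : MemCH M T n u) :
    MemCH M T s u where
  mem t ht := have : Fact (0 < M) := ⟨hM⟩; (h.mem t ht).mono hn hs
  tendsto t ht := by
    have : Fact (0 < M) := ⟨hM⟩
    refine squeeze_zero' (Eventually.of_forall fun _ => normH_nonneg _ _ _) ?_ (h.tendsto t ht)
    filter_upwards [self_mem_nhdsWithin] with τ hτ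
    exact normH_mono hs ((h.mem τ hτ).sub hn (h.mem t ht)).summable

end Continuity

/-! ### The solution map -/

/-- The constant in the estimates for the solution map. -/
def solutionConst (r : ℝ) : ℝ := growthConst r * (1 + |r|) + 1

theorem growthConst_nonneg (r : ℝ) : 0 ≤ growthConst r := Real.sqrt_nonneg _

theorem solutionConst_pos (r : ℝ) : 0 < solutionConst r := by
  have := growthConst_nonneg r
  unfold solutionConst
  positivity

theorem normLinftyH_le_dataSize {M T : ℝ} (hM : 0 ≤ M) (hT : 0 ≤ T) (n : ℕ)
    (a b c d e : ℝ → ℝ → ℝ) : normLinftyH M T n e ≤ dataSize M T n a b c d e := by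
  have h1 := normW_nonneg T (n + 3) a
  have h2 := normW_nonneg T 1 (timeDeriv T a)
  have h3 := normW_nonneg T 0 (fun t x => (a t x)⁻¹)
  have h4 := normW_nonneg T n b
  have h5 := normW_nonneg T 0 (timeDeriv T b)
  have h6 := normW_nonneg T n c
  have h7 := normW_nonneg T n d
  have h9 : (0 : ℝ) ≤ n := Nat.cast_nonneg n
  unfold dataSize
  linarith

/-- Here x is the norm of the initial value and y that of the source, which is itself at most the
data size r; this turns the bound into the form K(‖u₀‖ + 1). -/
theorem growthConst_mul_le {r x y : ℝ} (hx : 0 ≤ x) (hy : y ≤ r) :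
    growthConst r * (x + y) ≤ solutionConst r * (x + 1) := by
  have hr := hy.trans (le_abs_self r)
  have hg := growthConst_nonneg r
  have h1 : x + y ≤ (1 + |r|) * (x + 1) := by nlinarith [abs_nonneg r]
  calc growthConst r * (x + y) ≤ growthConst r * ((1 + |r|) * (x + 1)) := by gcongr
    _ ≤ _ := by
      unfold solutionConst
      nlinarith

end PeriodicDispersion

end

theorem theorem2p3 :
    ∃ K : ℝ → ℝ, (∀ r, 0 < K r) ∧
      ∀ (n : ℕ) (M T : ℝ) (a b c d e : ℝ → ℝ → ℝ),
        4 ≤ n → 0 < M → 0 < T →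
        PeriodicDispersion.Admissible M T n a b c d e →
        (∀ t ∈ Set.Icc 0 T, PeriodicDispersion.avgDiffusion M a b t = 0) →
        -- reversibility under `(x,t) ↦ (M - x, t₀ - t)`
        (∀ t₀ : ℝ, 0 < t₀ → t₀ ≤ T →
          PeriodicDispersion.Admissible M t₀ n
            (PeriodicDispersion.reflect M t₀ a) (-PeriodicDispersion.reflect M t₀ b)
            (PeriodicDispersion.reflect M t₀ c) (-PeriodicDispersion.reflect M t₀ d)
            (-PeriodicDispersion.reflect M t₀ e) ∧
          (∀ t ∈ Set.Icc 0 t₀,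
            PeriodicDispersion.avgDiffusion M (PeriodicDispersion.reflect M t₀ a)
              (-PeriodicDispersion.reflect M t₀ b) t = 0) ∧
          ∀ u : ℝ → ℝ → ℝ,
            PeriodicDispersion.IsSolution M t₀ n a b c d e u ↔
            PeriodicDispersion.IsSolution M t₀ n
              (PeriodicDispersion.reflect M t₀ a) (-PeriodicDispersion.reflect M t₀ b)
              (PeriodicDispersion.reflect M t₀ c) (-PeriodicDispersion.reflect M t₀ d)
              (-PeriodicDispersion.reflect M t₀ e) (PeriodicDispersion.reflect M t₀ u)) ∧
        -- the solution map
        ∃ Ψ : (ℝ → ℝ) → ℝ → ℝ → ℝ,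
          -- continuity from `H^n` to `L^∞([0,T]; H^n)`
          (∀ u₀, PeriodicDispersion.MemH M n u₀ → ∀ ε : ℝ, 0 < ε → ∃ η : ℝ, 0 < η ∧
            ∀ v₀, PeriodicDispersion.MemH M n v₀ →
              PeriodicDispersion.normH M n (fun x => v₀ x - u₀ x) < η →
              PeriodicDispersion.normLinftyH M T n (fun t x => Ψ v₀ t x - Ψ u₀ t x) < ε) ∧
          ∀ u₀, PeriodicDispersion.MemH M n u₀ →
            PeriodicDispersion.MemLinftyH M T n (Ψ u₀) ∧
            PeriodicDispersion.normLinftyH M T n (Ψ u₀) ≤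
              K (PeriodicDispersion.dataSize M T n a b c d e) *
                (PeriodicDispersion.normH M n u₀ + 1) ∧
            (∀ s : ℝ, 0 ≤ s → s < n →
              PeriodicDispersion.MemCH M T s (Ψ u₀) ∧
              ∀ t ∈ Set.Icc 0 T, PeriodicDispersion.normH M s (Ψ u₀ t) ≤
                K (PeriodicDispersion.dataSize M T n a b c d e) *
                  (PeriodicDispersion.normH M n u₀ + 1)) ∧
            (∀ x, Ψ u₀ 0 x = u₀ x) ∧
            PeriodicDispersion.IsSolution M T n a b c d e (Ψ u₀) ∧
            (∀ v : ℝ → ℝ → ℝ, PeriodicDispersion.IsSolution M T n a b c d e v →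
              (∀ x, v 0 x = u₀ x) → ∀ t ∈ Set.Icc 0 T, ∀ x, v t x = Ψ u₀ t x) ∧
            -- the additional regularity
            PeriodicDispersion.MemCH M T n (Ψ u₀) := by
  open PeriodicDispersion in
  refine ⟨solutionConst, solutionConst_pos, fun n M T a b c d e hn hM hT h havg =>
    ⟨fun t₀ h0 ht₀ => ⟨h.reflect hM h0 ht₀, avgDiffusion_reflect_eq_zero ht₀ havg,
      fun u => isSolution_reflect_iff hM h0⟩, ?_⟩⟩
  have : Fact (0 < M) := ⟨hM⟩
  have hn0 : 0 < n := by omega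
  have H := h.coeffBounds hn hM hT havg
  have h00 : (0 : ℝ) ∈ Set.Icc 0 T := ⟨le_rfl, hT.le⟩
  obtain ⟨r, hr⟩ : ∃ r, r = PeriodicDispersion.dataSize M T n a b c d e := ⟨_, rfl⟩
  have her : PeriodicDispersion.normLinftyH M T n e ≤ r :=
    hr ▸ PeriodicDispersion.normLinftyH_le_dataSize hM.le hT.le n a b c d e
  rw [← hr] at H ⊢
  -- Outside Hⁿ the chosen evolution is arbitrary; every claim about the solution map concerns
  -- initial values in Hⁿ.
  choose! w hw0 hw hwb _ using
    fun (u₀ : ℝ → ℝ) (hu : PeriodicDispersion.MemH M n u₀) => H.exists_solution h.e_mem hu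
  refine ⟨fun u₀ t => PeriodicDispersion.profile n (w u₀ t), ?_, ?_⟩
  · intro u₀ hu ε hε
    have hg := PeriodicDispersion.growthConst_nonneg r
    -- The solution map is Lipschitz with constant `growthConst r`; the added 1 keeps the
    -- denominator positive and the final inequality strict.
    refine ⟨ε / (PeriodicDispersion.growthConst r + 1), by positivity, fun v₀ hv hlt => ?_⟩
    refine lt_of_le_of_lt (PeriodicDispersion.normLinftyH_le (B := PeriodicDispersion.growthConst r
      * PeriodicDispersion.normH M n (fun x => v₀ x - u₀ x)) hT fun t ht => ?_).2 ?_
    · simp only [PeriodicDispersion.sub_profile]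
      have e1 := H.norm_sub_le h.e_mem (hw v₀ hv) (hw u₀ hu) ht
      rw [hw0 v₀ hv, hw0 u₀ hu] at e1
      refine (PeriodicDispersion.normH_profile hn0
        (by rw [map_sub, (hw v₀ hv).real t ht, (hw u₀ hu).real t ht])).trans_le ?_
      rw [PeriodicDispersion.normH_sub hn0 hv hu, mul_left_comm]
      exact mul_le_mul_of_nonneg_left e1 (Real.sqrt_nonneg M)
    · rw [lt_div_iff₀ (by positivity)] at hlt
      have := PeriodicDispersion.normH_nonneg M n (fun x => v₀ x - u₀ x)
      nlinarith
  · intro u₀ hu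
    have hsol := (hw u₀ hu).isSolution H h.e_mem
    have hmem : ∀ t ∈ Set.Icc 0 T,
        PeriodicDispersion.MemH M n (PeriodicDispersion.profile n (w u₀ t)) := fun t ht =>
      PeriodicDispersion.memH_profile hn0 ((hw u₀ hu).real t ht)
    have hbd : ∀ t ∈ Set.Icc 0 T,
        PeriodicDispersion.normH M n (PeriodicDispersion.profile n (w u₀ t))
          ≤ PeriodicDispersion.solutionConst r * (PeriodicDispersion.normH M n u₀ + 1) :=
      fun t ht => (hwb u₀ hu t ht).trans
        (PeriodicDispersion.growthConst_mul_le (PeriodicDispersion.normH_nonneg _ _ _) her)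
    have hCH := hsol.memCH hn hM hT h havg hmem
    have hinit : PeriodicDispersion.profile n (w u₀ 0) = u₀ := by
      rw [hw0 u₀ hu, PeriodicDispersion.profile_sob hn0 hu]
    refine ⟨hsol.mem, (PeriodicDispersion.normLinftyH_le hT hbd).2,
      fun s _ hs => ⟨hCH.mono hM hn0 hs.le, fun t ht =>
        (PeriodicDispersion.normH_mono hs.le (hmem t ht).summable).trans (hbd t ht)⟩,
      fun x => congrFun hinit x, hsol, fun v hv hv0 t ht x =>
        hv.eq_profile H h.e_mem (hw u₀ hu) (fun y => by rw [hinit, hv0]) ht x, hCH⟩
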